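/- Graphs are finite and simple. A dissociation set of a graph $G$ is a set of vertices inducing a subgraph of maximum degree at most $1$; the dissociation number $\psi(G)$ is the maximum cardinality of a dissociation set, and $\Phi(G)$ is the number of dissociation sets of cardinality $\psi(G)$. $P_n$ denotes the path on $n$ vertices. Let $\mathcal{T}_1$ be the family of trees obtained, for some integer $k\ge 0$, from the disjoint union of two copies of $P_2$ and $k$ copies of $P_3$ by fixing a copy of $P_2$ and a vertex $v_o$ in it, and adding edges joining $v_o$ to exactly one (arbitrary) vertex in each of the other copies of $P_2$ and $P_3$. Let $\mathcal{T}_2$ be the family of trees obtained, for some integer $j\ge 0$, from the disjoint union of $j+1$ copies of $P_3$ by fixing a copy of $P_3$ and a leaf $v_e$ of it, and adding edges joining $v_e$ to exactly one leaf of each of the other copies of $P_3$. Theorem. Let $T$ be a tree with dissociation number $\psi$. (1) If $\psi=1$, then $\Phi(T)=1$. (2) If $\psi$ is odd and $\psi\ge 3$, then $\Phi(T)\le 3^{\frac{\psi-1}{2}-1}+1$, with equality if and only if $T$ is isomorphic to a tree in $\mathcal{T}_1$. (3) If $\psi$ is even, then $\Phi(T)\le 3^{\frac{\psi}{2}-1}+\frac{\psi}{2}+1$,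 with equality if and only if $T$ is isomorphic to a tree in $\mathcal{T}_2$. -/

import Mathlib

/-- `s` is a dissociation set of `G`: every vertex of the subgraph induced on `s` has degree
at most `1` in that subgraph. -/
def IsDissociationSet {V : Type*} (G : SimpleGraph V) (s : Set V) : Prop :=
  ∀ v : s, ((G.induce s).neighborSet v).encard ≤ 1

/-- A (finite) dissociation set of maximum cardinality. -/
def IsMaximumDissociationSet {V : Type*} (G : SimpleGraph V) (F : Finset V) : Prop :=
  IsDissociationSet G (F : Set V) ∧
    ∀ F' : Finset V, IsDissociationSet G (F' : Set V) → F'.card ≤ F.card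

/-- The dissociation number: the maximum cardinality of a dissociation set. It is only used for
graphs on a finite vertex type, where the set below is nonempty and bounded. -/
noncomputable def dissociationNumber {V : Type*} (G : SimpleGraph V) : ℕ :=
  sSup {n | ∃ F : Finset V, IsDissociationSet G (F : Set V) ∧ F.card = n}

/-- The number of maximum dissociation sets. -/
noncomputable def numMaximumDissociationSets {V : Type*} (G : SimpleGraph V) : ℕ :=
  {F : Finset V | IsMaximumDissociationSet G F}.ncard

/-- `v` is a leaf of `G`: it has degree `1`. -/
def IsLeafVertex {V : Type*} (G : SimpleGraph V) (v : V) : Prop :=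
  (G.neighborSet v).encard = 1

/-- The disjoint union of `n` copies of `G`. -/
def copies {V : Type*} (n : ℕ) (G : SimpleGraph V) : SimpleGraph (Fin n × V) where
  Adj x y := x.1 = y.1 ∧ G.Adj x.2 y.2
  symm := ⟨fun _ _ h => ⟨h.1.symm, h.2.symm⟩⟩
  loopless := ⟨fun _ h => G.irrefl h.2⟩

/-- The graph `G` with edges added that join `v` to every vertex of `S` (other than `v`). -/
def addEdgesFrom {V : Type*} (G : SimpleGraph V) (v : V) (S : Set V) : SimpleGraph V :=
  G ⊔ SimpleGraph.fromRel fun x y => x = v ∧ y ∈ S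

/-- The trees of the first family, built from `2P₂ ∪ kP₃`. The fixed copy of `P₂` is copy `0`, and
`o` is its chosen vertex; `b` is the chosen vertex of the other copy of `P₂`, and `c i` is the
chosen vertex of the `i`-th copy of `P₃`. -/
def treeOne (k : ℕ) (o b : Fin 2) (c : Fin k → Fin 3) :
    SimpleGraph ((Fin 2 × Fin 2) ⊕ (Fin k × Fin 3)) :=
  addEdgesFrom (copies 2 (SimpleGraph.pathGraph 2) ⊕g copies k (SimpleGraph.pathGraph 3))
    (Sum.inl (0, o)) ({Sum.inl (1, b)} ∪ Set.range fun i => Sum.inr (i, c i))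

/-- `T` is isomorphic to a tree in the first family. -/
def InFamilyOne {V : Type*} (T : SimpleGraph V) : Prop :=
  ∃ (k : ℕ) (o b : Fin 2) (c : Fin k → Fin 3), Nonempty (T ≃g treeOne k o b c)

/-- The trees of the second family, built from `(j+1)P₃`. The fixed copy of `P₃` is copy `0`, and
`e` is its chosen vertex; `c i` is the chosen vertex of the `i`-th of the other `j` copies. -/
def treeTwo (j : ℕ) (e : Fin 3) (c : Fin j → Fin 3) : SimpleGraph (Fin (j + 1) × Fin 3) :=
  addEdgesFrom (copies (j + 1) (SimpleGraph.pathGraph 3)) (0, e)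
    (Set.range fun i => (i.succ, c i))

/-- `T` is isomorphic to a tree in the second family: the chosen vertices in `treeTwo` are leaves
of their copies of `P₃`. -/
def InFamilyTwo {V : Type*} (T : SimpleGraph V) : Prop :=
  ∃ (j : ℕ) (e : Fin 3) (c : Fin j → Fin 3),
    IsLeafVertex (SimpleGraph.pathGraph 3) e ∧
    (∀ i, IsLeafVertex (SimpleGraph.pathGraph 3) (c i)) ∧
    Nonempty (T ≃g treeTwo j e c)

/-! Cut a tree at an edge `rc` into a part `R` and a pendant part `C`. If some maximum dissociation
set of `C` avoids `c`, then ψ is additive, and `Link.num_union` computes the number of maximum sets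
of the whole from the numbers, on each side, of those that avoid the end of the edge, contain it, or
contain it isolated. A smallest `C` with at least three vertices has one of four shapes
(`exists_pendant`): P₃ attached at its centre, P₃ attached at an end, P₄ attached at an inner
vertex, or a rigid piece whose only maximum set avoids `c`. Exactly one maximum set of `C` avoids
`c` in each case. With `a = numAvoid R r` and `i = numIso R r`, the number of maximum sets therefore
grows by `2a`, `2a + i`, `a` and `0` respectively, while ψ grows by 2, 2, 3 and at least 3.

It remains to bound `a` and `i`. If `v` can be avoided, no maximum set of `U \ {v}` can be extended
by `v`. Exchanging sets branch by branch, this forces two vertices of `U \ {v}` whose successive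
deletion lowers ψ by two and loses no maximum set. With the crude forest bound `3 ^ ⌊ψ/2⌋`
(`num_le_three_pow`) this gives `3a ≤ 3 ^ ⌊ψ/2⌋` (`three_mul_numAvoid_le`), enough for every shape
except the P₃ attached at an end. There one wants `2a + i ≤ 2 * 3 ^ (⌊ψ/2⌋ - 1)`. By
`two_mul_numAvoid_add_numIso_le` this can fail only if the tree is a P₃ ending at `v` with further
P₃'s attached to `v`. Then `a = 3 ^ n` and `i = 1`, and each P₃ attached by an end contributes an
extra 1: this is the source of the linear term in the even bound.

For equality, `Grow` describes the trees made from a core by attaching P₃'s at one vertex, the core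
being P₄ for odd ψ and P₃ for even ψ. In the odd case just one maximum set contains the centre,
which determines where the next P₃ is attached (`Grow.recentre`). `Copies` translates between `Grow`
and the explicit families. -/

namespace Dissociation

open scoped Classical
open Finset

variable {V : Type*} {G : SimpleGraph V}

/-! ### Dissociation sets of induced subgraphs and their counts -/

/-- The finite set `S` induces a subgraph of maximum degree at most one. -/
def Diss (G : SimpleGraph V) (S : Finset V) : Prop :=
  ∀ v ∈ S, ∀ a ∈ S, ∀ b ∈ S, G.Adj v a → G.Adj v b → a = b

/-- No edge of `G` joins a vertex of `A` to a vertex of `B`. -/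
def NoEdge (G : SimpleGraph V) (A B : Finset V) : Prop :=
  ∀ a ∈ A, ∀ b ∈ B, ¬ G.Adj a b

/-- The vertex `v` has no neighbour in `S`. -/
def Isolated (G : SimpleGraph V) (v : V) (S : Finset V) : Prop :=
  ∀ a ∈ S, ¬ G.Adj v a

/-- The dissociation number of the subgraph induced on `U`. -/
noncomputable def psi (G : SimpleGraph V) (U : Finset V) : ℕ :=
  (U.powerset.filter (Diss G)).sup card

/-- The maximum dissociation sets of the subgraph induced on `U`. -/
noncomputable def maxDiss (G : SimpleGraph V) (U : Finset V) : Finset (Finset V) :=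
  U.powerset.filter fun S => Diss G S ∧ S.card = psi G U

/-- The number of maximum dissociation sets of the subgraph induced on `U`. -/
noncomputable def num (G : SimpleGraph V) (U : Finset V) : ℕ := (maxDiss G U).card

/-- The number of maximum dissociation sets that avoid `v`. -/
noncomputable def numAvoid (G : SimpleGraph V) (U : Finset V) (v : V) : ℕ :=
  ((maxDiss G U).filter fun S => v ∉ S).card

/-- The number of maximum dissociation sets that contain `v`. -/
noncomputable def numMem (G : SimpleGraph V) (U : Finset V) (v : V) : ℕ :=
  ((maxDiss G U).filter fun S => v ∈ S).card

/-- The number of maximum dissociation sets that contain `v` as an isolated vertex. -/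
noncomputable def numIso (G : SimpleGraph V) (U : Finset V) (v : V) : ℕ :=
  ((maxDiss G U).filter fun S => v ∈ S ∧ Isolated G v S).card

lemma Diss.mono {S T : Finset V} (h : Diss G T) (hs : S ⊆ T) : Diss G S :=
  fun v hv a ha b hb => h v (hs hv) a (hs ha) b (hs hb)

lemma diss_empty : Diss G ∅ := fun v hv => by simp at hv

lemma NoEdge.symm {A B : Finset V} (h : NoEdge G A B) : NoEdge G B A :=
  fun a ha b hb hab => h b hb a ha hab.symm

lemma NoEdge.mono {A B A' B' : Finset V} (h : NoEdge G A B) (ha : A' ⊆ A) (hb : B' ⊆ B) :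
    NoEdge G A' B' := fun a h1 b h2 => h a (ha h1) b (hb h2)

lemma Diss.union {A B : Finset V} (hA : Diss G A) (hB : Diss G B) (h : NoEdge G A B) :
    Diss G (A ∪ B) := by
  intro v hv a ha b hb hva hvb
  rw [mem_union] at hv ha hb
  rcases hv with hv | hv
  · have ha' : a ∈ A := ha.resolve_right fun q => h v hv a q hva
    have hb' : b ∈ A := hb.resolve_right fun q => h v hv b q hvb
    exact hA v hv a ha' b hb' hva hvb
  · have ha' : a ∈ B := ha.resolve_left fun q => h a q v hv hva.symm
    have hb' : b ∈ B := hb.resolve_left fun q => h b q v hv hvb.symm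
    exact hB v hv a ha' b hb' hva hvb

lemma diss_of_card_le_two {S : Finset V} (h : S.card ≤ 2) : Diss G S := by
  intro v hv a ha b hb hva hvb
  by_contra hab
  have : ({v, a, b} : Finset V) ⊆ S := by
    intro z hz
    simp only [mem_insert, mem_singleton] at hz
    rcases hz with rfl | rfl | rfl <;> assumption
  have h3 : ({v, a, b} : Finset V).card = 3 := card_eq_three.2 ⟨v, a, b, hva.ne, hvb.ne, hab, rfl⟩
  have := card_le_card this
  omega

lemma le_psi {S U : Finset V} (hS : S ⊆ U) (hd : Diss G S) : S.card ≤ psi G U :=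
  le_sup (f := card) (mem_filter.2 ⟨mem_powerset.2 hS, hd⟩)

lemma mem_maxDiss {S U : Finset V} :
    S ∈ maxDiss G U ↔ S ⊆ U ∧ Diss G S ∧ S.card = psi G U := by
  simp [maxDiss]

lemma maxDiss_nonempty (U : Finset V) : (maxDiss G U).Nonempty := by
  have hne : (U.powerset.filter (Diss G)).Nonempty :=
    ⟨∅, mem_filter.2 ⟨mem_powerset.2 (empty_subset _), diss_empty⟩⟩
  obtain ⟨S, hS, h⟩ := exists_mem_eq_sup _ hne card
  rw [mem_filter, mem_powerset] at hS
  exact ⟨S, mem_maxDiss.2 ⟨hS.1, hS.2, h.symm⟩⟩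

lemma mem_maxDiss_of_le {S U : Finset V} (h1 : S ⊆ U) (h2 : Diss G S) (h3 : psi G U ≤ S.card) :
    S ∈ maxDiss G U := mem_maxDiss.2 ⟨h1, h2, le_antisymm (le_psi h1 h2) h3⟩

lemma psi_le {U : Finset V} {n : ℕ} (h : ∀ S ⊆ U, Diss G S → S.card ≤ n) : psi G U ≤ n := by
  obtain ⟨S, hS⟩ := maxDiss_nonempty (G := G) U
  rw [mem_maxDiss] at hS
  exact hS.2.2 ▸ h S hS.1 hS.2.1

lemma psi_mono {A B : Finset V} (h : A ⊆ B) : psi G A ≤ psi G B :=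
  psi_le fun _ hS hd => le_psi (hS.trans h) hd

lemma psi_le_card (U : Finset V) : psi G U ≤ U.card := psi_le fun _ hS _ => card_le_card hS

lemma psi_of_card_le_two {U : Finset V} (h : U.card ≤ 2) : psi G U = U.card :=
  le_antisymm (psi_le_card U) (le_psi subset_rfl (diss_of_card_le_two h))

lemma two_le_psi {U : Finset V} (h : 2 ≤ U.card) : 2 ≤ psi G U := by
  obtain ⟨S, hS, hc⟩ := exists_subset_card_eq h
  exact hc ▸ le_psi hS (diss_of_card_le_two hc.le)

lemma psi_pos {U : Finset V} (h : U.Nonempty) : 1 ≤ psi G U := by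
  obtain ⟨x, hx⟩ := h
  have : ({x} : Finset V).card ≤ psi G U :=
    le_psi (singleton_subset_iff.2 hx) (diss_of_card_le_two (by simp))
  simpa using this

lemma maxDiss_of_diss {U : Finset V} (h : Diss G U) : maxDiss G U = {U} := by
  have hp : psi G U = U.card := le_antisymm (psi_le_card U) (le_psi subset_rfl h)
  ext S
  rw [mem_maxDiss, mem_singleton, hp]
  constructor
  · rintro ⟨h1, -, h3⟩
    exact eq_of_subset_of_card_le h1 h3.ge
  · rintro rfl
    exact ⟨subset_rfl, h, rfl⟩

lemma num_of_diss {U : Finset V} (h : Diss G U) : num G U = 1 := by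
  rw [num, maxDiss_of_diss h, card_singleton]

lemma numAvoid_add_numMem (U : Finset V) (v : V) : numAvoid G U v + numMem G U v = num G U := by
  rw [numAvoid, numMem, num, add_comm]
  exact card_filter_add_card_filter_not (fun S : Finset V => v ∈ S)

lemma numIso_le_numMem (U : Finset V) (v : V) : numIso G U v ≤ numMem G U v := by
  refine card_le_card fun S hS => ?_
  rw [mem_filter] at hS ⊢
  exact ⟨hS.1, hS.2.1⟩

lemma psi_union_le (A B : Finset V) : psi G (A ∪ B) ≤ psi G A + psi G B := by
  refine psi_le fun S hS hd => ?_
  have h1 := le_psi (inter_subset_right : S ∩ A ⊆ A) (hd.mono inter_subset_left)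
  have h2 := le_psi (inter_subset_right : S ∩ B ⊆ B) (hd.mono inter_subset_left)
  have h3 : S = (S ∩ A) ∪ (S ∩ B) := by
    rw [← inter_union_distrib_left, inter_eq_left.2 hS]
  have h4 := card_union_le (S ∩ A) (S ∩ B)
  rw [← h3] at h4
  omega

/-! ### Partitions of the vertex set over which ψ is additive -/

section Cut

variable {A B : Finset V}

lemma union_inter_left_cancel (hAB : Disjoint A B) {S T : Finset V} (hS : S ⊆ A) (hT : T ⊆ B) :
    (S ∪ T) ∩ A = S := by
  rw [union_inter_distrib_right, inter_eq_left.2 hS,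
    disjoint_iff_inter_eq_empty.1 (hAB.symm.mono_left hT), union_empty]

lemma union_inter_right_cancel (hAB : Disjoint A B) {S T : Finset V} (hS : S ⊆ A) (hT : T ⊆ B) :
    (S ∪ T) ∩ B = T := by
  rw [union_comm]
  exact union_inter_left_cancel hAB.symm hT hS

lemma inter_union_inter_cancel {S : Finset V} (hS : S ⊆ A ∪ B) : (S ∩ A) ∪ (S ∩ B) = S := by
  rw [← inter_union_distrib_left, inter_eq_left.2 hS]

lemma inter_mem_maxDiss (hAB : Disjoint A B) (hp : psi G (A ∪ B) = psi G A + psi G B)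
    {S : Finset V} (hS : S ∈ maxDiss G (A ∪ B)) :
    S ∩ A ∈ maxDiss G A ∧ S ∩ B ∈ maxDiss G B := by
  rw [mem_maxDiss] at hS
  obtain ⟨h1, h2, h3⟩ := hS
  have hA := le_psi (inter_subset_right : S ∩ A ⊆ A) (h2.mono inter_subset_left)
  have hB := le_psi (inter_subset_right : S ∩ B ⊆ B) (h2.mono inter_subset_left)
  have hc : S.card = (S ∩ A).card + (S ∩ B).card := by
    rw [← card_union_of_disjoint (hAB.mono inter_subset_right inter_subset_right),
      inter_union_inter_cancel h1]
  exact ⟨mem_maxDiss.2 ⟨inter_subset_right, h2.mono inter_subset_left, by omega⟩,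
    mem_maxDiss.2 ⟨inter_subset_right, h2.mono inter_subset_left, by omega⟩⟩

lemma union_mem_maxDiss (hAB : Disjoint A B) (hp : psi G (A ∪ B) = psi G A + psi G B)
    {S T : Finset V} (hS : S ∈ maxDiss G A) (hT : T ∈ maxDiss G B) (hd : Diss G (S ∪ T)) :
    S ∪ T ∈ maxDiss G (A ∪ B) := by
  rw [mem_maxDiss] at hS hT ⊢
  refine ⟨union_subset_union hS.1 hT.1, hd, ?_⟩
  rw [card_union_of_disjoint (hAB.mono hS.1 hT.1), hS.2.2, hT.2.2, hp]

/-- When ψ is additive, a maximum set must be maximum on both sides, so `S ↦ (S ∩ A, S ∩ B)` is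
injective. Its image is the set of pairs whose union is still a dissociation set. All later counts
specialise `p`. -/
lemma card_filter_maxDiss_union (hAB : Disjoint A B)
    (hp : psi G (A ∪ B) = psi G A + psi G B) (p : Finset V → Prop) [DecidablePred p]
    [DecidablePred fun x : Finset V × Finset V => Diss G (x.1 ∪ x.2) ∧ p (x.1 ∪ x.2)] :
    ((maxDiss G (A ∪ B)).filter p).card =
      ((maxDiss G A ×ˢ maxDiss G B).filter
        fun x => Diss G (x.1 ∪ x.2) ∧ p (x.1 ∪ x.2)).card := by
  refine card_bij' (fun S _ => (S ∩ A, S ∩ B)) (fun x _ => x.1 ∪ x.2) ?_ ?_ ?_ ?_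
  · intro S hS
    rw [mem_filter] at hS
    have h := inter_mem_maxDiss hAB hp hS.1
    have hm := mem_maxDiss.1 hS.1
    simp only [mem_filter, mem_product]
    rw [inter_union_inter_cancel hm.1]
    exact ⟨h, hm.2.1, hS.2⟩
  · rintro ⟨S, T⟩ hx
    simp only [mem_filter, mem_product] at hx ⊢
    exact ⟨union_mem_maxDiss hAB hp hx.1.1 hx.1.2 hx.2.1, hx.2.2⟩
  · intro S hS
    rw [mem_filter] at hS
    exact inter_union_inter_cancel (mem_maxDiss.1 hS.1).1
  · rintro ⟨S, T⟩ hx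
    simp only [mem_filter, mem_product] at hx
    have hS := (mem_maxDiss.1 hx.1.1).1
    have hT := (mem_maxDiss.1 hx.1.2).1
    simp only [union_inter_left_cancel hAB hS hT, union_inter_right_cancel hAB hS hT]

lemma num_union_eq_card (hAB : Disjoint A B) (hp : psi G (A ∪ B) = psi G A + psi G B) :
    num G (A ∪ B) =
      ((maxDiss G A ×ˢ maxDiss G B).filter fun x => Diss G (x.1 ∪ x.2)).card := by
  have h := card_filter_maxDiss_union hAB hp (fun _ => True)
  simpa only [filter_true, and_true, num] using h

lemma num_union_le (hAB : Disjoint A B) (hp : psi G (A ∪ B) = psi G A + psi G B) :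
    num G (A ∪ B) ≤ num G A * num G B := by
  rw [num_union_eq_card hAB hp, num, num, ← card_product]
  exact card_filter_le _ _

lemma psi_union_of_noEdge (hAB : Disjoint A B) (h : NoEdge G A B) :
    psi G (A ∪ B) = psi G A + psi G B := by
  refine le_antisymm (psi_union_le A B) ?_
  obtain ⟨S, hS⟩ := maxDiss_nonempty (G := G) A
  obtain ⟨T, hT⟩ := maxDiss_nonempty (G := G) B
  rw [mem_maxDiss] at hS hT
  rw [← hS.2.2, ← hT.2.2, ← card_union_of_disjoint (hAB.mono hS.1 hT.1)]
  exact le_psi (union_subset_union hS.1 hT.1) (hS.2.1.union hT.2.1 (h.mono hS.1 hT.1))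

lemma num_union_of_noEdge (hAB : Disjoint A B) (h : NoEdge G A B) :
    num G (A ∪ B) = num G A * num G B := by
  rw [num_union_eq_card hAB (psi_union_of_noEdge hAB h), num, num, ← card_product, filter_true_of_mem]
  rintro ⟨S, T⟩ hx
  rw [mem_product] at hx
  have hS := mem_maxDiss.1 hx.1
  have hT := mem_maxDiss.1 hx.2
  exact hS.2.1.union hT.2.1 (h.mono hS.1 hT.1)

end Cut

/-! ### Two vertex sets joined by a single edge -/

/-- The disjoint vertex sets `R` and `C` are joined by exactly one edge, from `r ∈ R` to
`c ∈ C`. -/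
structure Link (G : SimpleGraph V) (R C : Finset V) (r c : V) : Prop where
  disj : Disjoint R C
  left_mem : r ∈ R
  right_mem : c ∈ C
  adj : G.Adj r c
  eq_of_adj : ∀ a ∈ R, ∀ b ∈ C, G.Adj a b → a = r ∧ b = c

lemma Link.symm {R C : Finset V} {r c : V} (h : Link G R C r c) : Link G C R c r :=
  ⟨h.disj.symm, h.right_mem, h.left_mem, h.adj.symm, fun a ha b hb hab =>
    (h.eq_of_adj b hb a ha hab.symm).symm⟩

section LinkCount

variable {R C : Finset V} {r c : V}

/-- The edge `rc` matters only when both ends are chosen; each end is then the one permitted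
neighbour of the other. -/
lemma Link.diss_union_iff (h : Link G R C r c) {S T : Finset V} (hS : S ⊆ R) (hT : T ⊆ C)
    (hdS : Diss G S) (hdT : Diss G T) :
    Diss G (S ∪ T) ↔ (r ∈ S → c ∈ T → Isolated G r S ∧ Isolated G c T) := by
  constructor
  · intro hd hr hc
    constructor
    · intro a ha hra
      have := hd r (mem_union_left _ hr) a (mem_union_left _ ha) c (mem_union_right _ hc) hra h.adj
      exact disjoint_left.1 h.disj (hS ha) (this ▸ h.right_mem)
    · intro a ha hca
      have := hd c (mem_union_right _ hc) a (mem_union_right _ ha) r (mem_union_left _ hr) hca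
        h.adj.symm
      exact disjoint_left.1 h.disj h.left_mem (this ▸ hT ha)
  · intro hi v hv a ha b hb hva hvb
    rw [mem_union] at hv ha hb
    rcases hv with hv | hv <;> rcases ha with ha | ha <;> rcases hb with hb | hb
    · exact hdS v hv a ha b hb hva hvb
    · obtain ⟨rfl, rfl⟩ := h.eq_of_adj v (hS hv) b (hT hb) hvb
      exact absurd hva ((hi hv hb).1 a ha)
    · obtain ⟨rfl, rfl⟩ := h.eq_of_adj v (hS hv) a (hT ha) hva
      exact absurd hvb ((hi hv ha).1 b hb)
    · exact (h.eq_of_adj v (hS hv) a (hT ha) hva).2.trans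
        (h.eq_of_adj v (hS hv) b (hT hb) hvb).2.symm
    · exact (h.eq_of_adj a (hS ha) v (hT hv) hva.symm).1.trans
        (h.eq_of_adj b (hS hb) v (hT hv) hvb.symm).1.symm
    · obtain ⟨rfl, rfl⟩ := h.eq_of_adj a (hS ha) v (hT hv) hva.symm
      exact absurd hvb ((hi ha hv).2 b hb)
    · obtain ⟨rfl, rfl⟩ := h.eq_of_adj b (hS hb) v (hT hv) hvb.symm
      exact absurd hva ((hi hb hv).2 a ha)
    · exact hdT v hv a ha b hb hva hvb

lemma numAvoid_pos_iff {U : Finset V} {v : V} :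
    0 < numAvoid G U v ↔ ∃ S ∈ maxDiss G U, v ∉ S := by
  rw [numAvoid, card_pos]
  simp [Finset.Nonempty]

lemma Link.psi_union (h : Link G R C r c) (hc : 0 < numAvoid G C c) :
    psi G (R ∪ C) = psi G R + psi G C := by
  refine le_antisymm (psi_union_le R C) ?_
  obtain ⟨S, hS⟩ := maxDiss_nonempty (G := G) R
  obtain ⟨T, hT, hcT⟩ := numAvoid_pos_iff.1 hc
  rw [mem_maxDiss] at hS hT
  rw [← hS.2.2, ← hT.2.2, ← card_union_of_disjoint (h.disj.mono hS.1 hT.1)]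
  exact le_psi (union_subset_union hS.1 hT.1)
    ((h.diss_union_iff hS.1 hT.1 hS.2.1 hT.2.1).2 fun _ q => absurd q hcT)

/-- The compatible pairs split into three classes: `c` is not chosen; `c` is chosen and `r` is not;
both are chosen, and each is isolated on its own side. -/
lemma Link.num_union (h : Link G R C r c) (hc : 0 < numAvoid G C c) :
    num G (R ∪ C) = num G R * numAvoid G C c + numAvoid G R r * numMem G C c +
      numIso G R r * numIso G C c := by
  rw [num_union_eq_card h.disj (h.psi_union hc)]
  have h1 : (maxDiss G R ×ˢ maxDiss G C).filter
      (fun x => Diss G (x.1 ∪ x.2)) =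
      (maxDiss G R ×ˢ (maxDiss G C).filter (fun T => c ∉ T) ∪
        (maxDiss G R).filter (fun S => r ∉ S) ×ˢ (maxDiss G C).filter (fun T => c ∈ T)) ∪
        (maxDiss G R).filter (fun S => r ∈ S ∧ Isolated G r S) ×ˢ
          (maxDiss G C).filter (fun T => c ∈ T ∧ Isolated G c T) := by
    ext ⟨S, T⟩
    simp only [mem_filter, mem_union, mem_product]
    constructor
    · rintro ⟨⟨hS, hT⟩, hd⟩
      have hS' := mem_maxDiss.1 hS
      have hT' := mem_maxDiss.1 hT
      rw [h.diss_union_iff hS'.1 hT'.1 hS'.2.1 hT'.2.1] at hd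
      by_cases h1 : c ∈ T <;> by_cases h2 : r ∈ S <;> simp_all
    · intro hx
      have hST : S ∈ maxDiss G R ∧ T ∈ maxDiss G C := by tauto
      refine ⟨hST, ?_⟩
      have hS' := mem_maxDiss.1 hST.1
      have hT' := mem_maxDiss.1 hST.2
      rw [h.diss_union_iff hS'.1 hT'.1 hS'.2.1 hT'.2.1]
      tauto
  rw [h1, card_union_of_disjoint, card_union_of_disjoint, card_product, card_product,
    card_product]
  · rfl
  · rw [disjoint_left]
    rintro ⟨S, T⟩
    simp only [mem_filter, mem_product]
    tauto
  · rw [disjoint_left]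
    rintro ⟨S, T⟩
    simp only [mem_filter, mem_product, mem_union]
    tauto

lemma Link.numAvoid_union (h : Link G R C r c) (hc : 0 < numAvoid G C c) :
    numAvoid G (R ∪ C) r = numAvoid G R r * num G C := by
  rw [numAvoid, card_filter_maxDiss_union h.disj (h.psi_union hc) (fun S => r ∉ S), numAvoid, num, ← card_product]
  congr 1
  ext ⟨S, T⟩
  simp only [mem_filter, mem_product, mem_union]
  constructor
  · rintro ⟨⟨hS, hT⟩, hd, hr⟩
    exact ⟨⟨hS, fun q => hr (Or.inl q)⟩, hT⟩
  · rintro ⟨⟨hS, hr⟩, hT⟩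
    have hS' := mem_maxDiss.1 hS
    have hT' := mem_maxDiss.1 hT
    refine ⟨⟨hS, hT⟩, ?_, ?_⟩
    · rw [h.diss_union_iff hS'.1 hT'.1 hS'.2.1 hT'.2.1]
      exact fun q => absurd q hr
    · rintro (q | q)
      · exact hr q
      · exact disjoint_left.1 h.disj h.left_mem (hT'.1 q)

lemma Link.numIso_union (h : Link G R C r c) (hc : 0 < numAvoid G C c) :
    numIso G (R ∪ C) r = numIso G R r * numAvoid G C c := by
  rw [numIso, card_filter_maxDiss_union h.disj (h.psi_union hc)
    (fun S => r ∈ S ∧ Isolated G r S), numIso, numAvoid, ← card_product]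
  congr 1
  ext ⟨S, T⟩
  simp only [mem_filter, mem_product, mem_union]
  constructor
  · rintro ⟨⟨hS, hT⟩, hd, hr, hi⟩
    have hT' := mem_maxDiss.1 hT
    refine ⟨⟨hS, hr.resolve_right fun q => disjoint_left.1 h.disj h.left_mem (hT'.1 q), ?_⟩, hT, ?_⟩
    · exact fun a ha => hi a (mem_union_left _ ha)
    · exact fun q => hi c (mem_union_right _ q) h.adj
  · rintro ⟨⟨hS, hr, hi⟩, hT, hcT⟩
    have hS' := mem_maxDiss.1 hS
    have hT' := mem_maxDiss.1 hT
    refine ⟨⟨hS, hT⟩, ?_, Or.inl hr, ?_⟩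
    · rw [h.diss_union_iff hS'.1 hT'.1 hS'.2.1 hT'.2.1]
      exact fun _ q => absurd q hcT
    · intro a ha hra
      rw [mem_union] at ha
      rcases ha with ha | ha
      · exact hi a ha hra
      · exact hcT ((h.eq_of_adj r h.left_mem a (hT'.1 ha) hra).2 ▸ ha)

end LinkCount

/-! ### Connected sets and branches in a forest -/

/-- The subgraph induced on `U` is nonempty and connected. -/
def Conn (G : SimpleGraph V) (U : Finset V) : Prop :=
  U.Nonempty ∧ ∀ Z ⊆ U, Z.Nonempty → NoEdge G Z (U \ Z) → Z = U

/-- Every edge of a forest is a bridge; `K` is the component of `u` once `uv` is deleted. -/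
lemma exists_side (hG : G.IsAcyclic) {u v : V} (h : G.Adj u v) :
    ∃ K : Set V, u ∈ K ∧ v ∉ K ∧ ∀ x ∈ K, ∀ y ∉ K, G.Adj x y → x = u ∧ y = v := by
  have hb : G.IsBridge s(u, v) := SimpleGraph.isAcyclic_iff_forall_isBridge.1 hG h
  rw [SimpleGraph.isBridge_iff] at hb
  refine ⟨{x | (G.deleteEdges {s(u, v)}).Reachable u x}, SimpleGraph.Reachable.refl _, hb, ?_⟩
  intro x hx y hy hxy
  by_contra hne
  by_cases he : s(x, y) = s(u, v)
  · rw [Sym2.eq_iff] at he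
    rcases he with he | ⟨rfl, rfl⟩
    · exact hne he
    · exact hb hx
  · refine hy (SimpleGraph.Reachable.trans hx (SimpleGraph.Adj.reachable ?_))
    rw [SimpleGraph.deleteEdges_adj]
    exact ⟨hxy, by simpa using he⟩

lemma no_triangle (hG : G.IsAcyclic) {u v w : V} (h1 : G.Adj u v) (h2 : G.Adj u w)
    (h3 : G.Adj v w) : False := by
  obtain ⟨K, hu, hv, hK⟩ := exists_side hG h1
  by_cases hw : w ∈ K
  · exact h2.ne (hK w hw v hv h3.symm).1.symm
  · exact h3.ne (hK u hu w hw h2).2.symm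

lemma exists_link (hG : G.IsAcyclic) {U : Finset V} {v u : V} (hv : v ∈ U) (hu : u ∈ U)
    (h : G.Adj v u) : ∃ R C, R ∪ C = U ∧ Link G R C v u := by
  obtain ⟨K, hKu, hKv, hK⟩ := exists_side hG h.symm
  refine ⟨U.filter (· ∉ K), U.filter (· ∈ K), ?_, ?_, ?_, ?_, h, ?_⟩
  · ext x
    simp only [mem_union, mem_filter]
    tauto
  · rw [disjoint_left]
    intro x
    simp only [mem_filter]
    tauto
  · exact mem_filter.2 ⟨hv, hKv⟩
  · exact mem_filter.2 ⟨hu, hKu⟩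
  · intro a ha b hb hab
    rw [mem_filter] at ha hb
    exact (hK b hb.2 a ha.2 hab.symm).symm

/-- A part of `R` closed in `R` and missing `r` would be closed in `R ∪ C`, since only `r` has a
neighbour in `C`. A proper closed part containing `r` is handled through its complement. -/
lemma Link.conn_left {R C : Finset V} {r c : V} (h : Link G R C r c) (hU : Conn G (R ∪ C)) :
    Conn G R := by
  have key : ∀ Z ⊆ R, Z.Nonempty → r ∉ Z → NoEdge G Z (R \ Z) → False := by
    intro Z hZ hne hr hno
    have := hU.2 Z (hZ.trans subset_union_left) hne ?_
    · have hc : c ∈ Z := this ▸ mem_union_right _ h.right_mem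
      exact disjoint_left.1 h.disj (hZ hc) h.right_mem
    · intro a ha b hb hab
      rw [mem_sdiff, mem_union] at hb
      rcases hb.1 with hb1 | hb1
      · exact hno a ha b (mem_sdiff.2 ⟨hb1, hb.2⟩) hab
      · exact hr ((h.eq_of_adj a (hZ ha) b hb1 hab).1 ▸ ha)
  refine ⟨⟨r, h.left_mem⟩, fun Z hZ hne hno => ?_⟩
  by_cases hr : r ∈ Z
  · by_contra hZR
    refine key (R \ Z) sdiff_subset ?_ (fun q => (mem_sdiff.1 q).2 hr) ?_
    · rw [sdiff_nonempty]
      exact fun q => hZR (hZ.antisymm q)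
    · rw [Finset.sdiff_sdiff_eq_self hZ]
      exact hno.symm
  · exact (key Z hZ hne hr hno).elim

lemma Link.conn_right {R C : Finset V} {r c : V} (h : Link G R C r c) (hU : Conn G (R ∪ C)) :
    Conn G C := h.symm.conn_left (by rwa [union_comm])

/-- The branch beyond a neighbour of `c` is a strictly smaller pendant part; this is what minimality
arguments are played against. -/
lemma Link.exists_sublink (hG : G.IsAcyclic) {R C : Finset V} {r c u : V} (h : Link G R C r c)
    (hu : u ∈ C) (hcu : G.Adj c u) :
    ∃ B ⊆ C, c ∉ B ∧ Link G ((R ∪ C) \ B) B c u := by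
  obtain ⟨K, hKu, hKc, hK⟩ := exists_side hG hcu.symm
  refine ⟨C.filter (· ∈ K), filter_subset _ _, fun q => hKc (mem_filter.1 q).2, sdiff_disjoint,
    ?_, mem_filter.2 ⟨hu, hKu⟩, hcu, ?_⟩
  · exact mem_sdiff.2 ⟨mem_union_right _ h.right_mem, fun q => hKc (mem_filter.1 q).2⟩
  · intro a ha b hb hab
    rw [mem_sdiff, mem_union, mem_filter] at ha
    rw [mem_filter] at hb
    by_cases haC : a ∈ C
    · exact (hK b hb.2 a (fun q => ha.2 ⟨haC, q⟩) hab.symm).symm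
    · have haR := ha.1.resolve_right haC
      have := (h.eq_of_adj a haR b hb.1 hab).2
      exact absurd hb.2 (this ▸ hKc)

lemma Conn.exists_adj {U : Finset V} (hU : Conn G U) {Z : Finset V} (hZ : Z ⊆ U)
    (hne : Z.Nonempty) (hZU : Z ≠ U) : ∃ a ∈ Z, ∃ b ∈ U, b ∉ Z ∧ G.Adj a b := by
  by_contra hcon
  refine hZU (hU.2 Z hZ hne fun a ha b hb hab => hcon ?_)
  rw [mem_sdiff] at hb
  exact ⟨a, ha, b, hb.1, hb.2, hab⟩

lemma Conn.exists_adj_of_mem {U : Finset V} (hU : Conn G U) {v : V} (hv : v ∈ U)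
    (hc : 2 ≤ U.card) : ∃ b ∈ U, G.Adj v b := by
  obtain ⟨a, ha, b, hb, -, hab⟩ := hU.exists_adj (singleton_subset_iff.2 hv)
    (singleton_nonempty v) (fun q => by rw [← q, card_singleton] at hc; omega)
  rw [mem_singleton] at ha
  exact ⟨b, hb, ha ▸ hab⟩

/-! ### Paths on three and four vertices -/

/-- The induced subgraph on `C` is a path on three vertices with centre `c`. -/
def Cherry (G : SimpleGraph V) (C : Finset V) (c : V) : Prop :=
  ∃ x y, C = {c, x, y} ∧ x ≠ y ∧ G.Adj c x ∧ G.Adj c y ∧ ¬ G.Adj x y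

/-- The induced subgraph on `C` is a path on three vertices with end vertex `c`. -/
def Path3 (G : SimpleGraph V) (C : Finset V) (c : V) : Prop :=
  ∃ x y, C = {c, x, y} ∧ c ≠ y ∧ G.Adj c x ∧ G.Adj x y ∧ ¬ G.Adj c y

/-- The induced subgraph on `C` is a path `l, c, p, q`. -/
def Path4 (G : SimpleGraph V) (C : Finset V) (c : V) : Prop :=
  ∃ l p q, C = {c, l, p, q} ∧ l ≠ p ∧ l ≠ q ∧ c ≠ q ∧ G.Adj c l ∧ G.Adj c p ∧ G.Adj p q ∧
    ¬ G.Adj c q ∧ ¬ G.Adj l p ∧ ¬ G.Adj l q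

lemma conn_card_three (hG : G.IsAcyclic) {C : Finset V} (hC : Conn G C) (h3 : C.card = 3) {c : V}
    (hc : c ∈ C) : Cherry G C c ∨ Path3 G C c := by
  obtain ⟨x, hx, hcx⟩ := hC.exists_adj_of_mem hc (by omega)
  obtain ⟨y, hy⟩ : ((C.erase c).erase x).Nonempty := by
    rw [← card_pos, card_erase_of_mem (mem_erase.2 ⟨hcx.ne', hx⟩), card_erase_of_mem hc]
    omega
  simp only [mem_erase] at hy
  have hCe : C = {c, x, y} := by
    symm
    apply eq_of_subset_of_card_le
    · intro z hz
      simp only [mem_insert, mem_singleton] at hz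
      rcases hz with rfl | rfl | rfl
      · exact hc
      · exact hx
      · exact hy.2.2
    · rw [card_eq_three.2 ⟨c, x, y, hcx.ne, hy.2.1.symm, hy.1.symm, rfl⟩, h3]
  obtain ⟨b, hb, hyb⟩ := hC.exists_adj_of_mem hy.2.2 (by omega)
  rw [hCe] at hb
  simp only [mem_insert, mem_singleton] at hb
  rcases hb with rfl | rfl | rfl
  · exact Or.inl ⟨x, y, hCe, hy.1.symm, hcx, hyb.symm, fun q => no_triangle hG hcx hyb.symm q⟩
  · exact Or.inr ⟨b, y, hCe, hy.2.1.symm, hcx, hyb.symm, fun q => no_triangle hG hcx q hyb.symm⟩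
  · exact absurd hyb (G.irrefl)

lemma not_diss_of_adj {S : Finset V} {v a b : V} (hv : v ∈ S) (ha : a ∈ S) (hb : b ∈ S)
    (hab : a ≠ b) (hva : G.Adj v a) (hvb : G.Adj v b) : ¬ Diss G S :=
  fun h => hab (h v hv a ha b hb hva hvb)

lemma psi_card_three {C : Finset V} (h3 : C.card = 3) (hd : ¬ Diss G C) : psi G C = 2 := by
  refine le_antisymm (psi_le fun S hS hS' => ?_) (two_le_psi (by omega))
  by_contra hlt
  have : S = C := eq_of_subset_of_card_le hS (by omega)
  exact hd (this ▸ hS')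

lemma maxDiss_card_three {C : Finset V} (h3 : C.card = 3) (hd : ¬ Diss G C) :
    maxDiss G C = C.powersetCard 2 := by
  ext S
  rw [mem_maxDiss, mem_powersetCard, psi_card_three h3 hd]
  exact ⟨fun h => ⟨h.1, h.2.2⟩, fun h => ⟨h.1, diss_of_card_le_two h.2.le, h.2⟩⟩

lemma num_card_three {C : Finset V} (h3 : C.card = 3) (hd : ¬ Diss G C) : num G C = 3 := by
  rw [num, maxDiss_card_three h3 hd, card_powersetCard, h3]
  rfl

lemma numAvoid_card_three {C : Finset V} (h3 : C.card = 3) (hd : ¬ Diss G C) {c : V} (hc : c ∈ C) :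
    numAvoid G C c = 1 := by
  rw [numAvoid, maxDiss_card_three h3 hd]
  have : (C.powersetCard 2).filter (fun S => c ∉ S) = (C.erase c).powersetCard 2 := by
    ext S
    simp only [mem_filter, mem_powersetCard, subset_erase]
    tauto
  rw [this, card_powersetCard, card_erase_of_mem hc, h3]
  rfl

lemma numMem_card_three {C : Finset V} (h3 : C.card = 3) (hd : ¬ Diss G C) {c : V} (hc : c ∈ C) :
    numMem G C c = 2 := by
  have h1 := numAvoid_add_numMem (G := G) C c
  rw [numAvoid_card_three h3 hd hc, num_card_three h3 hd] at h1
  omega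

section Shapes

variable {C : Finset V} {c : V}

lemma Cherry.mem (h : Cherry G C c) : c ∈ C := by
  obtain ⟨x, y, rfl, -⟩ := h
  simp

lemma Path3.mem (h : Path3 G C c) : c ∈ C := by
  obtain ⟨x, y, rfl, -⟩ := h
  simp

lemma Cherry.card (h : Cherry G C c) : C.card = 3 := by
  obtain ⟨x, y, rfl, hxy, hx, hy, -⟩ := h
  exact card_eq_three.2 ⟨c, x, y, hx.ne, hy.ne, hxy, rfl⟩

lemma Path3.card (h : Path3 G C c) : C.card = 3 := by
  obtain ⟨x, y, rfl, hcy, hx, hy, -⟩ := h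
  exact card_eq_three.2 ⟨c, x, y, hx.ne, hcy, hy.ne, rfl⟩

lemma Cherry.not_diss (h : Cherry G C c) : ¬ Diss G C := by
  obtain ⟨x, y, rfl, hxy, hx, hy, -⟩ := h
  exact not_diss_of_adj (v := c) (a := x) (b := y) (by simp) (by simp) (by simp) hxy hx hy

lemma Path3.not_diss (h : Path3 G C c) : ¬ Diss G C := by
  obtain ⟨x, y, rfl, hcy, hx, hy, -⟩ := h
  exact not_diss_of_adj (v := x) (a := c) (b := y) (by simp) (by simp) (by simp) hcy hx.symm hy

lemma Cherry.numIso (h : Cherry G C c) : numIso G C c = 0 := by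
  rw [Dissociation.numIso, maxDiss_card_three h.card h.not_diss, card_eq_zero, filter_eq_empty_iff]
  obtain ⟨x, y, rfl, hxy, hx, hy, -⟩ := h
  rintro S hS ⟨hc, hi⟩
  rw [mem_powersetCard] at hS
  obtain ⟨z, hz, hzc⟩ := exists_mem_ne (by omega : 1 < S.card) c
  have := hS.1 hz
  simp only [mem_insert, mem_singleton] at this
  rcases this with rfl | rfl | rfl
  · exact hzc rfl
  · exact hi _ hz hx
  · exact hi _ hz hy

lemma Path3.numIso (h : Path3 G C c) : numIso G C c = 1 := by
  rw [Dissociation.numIso, maxDiss_card_three h.card h.not_diss, card_eq_one]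
  have h3 := h.card
  obtain ⟨x, y, rfl, hcy, hx, hy, hn⟩ := h
  refine ⟨{c, y}, ?_⟩
  ext S
  rw [mem_filter, mem_powersetCard, mem_singleton]
  constructor
  · rintro ⟨⟨hS, h2⟩, hc, hi⟩
    refine eq_of_subset_of_card_le (fun z hz => ?_) (by rw [card_pair hcy, h2])
    have := hS hz
    simp only [mem_insert, mem_singleton] at this ⊢
    rcases this with rfl | rfl | rfl
    · exact Or.inl rfl
    · exact absurd hx (hi _ hz)
    · exact Or.inr rfl
  · rintro rfl
    refine ⟨⟨by intro z; simp only [mem_insert, mem_singleton]; tauto, card_pair hcy⟩, by simp, ?_⟩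
    intro a ha
    simp only [mem_insert, mem_singleton] at ha
    rcases ha with rfl | rfl
    · exact G.irrefl
    · exact hn

/-- The maximum sets are `{l, p, q}` and `{c, l, q}`: choosing both `c` and `p` excludes `l` and
`q`. In the second one `c` has the neighbour `l`. -/
lemma Path4.counts (h : Path4 G C c) :
    psi G C = 3 ∧ numAvoid G C c = 1 ∧ numMem G C c = 1 ∧ numIso G C c = 0 := by
  obtain ⟨l, p, q, rfl, hlp, hlq, hcq, hcl, hcp, hpq, hncq, hnlp, hnlq⟩ := h
  have hd1 : Diss G {l, p, q} := by
    intro v hv a ha b hb hva hvb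
    simp only [mem_insert, mem_singleton] at hv ha hb
    have h1 := fun z => hnlp (G.adj_symm z)
    have h2 := fun z => hnlq (G.adj_symm z)
    rcases hv with rfl | rfl | rfl <;> rcases ha with rfl | rfl | rfl <;>
      rcases hb with rfl | rfl | rfl <;> first | rfl | simp_all
  have hd2 : Diss G {c, l, q} := by
    intro v hv a ha b hb hva hvb
    simp only [mem_insert, mem_singleton] at hv ha hb
    have h1 := fun z => hncq (G.adj_symm z)
    have h2 := fun z => hnlq (G.adj_symm z)
    rcases hv with rfl | rfl | rfl <;> rcases ha with rfl | rfl | rfl <;>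
      rcases hb with rfl | rfl | rfl <;> first | rfl | simp_all
  have hc1 : ({l, p, q} : Finset V).card = 3 := card_eq_three.2 ⟨l, p, q, hlp, hlq, hpq.ne, rfl⟩
  have hc2 : ({c, l, q} : Finset V).card = 3 := card_eq_three.2 ⟨c, l, q, hcl.ne, hcq, hlq, rfl⟩
  have hc4 : ({c, l, p, q} : Finset V).card = 4 := by
    rw [card_insert_of_notMem, hc1]
    simp [hcl.ne, hcp.ne, hcq]
  have hs1 : ({l, p, q} : Finset V) ⊆ {c, l, p, q} := subset_insert _ _
  have hs2 : ({c, l, q} : Finset V) ⊆ {c, l, p, q} := by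
    intro z
    simp only [mem_insert, mem_singleton]
    tauto
  have hnot : ∀ S : Finset V, S ⊆ {c, l, p, q} → c ∈ S → Diss G S → 3 ≤ S.card →
      S = {c, l, q} := by
    intro S hS hc hd h3
    have hp : p ∉ S := by
      intro hp
      have hl : l ∉ S := fun hl => hlp (hd c hc l hl p hp hcl hcp)
      have hq : q ∉ S := fun hq => hcq (hd p hp c hc q hq hcp.symm hpq)
      have : S ⊆ {c, p} := by
        intro z hz
        have := hS hz
        simp only [mem_insert, mem_singleton] at this ⊢
        rcases this with rfl | rfl | rfl | rfl <;> tauto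
      have := card_le_card this
      have := card_le_two (a := c) (b := p)
      omega
    refine eq_of_subset_of_card_le (fun z hz => ?_) (by rw [hc2]; exact h3)
    have := hS hz
    simp only [mem_insert, mem_singleton] at this ⊢
    rcases this with rfl | rfl | rfl | rfl <;> tauto
  have hpsi : psi G {c, l, p, q} = 3 := by
    refine le_antisymm (psi_le fun S hS hd => ?_) (hc1 ▸ le_psi hs1 hd1)
    by_contra hlt
    by_cases hc : c ∈ S
    · have := hnot S hS hc hd (by omega)
      rw [this, hc2] at hlt
      omega
    · have := card_lt_card ⟨hS, fun q => hc (q (mem_insert_self _ _))⟩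
      omega
  have hM : maxDiss G {c, l, p, q} = {{l, p, q}, {c, l, q}} := by
    ext S
    rw [mem_maxDiss, hpsi, mem_insert, mem_singleton]
    constructor
    · rintro ⟨hS, hd, h3⟩
      by_cases hc : c ∈ S
      · exact Or.inr (hnot S hS hc hd h3.ge)
      · refine Or.inl (eq_of_subset_of_card_le (fun z hz => ?_) (by omega))
        exact mem_of_mem_insert_of_ne (hS hz) (fun q => hc (q ▸ hz))
    · rintro (rfl | rfl)
      · exact ⟨hs1, hd1, hc1⟩
      · exact ⟨hs2, hd2, hc2⟩
  have hcn : c ∉ ({l, p, q} : Finset V) := by simp [hcl.ne, hcp.ne, hcq]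
  have hcm : c ∈ ({c, l, q} : Finset V) := by simp
  have hiso : ¬ Isolated G c {c, l, q} := fun q => q l (by simp) hcl
  refine ⟨hpsi, ?_, ?_, ?_⟩
  · rw [numAvoid, hM, card_eq_one]
    refine ⟨{l, p, q}, ?_⟩
    rw [filter_insert, filter_singleton, if_pos hcn, if_neg (not_not.2 hcm), insert_empty_eq]
  · rw [numMem, hM, card_eq_one]
    refine ⟨{c, l, q}, ?_⟩
    rw [filter_insert, filter_singleton, if_neg hcn, if_pos hcm]
  · rw [numIso, hM, card_eq_zero, filter_eq_empty_iff]
    intro S hS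
    rw [mem_insert, mem_singleton] at hS
    rcases hS with rfl | rfl
    · exact fun q => hcn q.1
    · exact fun q => hiso q.2

end Shapes

/-! ### Minimal pendant parts and their four shapes -/

/-- The set `C` has a unique maximum dissociation set, which avoids `c` and has at least three
elements. -/
structure Rigid (G : SimpleGraph V) (C : Finset V) (c : V) : Prop where
  three_le : 3 ≤ psi G C
  numAvoid : numAvoid G C c = 1
  numMem : numMem G C c = 0

lemma Rigid.numIso {C : Finset V} {c : V} (h : Rigid G C c) : numIso G C c = 0 := by
  have := numIso_le_numMem (G := G) C c
  have := h.numMem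
  omega

/-- Omitting `c` costs one vertex, while keeping `c` costs at least two, so `C.erase c` is the only
maximum set. -/
lemma rigid_of_erase {C : Finset V} {c : V} (hc : c ∈ C) (h4 : 4 ≤ C.card)
    (hd : Diss G (C.erase c)) (h : ∀ S ⊆ C, c ∈ S → Diss G S → S.card + 2 ≤ C.card) :
    Rigid G C c := by
  have hce : (C.erase c).card = C.card - 1 := card_erase_of_mem hc
  have hpsi : psi G C = C.card - 1 := by
    refine le_antisymm (psi_le fun S hS hS' => ?_) (hce ▸ le_psi (erase_subset _ _) hd)
    by_cases hcS : c ∈ S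
    · have := h S hS hcS hS'
      omega
    · rw [← hce]
      exact card_le_card (subset_erase.2 ⟨hS, hcS⟩)
  have hM : maxDiss G C = {C.erase c} := by
    ext S
    rw [mem_maxDiss, hpsi, mem_singleton]
    constructor
    · rintro ⟨hS, hS', h3⟩
      have hcS : c ∉ S := fun q => by
        have := h S hS q hS'
        omega
      exact eq_of_subset_of_card_le (subset_erase.2 ⟨hS, hcS⟩) (by omega)
    · rintro rfl
      exact ⟨erase_subset _ _, hd, hce⟩
  refine ⟨by omega, ?_, ?_⟩
  · rw [numAvoid, hM, filter_singleton, if_pos (notMem_erase c C), card_singleton]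
  · rw [numMem, hM, filter_singleton, if_neg (notMem_erase c C), card_empty]

lemma Conn.adj_of_pair {u q : V} (h : Conn G {u, q}) (huq : u ≠ q) : G.Adj u q := by
  obtain ⟨b, hb, hub⟩ := h.exists_adj_of_mem (mem_insert_self u {q}) (by rw [card_pair huq])
  simp only [mem_insert, mem_singleton] at hb
  rcases hb with rfl | rfl
  · exact absurd hub G.irrefl
  · exact hub

/-- A smallest side of an edge is a single vertex, since otherwise it contains a smaller branch. The
opposite side then has at least three vertices. -/
lemma exists_large_link (hG : G.IsAcyclic) {U : Finset V} (hU : Conn G U) (h4 : 4 ≤ U.card) :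
    ∃ R C r c, R ∪ C = U ∧ Link G R C r c ∧ 3 ≤ C.card := by
  let F := U.powerset.filter fun C => ∃ R r c, R ∪ C = U ∧ Link G R C r c
  have hF : F.Nonempty := by
    obtain ⟨v, hv⟩ := hU.1
    obtain ⟨u, hu, hvu⟩ := hU.exists_adj_of_mem hv (by omega)
    obtain ⟨R, C, hRC, hl⟩ := exists_link hG hv hu hvu
    exact ⟨C, mem_filter.2 ⟨mem_powerset.2 (hRC ▸ subset_union_right), R, v, u, hRC, hl⟩⟩
  obtain ⟨C, hC, hmin⟩ := exists_min_image F card hF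
  obtain ⟨hCU, R, r, c, hRC, hl⟩ := mem_filter.1 hC
  have h1 : C.card ≤ 1 := by
    by_contra hlt
    have hconn : Conn G C := hl.conn_right (hRC ▸ hU)
    obtain ⟨u, hu, hcu⟩ := hconn.exists_adj_of_mem hl.right_mem (by omega)
    obtain ⟨B, hBC, hcB, hB⟩ := hl.exists_sublink hG hu hcu
    have hBU : B ⊆ R ∪ C := hBC.trans subset_union_right
    have hBF : B ∈ F := mem_filter.2 ⟨mem_powerset.2 (hRC ▸ hBU), _, c, u,
      by rw [sdiff_union_of_subset hBU, hRC], hB⟩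
    have := card_lt_card (⟨hBC, fun q => hcB (q hl.right_mem)⟩ : B ⊂ C)
    have := hmin B hBF
    omega
  refine ⟨C, R, c, r, by rw [union_comm, hRC], hl.symm, ?_⟩
  rw [← hRC, card_union_of_disjoint hl.disj] at h4
  omega

/-- The four shapes of a minimal pendant subtree on at least three vertices. -/
def Pendant (G : SimpleGraph V) (C : Finset V) (c : V) : Prop :=
  Rigid G C c ∨ Cherry G C c ∨ Path3 G C c ∨ Path4 G C c

/-- Take `C` smallest among the sides with at least three vertices. All branches of `C` below `c`
then have one or two vertices, and the shape depends only on how many there are of each size. -/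
lemma exists_pendant (hG : G.IsAcyclic) {U : Finset V} (hU : Conn G U) (h4 : 4 ≤ U.card) :
    ∃ R C r c, R ∪ C = U ∧ Link G R C r c ∧ Pendant G C c := by
  let F := U.powerset.filter fun C => 3 ≤ C.card ∧ ∃ R r c, R ∪ C = U ∧ Link G R C r c
  have hF : F.Nonempty := by
    obtain ⟨R, C, r, c, hRC, hl, h3⟩ := exists_large_link hG hU h4
    exact ⟨C, mem_filter.2 ⟨mem_powerset.2 (hRC ▸ subset_union_right), h3, R, r, c, hRC, hl⟩⟩
  obtain ⟨C, hC, hmin⟩ := exists_min_image F card hF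
  obtain ⟨-, h3, R, r, c, rfl, hl⟩ := mem_filter.1 hC
  refine ⟨R, C, r, c, rfl, hl, ?_⟩
  have hconn : Conn G C := hl.conn_right hU
  have hsub : ∀ u ∈ C, G.Adj c u → ∃ B ⊆ C, c ∉ B ∧ Link G ((R ∪ C) \ B) B c u ∧ B.card ≤ 2 := by
    intro u hu hcu
    obtain ⟨B, hBC, hcB, hB⟩ := hl.exists_sublink hG hu hcu
    refine ⟨B, hBC, hcB, hB, ?_⟩
    by_contra hlt
    have hBU : B ⊆ R ∪ C := hBC.trans subset_union_right
    have hBF : B ∈ F := mem_filter.2 ⟨mem_powerset.2 hBU, by omega, _, c, u,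
      sdiff_union_of_subset hBU, hB⟩
    have := card_lt_card (⟨hBC, fun q => hcB (q hl.right_mem)⟩ : B ⊂ C)
    have := hmin B hBF
    omega
  choose! B hBC hcB hB hB2 using hsub
  have hleave : ∀ u ∈ C, G.Adj c u → ∀ a ∈ B u, ∀ b ∈ C, b ∉ B u → G.Adj a b → a = u ∧ b = c := by
    intro u hu hcu a ha b hb hbB hab
    exact ((hB u hu hcu).eq_of_adj b (mem_sdiff.2 ⟨mem_union_right _ hb, hbB⟩) a ha hab.symm).symm
  have huB : ∀ u ∈ C, G.Adj c u → u ∈ B u := fun u hu hcu => (hB u hu hcu).right_mem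
  have hBconn : ∀ u ∈ C, G.Adj c u → Conn G (B u) := by
    intro u hu hcu
    refine (hB u hu hcu).conn_right ?_
    rwa [sdiff_union_of_subset ((hBC u hu hcu).trans subset_union_right)]
  have hchild : ∀ u ∈ C, G.Adj c u → ∀ a ∈ B u, G.Adj c a → a = u := by
    intro u hu hcu a ha hca
    exact (hleave u hu hcu a ha c hl.right_mem (hcB u hu hcu) hca.symm).1
  -- An uncovered set of vertices would have an edge leaving it, by connectedness of `C`. That edge
  -- ends at `c`, making its other end a neighbour of `c` and hence covered, or in some branch,
  -- which can be left only through `c`.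
  have hcover : ∀ z ∈ C, z ≠ c → ∃ u ∈ C, G.Adj c u ∧ z ∈ B u := by
    let Z := C.filter fun z => z ≠ c ∧ ∀ u ∈ C, G.Adj c u → z ∉ B u
    have hZ : Z = ∅ := by
      by_contra hne
      have hcZ : c ∉ Z := fun q => (mem_filter.1 q).2.1 rfl
      obtain ⟨a, ha, b, hb, hbZ, hab⟩ := hconn.exists_adj (filter_subset _ _ : Z ⊆ C)
        (nonempty_iff_ne_empty.2 hne) (fun q => hcZ (by rw [show Z = C from q]; exact hl.right_mem))
      rw [mem_filter] at ha
      by_cases hbc : b = c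
      · subst hbc
        exact ha.2.2 a ha.1 hab.symm (huB a ha.1 hab.symm)
      · refine hbZ (mem_filter.2 ⟨hb, hbc, fun u hu hcu hbu => ?_⟩)
        exact ha.2.1 (hleave u hu hcu b hbu a ha.1 (ha.2.2 u hu hcu) hab.symm).2
    intro z hz hzc
    by_contra hcon
    have : z ∈ Z := mem_filter.2 ⟨hz, hzc, fun u hu hcu hzu => hcon ⟨u, hu, hcu, hzu⟩⟩
    rw [hZ] at this
    simp at this
  -- A vertex other than `c` has its neighbours other than `c` in its own branch, which has at most
  -- two vertices.
  have hdiss : Diss G (C.erase c) := by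
    intro v hv a ha b hb hva hvb
    rw [mem_erase] at hv ha hb
    obtain ⟨u, hu, hcu, hvu⟩ := hcover v hv.2 hv.1
    have h1 : ∀ z ∈ C, z ≠ c → G.Adj v z → z ∈ (B u).erase v := by
      intro z hz hzc hvz
      refine mem_erase.2 ⟨hvz.ne', ?_⟩
      by_contra hzB
      exact hzc (hleave u hu hcu v hvu z hz hzB hvz).2
    have h2 : ((B u).erase v).card ≤ 1 := by
      rw [card_erase_of_mem hvu]
      have := hB2 u hu hcu
      omega
    exact card_le_one.1 h2 a (h1 a ha.2 ha.1 hva) b (h1 b hb.2 hb.1 hvb)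
  let X := C.filter (G.Adj c)
  have hXC : X ⊆ C := filter_subset _ _
  have hmemX : ∀ u, u ∈ X ↔ u ∈ C ∧ G.Adj c u := fun u => mem_filter
  have hdX : ∀ S, c ∈ S → Diss G S → (X ∩ S).card ≤ 1 := by
    intro S hcS hd
    refine card_le_one.2 fun a ha b hb => ?_
    rw [mem_inter, hmemX] at ha hb
    exact hd c hcS a ha.2 b hb.2 ha.1.2 hb.1.2
  have hcard_le : ∀ S ⊆ C, c ∈ S → Diss G S → S.card + X.card ≤ C.card + 1 := by
    intro S hS hcS hd
    have h1 := hdX S hcS hd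
    have h2 : (S ∪ X).card ≤ C.card := card_le_card (union_subset hS hXC)
    have h3 := card_union_add_card_inter S X
    rw [inter_comm] at h3
    omega
  have hpair : ∀ u ∈ X, B u = {u} ∨ ∃ q ∈ C, q ≠ u ∧ q ≠ c ∧ B u = {u, q} ∧ G.Adj u q ∧
      ¬ G.Adj c q := by
    intro u hu
    rw [hmemX] at hu
    by_cases h1 : (B u).card = 1
    · left
      obtain ⟨z, hz⟩ := card_eq_one.1 h1
      have := huB u hu.1 hu.2
      rw [hz, mem_singleton] at this
      rw [hz, this]
    · right
      have h2 : ((B u).erase u).card = 1 := by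
        have h5 := card_pos.2 ⟨u, huB u hu.1 hu.2⟩
        have := hB2 u hu.1 hu.2
        rw [card_erase_of_mem (huB u hu.1 hu.2)]
        omega
      obtain ⟨q, hq⟩ := card_eq_one.1 h2
      have hqe : q ∈ (B u).erase u := hq ▸ mem_singleton_self q
      rw [mem_erase] at hqe
      have hBu : B u = {u, q} := by
        rw [← insert_erase (huB u hu.1 hu.2), hq]
      have hcn := hBconn u hu.1 hu.2
      rw [hBu] at hcn
      exact ⟨q, hBC u hu.1 hu.2 hqe.2, hqe.1, fun z => hcB u hu.1 hu.2 (z ▸ hqe.2), hBu,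
        hcn.adj_of_pair hqe.1.symm, fun z => hqe.1 (hchild u hu.1 hu.2 q hqe.2 z)⟩
  have hX0 : X.card ≠ 0 := by
    intro h0
    obtain ⟨u, hu, hcu⟩ := hconn.exists_adj_of_mem hl.right_mem (by omega)
    have : u ∈ X := (hmemX u).2 ⟨hu, hcu⟩
    rw [card_eq_zero.1 h0] at this
    simp at this
  -- With at least three neighbours of `c`, a dissociation set containing `c` misses at least two of
  -- them, so `C` is rigid.
  rcases Nat.lt_or_ge X.card 3 with hlt | hge
  swap
  · left
    have hXe : X ⊆ C.erase c := subset_erase.2 ⟨hXC, fun q => G.irrefl ((hmemX c).1 q).2⟩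
    have := card_le_card hXe
    rw [card_erase_of_mem hl.right_mem] at this
    refine rigid_of_erase hl.right_mem (by omega) hdiss fun S hS hcS hd => ?_
    have := hcard_le S hS hcS hd
    omega
  rcases (by omega : X.card = 1 ∨ X.card = 2) with h1 | h2
  · obtain ⟨u, hXu⟩ := card_eq_one.1 h1
    have huX : u ∈ X := hXu ▸ mem_singleton_self u
    have hu := (hmemX u).1 huX
    have hCe : C ⊆ insert c (B u) := by
      intro z hz
      by_cases hzc : z = c
      · exact hzc ▸ mem_insert_self _ _
      · obtain ⟨u', hu', hcu', hzu⟩ := hcover z hz hzc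
        have : u' ∈ X := (hmemX u').2 ⟨hu', hcu'⟩
        rw [hXu, mem_singleton] at this
        exact mem_insert_of_mem (this ▸ hzu)
    have hle := card_le_card hCe
    rcases hpair u huX with hs | ⟨q, hqC, hqu, hqc, hBq, huq, hcq⟩
    · rw [hs] at hle
      have := card_le_two (a := c) (b := u)
      omega
    · right; right; left
      refine ⟨u, q, subset_antisymm (hBq ▸ hCe) ?_, hqc.symm, hu.2, huq, hcq⟩
      intro z hz
      simp only [mem_insert, mem_singleton] at hz
      rcases hz with rfl | rfl | rfl
      · exact hl.right_mem
      · exact hu.1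
      · exact hqC
  · obtain ⟨u, u', huu, hXu⟩ := card_eq_two.1 h2
    have huX : u ∈ X := by rw [hXu]; simp
    have huX' : u' ∈ X := by rw [hXu]; simp
    have hCe : ∀ u u', X = {u, u'} → C ⊆ insert c (B u ∪ B u') := by
      intro u u' hXu z hz
      by_cases hzc : z = c
      · exact hzc ▸ mem_insert_self _ _
      · obtain ⟨v, hv, hcv, hzv⟩ := hcover z hz hzc
        have : v ∈ X := (hmemX v).2 ⟨hv, hcv⟩
        rw [hXu, mem_insert, mem_singleton] at this
        refine mem_insert_of_mem (mem_union.2 ?_)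
        rcases this with rfl | rfl
        · exact Or.inl hzv
        · exact Or.inr hzv
    have hnb : ∀ u ∈ X, ∀ u' ∈ X, u ≠ u' → ∀ z ∈ B u, ¬ G.Adj u' z := by
      intro u hu u' hu' huu z hz hadj
      rw [hmemX] at hu hu'
      have hn : u' ∉ B u := fun q => huu (hchild u hu.1 hu.2 u' q hu'.2).symm
      have := (hleave u hu.1 hu.2 z hz u' hu'.1 hn hadj.symm).2
      exact G.irrefl (this ▸ hu'.2)
    have hnm : ∀ u ∈ X, ∀ u' ∈ X, u ≠ u' → u' ∉ B u := by
      intro u hu u' hu' huu q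
      rw [hmemX] at hu hu'
      exact huu (hchild u hu.1 hu.2 u' q hu'.2).symm
    have hP4 : ∀ u u', X = {u, u'} → u ≠ u' → B u' = {u'} → ∀ q ∈ C, q ≠ u → q ≠ c →
        B u = {u, q} → G.Adj u q → ¬ G.Adj c q → Path4 G C c := by
      intro u u' hXu huu hs q hqC hqu hqc hBq huq hcq
      have huX : u ∈ X := by rw [hXu]; simp
      have huX' : u' ∈ X := by rw [hXu]; simp
      have hu := (hmemX u).1 huX
      have hu' := (hmemX u').1 huX'
      have hqB : q ∈ B u := by rw [hBq]; simp
      refine ⟨u', u, q, subset_antisymm ?_ ?_, huu.symm,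
        fun z => hnm u huX u' huX' huu (z ▸ hqB), hqc.symm, hu'.2, hu.2, huq, hcq,
        hnb u huX u' huX' huu u (huB u hu.1 hu.2), hnb u huX u' huX' huu q hqB⟩
      · have := hCe u u' hXu
        rw [hBq, hs] at this
        intro z hz
        have := this hz
        simp only [mem_insert, mem_union, mem_singleton] at this ⊢
        tauto
      · intro z hz
        simp only [mem_insert, mem_singleton] at hz
        rcases hz with rfl | rfl | rfl | rfl
        · exact hl.right_mem
        · exact hu'.1
        · exact hu.1
        · exact hqC
    have hu := (hmemX u).1 huX
    have hu' := (hmemX u').1 huX'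
    -- Two branches: sizes 1, 1 give a cherry; 1, 2 give a P₄; 2, 2 give a rigid part.
    rcases hpair u huX with hs | ⟨q, hqC, hqu, hqc, hBq, huq, hcq⟩ <;>
      rcases hpair u' huX' with hs' | ⟨q', hqC', hqu', hqc', hBq', huq', hcq'⟩
    · right; left
      refine ⟨u, u', subset_antisymm ?_ ?_, huu, hu.2, hu'.2, fun z => ?_⟩
      · have := hCe u u' hXu
        rw [hs, hs'] at this
        intro z hz
        have := this hz
        simp only [mem_insert, mem_union, mem_singleton] at this ⊢
        tauto
      · intro z hz
        simp only [mem_insert, mem_singleton] at hz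
        rcases hz with rfl | rfl | rfl
        · exact hl.right_mem
        · exact hu.1
        · exact hu'.1
      · exact no_triangle hG hu.2 hu'.2 z
    · right; right; right
      exact hP4 u' u (by rw [hXu, pair_comm]) huu.symm hs q' hqC' hqu' hqc' hBq' huq' hcq'
    · right; right; right
      exact hP4 u u' hXu huu hs' q hqC hqu hqc hBq huq hcq
    · left
      have hq'u : q' ≠ u := fun z => hnm u' huX' u huX huu.symm (by rw [hBq', ← z]; simp)
      have hqu2 : q ≠ u' := fun z => hnm u huX u' huX' huu (by rw [hBq, ← z]; simp)
      have h4 : 4 ≤ C.card := by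
        have hsub : ({c, u, u', q} : Finset V) ⊆ C := by
          intro z hz
          simp only [mem_insert, mem_singleton] at hz
          rcases hz with rfl | rfl | rfl | rfl
          · exact hl.right_mem
          · exact hu.1
          · exact hu'.1
          · exact hqC
        have hc4 : ({c, u, u', q} : Finset V).card = 4 := by
          rw [card_insert_of_notMem, card_eq_three.2 ⟨u, u', q, huu, hqu.symm, hqu2.symm, rfl⟩]
          simp [hu.2.ne, hu'.2.ne, hqc.symm]
        exact hc4 ▸ card_le_card hsub
      refine rigid_of_erase hl.right_mem h4 hdiss fun S hS hcS hd => ?_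
      -- If `c` is matched with one neighbour, then the other neighbour and the far vertex of the
      -- matched branch are missed; if it is matched with neither, both neighbours are.
      have key : ∃ a ∈ C, ∃ b ∈ C, a ≠ b ∧ a ∉ S ∧ b ∉ S := by
        by_cases huS : u ∈ S
        · have hu'S : u' ∉ S := fun z => huu (hd c hcS u huS u' z hu.2 hu'.2)
          have hqS : q ∉ S := fun z => hqc (hd u huS q z c hcS huq hu.2.symm)
          exact ⟨u', hu'.1, q, hqC, hqu2.symm, hu'S, hqS⟩
        · by_cases hu'S : u' ∈ S
          · have hqS : q' ∉ S := fun z => hqc' (hd u' hu'S q' z c hcS huq' hu'.2.symm)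
            exact ⟨u, hu.1, q', hqC', hq'u.symm, huS, hqS⟩
          · exact ⟨u, hu.1, u', hu'.1, huu, huS, hu'S⟩
      obtain ⟨a, ha, b, hb, hab, haS, hbS⟩ := key
      have h1 : S ⊆ (C.erase a).erase b := by
        rw [subset_erase, subset_erase]
        exact ⟨⟨hS, haS⟩, hbS⟩
      have := card_le_card h1
      rw [card_erase_of_mem (mem_erase.2 ⟨hab.symm, hb⟩), card_erase_of_mem ha] at this
      omega

section Pendant

variable {C : Finset V} {c : V}

lemma Pendant.numAvoid (hC : Pendant G C c) (hc : c ∈ C) : numAvoid G C c = 1 := by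
  rcases hC with h | h | h | h
  · exact h.numAvoid
  · exact numAvoid_card_three h.card h.not_diss hc
  · exact numAvoid_card_three h.card h.not_diss hc
  · exact h.counts.2.1

lemma Pendant.numAvoid_pos (hC : Pendant G C c) (hc : c ∈ C) : 0 < Dissociation.numAvoid G C c := by
  rw [hC.numAvoid hc]
  exact one_pos

lemma Pendant.two_le_psi (hC : Pendant G C c) : 2 ≤ psi G C := by
  rcases hC with h | h | h | h
  · exact le_trans (by norm_num) h.three_le
  · rw [psi_card_three h.card h.not_diss]
  · rw [psi_card_three h.card h.not_diss]
  · rw [h.counts.1]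
    norm_num

lemma Pendant.num_le (hC : Pendant G C c) (hc : c ∈ C) : num G C ≤ 3 := by
  have h1 := numAvoid_add_numMem (G := G) C c
  rw [hC.numAvoid hc] at h1
  rcases hC with h | h | h | h
  · rw [h.numMem] at h1
    omega
  · rw [num_card_three h.card h.not_diss]
  · rw [num_card_three h.card h.not_diss]
  · rw [h.counts.2.2.1] at h1
    omega

end Pendant

/-! ### The crude bound for forests -/

lemma num_of_card_le_two {U : Finset V} (h : U.card ≤ 2) : num G U = 1 :=
  num_of_diss (diss_of_card_le_two h)

lemma three_pow_mul_le {a b n p : ℕ} (h1 : a ≤ 3 ^ (p / 2)) (h2 : b ≤ 3 ^ (n / 2)) :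
    a * b ≤ 3 ^ ((p + n) / 2) := by
  calc a * b ≤ 3 ^ (p / 2) * 3 ^ (n / 2) := Nat.mul_le_mul h1 h2
    _ = 3 ^ (p / 2 + n / 2) := (pow_add _ _ _).symm
    _ ≤ _ := Nat.pow_le_pow_right (by norm_num) (by omega)

/-- A forest with dissociation number `ψ` has at most `3 ^ ⌊ψ / 2⌋` maximum dissociation sets. -/
theorem num_le_three_pow (hG : G.IsAcyclic) (U : Finset V) : num G U ≤ 3 ^ (psi G U / 2) := by
  induction U using Finset.strongInduction with
  | H U ih =>
  by_cases hU : Conn G U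
  · by_cases h4 : 4 ≤ U.card
    · obtain ⟨R, C, r, c, rfl, hl, hC⟩ := exists_pendant hG hU h4
      have hp := hl.psi_union (hC.numAvoid_pos hl.right_mem)
      have hR : R ⊂ R ∪ C := ⟨subset_union_left, fun q =>
        disjoint_left.1 hl.disj (q (mem_union_right _ hl.right_mem)) hl.right_mem⟩
      rw [hp]
      refine (num_union_le hl.disj hp).trans (three_pow_mul_le (ih R hR) ?_)
      -- A pendant part has at most 3 maximum sets and ψ at least 2, so it pays for its factor 3.
      refine (hC.num_le hl.right_mem).trans ?_
      calc 3 = 3 ^ 1 := rfl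
        _ ≤ _ := Nat.pow_le_pow_right (by norm_num) (by have := hC.two_le_psi; omega)
    · by_cases hd : Diss G U
      · rw [num_of_diss hd]
        exact Nat.one_le_pow _ _ (by norm_num)
      · have h3 : U.card = 3 := by
          have : ¬ U.card ≤ 2 := fun q => hd (diss_of_card_le_two q)
          omega
        rw [num_card_three h3 hd, psi_card_three h3 hd]
        norm_num
  · by_cases hne : U.Nonempty
    · simp only [Conn, hne, true_and, not_forall] at hU
      obtain ⟨Z, hZ, hZne, hno, hZU⟩ := hU
      have hdj : Disjoint Z (U \ Z) := disjoint_sdiff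
      have hun : Z ∪ (U \ Z) = U := union_sdiff_of_subset hZ
      rw [← hun, psi_union_of_noEdge hdj hno, num_union_of_noEdge hdj hno]
      refine three_pow_mul_le (ih Z (hZ.ssubset_of_ne hZU)) (ih _ (sdiff_ssubset hZ hZne))
    · rw [not_nonempty_iff_eq_empty] at hne
      subst hne
      rw [num_of_diss diss_empty]
      exact Nat.one_le_pow _ _ (by norm_num)

/-! ### Essential and saturated vertices, and the bound on `numAvoid` -/

/-- The vertex `u` lies in every maximum dissociation set of `U`. -/
def Essential (G : SimpleGraph V) (U : Finset V) (u : V) : Prop := ∀ S ∈ maxDiss G U, u ∈ S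

lemma numAvoid_eq_zero_iff {U : Finset V} {u : V} : numAvoid G U u = 0 ↔ Essential G U u := by
  rw [numAvoid, card_eq_zero, filter_eq_empty_iff]
  simp only [not_not]
  rfl

lemma not_essential_iff {U : Finset V} {u : V} :
    ¬ Essential G U u ↔ ∃ S ∈ maxDiss G U, u ∉ S := by
  simp [Essential]

lemma Essential.mem {U : Finset V} {u : V} (h : Essential G U u) : u ∈ U := by
  obtain ⟨S, hS⟩ := maxDiss_nonempty (G := G) U
  exact (mem_maxDiss.1 hS).1 (h S hS)

/-- Deleting `u` costs at most one. It costs exactly one, since a set of size ψ without `u` would be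
a maximum set missing an essential vertex. -/
lemma Essential.psi_erase {U : Finset V} {u : V} (h : Essential G U u) : psi G (U.erase u) + 1 = psi G U := by
  obtain ⟨S, hS⟩ := maxDiss_nonempty (G := G) U
  obtain ⟨T, hT⟩ := maxDiss_nonempty (G := G) (U.erase u)
  have huS := h S hS
  have hS' := mem_maxDiss.1 hS
  have hT' := mem_maxDiss.1 hT
  have h1 : (S.erase u).card ≤ psi G (U.erase u) :=
    le_psi (erase_subset_erase _ hS'.1) (hS'.2.1.mono (erase_subset _ _))
  have h2 := psi_mono (G := G) (erase_subset u U)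
  have h3 : psi G (U.erase u) ≠ psi G U := fun q =>
    notMem_erase u U (hT'.1 (h T (mem_maxDiss.2
      ⟨hT'.1.trans (erase_subset _ _), hT'.2.1, hT'.2.2.trans q⟩)))
  have h4 := card_erase_add_one huS
  have := hS'.2.2
  omega

lemma Essential.erase_mem_maxDiss {U : Finset V} {u : V} (h : Essential G U u) {S : Finset V}
    (hS : S ∈ maxDiss G U) : S.erase u ∈ maxDiss G (U.erase u) := by
  have h1 := h.psi_erase
  have h2 := card_erase_add_one (h S hS)
  rw [mem_maxDiss] at hS
  exact mem_maxDiss.2 ⟨erase_subset_erase _ hS.1, hS.2.1.mono (erase_subset _ _), by omega⟩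

lemma Essential.num_le_num_erase {U : Finset V} {u : V} (h : Essential G U u) :
    num G U ≤ num G (U.erase u) := by
  refine card_le_card_of_injOn (fun S => S.erase u) (fun S hS => h.erase_mem_maxDiss hS) ?_
  intro S hS T hT hST
  have hS' := insert_erase (h S hS)
  have hT' := insert_erase (h T hT)
  simp only at hST
  rw [← hS', ← hT', hST]

lemma Essential.num_le (hG : G.IsAcyclic) {U : Finset V} {u : V} (h : Essential G U u) :
    num G U ≤ 3 ^ ((psi G U - 1) / 2) := by
  have h1 := h.psi_erase
  refine (h.num_le_num_erase.trans (num_le_three_pow hG _)).trans_eq ?_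
  congr 2
  omega

lemma psi_erase_of_not_essential {U : Finset V} {v : V} (h : ¬ Essential G U v) :
    psi G (U.erase v) = psi G U := by
  obtain ⟨S, hS, hv⟩ := not_essential_iff.1 h
  rw [mem_maxDiss] at hS
  refine le_antisymm (psi_mono (erase_subset _ _)) ?_
  rw [← hS.2.2]
  exact le_psi (subset_erase.2 ⟨hS.1, hv⟩) hS.2.1

lemma mem_maxDiss_erase {U : Finset V} {v : V} (h : ¬ Essential G U v) {S : Finset V} :
    S ∈ maxDiss G (U.erase v) ↔ S ∈ maxDiss G U ∧ v ∉ S := by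
  rw [mem_maxDiss, mem_maxDiss, psi_erase_of_not_essential h, subset_erase]
  tauto

lemma numAvoid_eq_num_erase {U : Finset V} {v : V} (h : ¬ Essential G U v) :
    numAvoid G U v = num G (U.erase v) := by
  rw [numAvoid, num]
  congr 1
  ext S
  rw [mem_filter, mem_maxDiss_erase h]

/-- The branch of `W` at a vertex `x` adjacent to a vertex `v` outside `W`. -/
lemma exists_branch (hG : G.IsAcyclic) {W : Finset V} {v x : V} (hv : v ∉ W) (hx : x ∈ W)
    (h : G.Adj v x) :
    ∃ B ⊆ W, x ∈ B ∧ NoEdge G B (W \ B) ∧ ∀ u ∈ B, G.Adj v u → u = x := by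
  obtain ⟨K, hKx, hKv, hK⟩ := exists_side hG h.symm
  refine ⟨W.filter (· ∈ K), filter_subset _ _, mem_filter.2 ⟨hx, hKx⟩, ?_, ?_⟩
  · intro a ha b hb hab
    rw [mem_filter] at ha
    rw [mem_sdiff, mem_filter] at hb
    exact hv ((hK a ha.2 b (fun q => hb.2 ⟨hb.1, q⟩) hab).2 ▸ hb.1)
  · intro u hu hvu
    exact (hK u (mem_filter.1 hu).2 v hKv hvu.symm).1

/-- No edge leaves `B` inside `W`, so the parts of a maximum set in `B` and outside `B` can be
chosen independently. -/
lemma swap_mem_maxDiss {W B : Finset V} (hB : B ⊆ W) (hno : NoEdge G B (W \ B)) {S T : Finset V}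
    (hS : S ∈ maxDiss G W) (hT : T ∈ maxDiss G W) :
    T ∩ B ∪ S ∩ (W \ B) ∈ maxDiss G W := by
  have hdj : Disjoint B (W \ B) := disjoint_sdiff
  have hun : B ∪ (W \ B) = W := union_sdiff_of_subset hB
  have hp := psi_union_of_noEdge hdj hno
  rw [← hun] at hS hT
  have h1 := (inter_mem_maxDiss hdj hp hS).2
  have h2 := (inter_mem_maxDiss hdj hp hT).1
  have h3 := union_mem_maxDiss hdj hp h2 h1 ((mem_maxDiss.1 h2).2.1.union (mem_maxDiss.1 h1).2.1
    (hno.mono inter_subset_right inter_subset_right))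
  rwa [hun] at h3

/-- Distinct neighbours of `v` lie in distinct branches of `W`, so `S₀` can be replaced, branch by
branch, by a maximum set missing the given neighbour. The last clause records that the remaining
neighbours of `v` keep their status and that of their own neighbours. -/
lemma exists_avoid (hG : G.IsAcyclic) {W : Finset V} {v : V} (hv : v ∉ W) {S₀ : Finset V}
    (hS₀ : S₀ ∈ maxDiss G W) (X : Finset V) (hX : X ⊆ W) (hadj : ∀ x ∈ X, G.Adj v x)
    (hne : ∀ x ∈ X, ¬ Essential G W x) :
    ∃ S ∈ maxDiss G W, (∀ x ∈ X, x ∉ S) ∧ ∀ u ∈ W, G.Adj v u → u ∉ X →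
      (u ∈ S ↔ u ∈ S₀) ∧ ∀ z ∈ W, G.Adj u z → (z ∈ S ↔ z ∈ S₀) := by
  induction X using Finset.induction_on with
  | empty => exact ⟨S₀, hS₀, by simp, fun _ _ _ _ => ⟨Iff.rfl, fun _ _ _ => Iff.rfl⟩⟩
  | insert x X hxX ih =>
    obtain ⟨S, hS, hav, hag⟩ := ih ((subset_insert _ _).trans hX)
      (fun y hy => hadj y (mem_insert_of_mem hy)) (fun y hy => hne y (mem_insert_of_mem hy))
    have hxW := hX (mem_insert_self x X)
    obtain ⟨T, hT, hxT⟩ := not_essential_iff.1 (hne x (mem_insert_self x X))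
    obtain ⟨B, hBW, hxB, hno, hB⟩ := exists_branch hG hv hxW (hadj x (mem_insert_self x X))
    have hmem : ∀ z ∈ W, z ∉ B → (z ∈ T ∩ B ∪ S ∩ (W \ B) ↔ z ∈ S) := by
      intro z hz hzB
      simp [hz, hzB]
    have hnB : ∀ u ∈ W, G.Adj v u → u ≠ x → u ∉ B := fun u _ hvu hux q => hux (hB u q hvu)
    refine ⟨_, swap_mem_maxDiss hBW hno hS hT, ?_, ?_⟩
    · intro y hy
      rw [mem_insert] at hy
      rcases hy with rfl | hy
      · simp [hxT, hxB]
      · have hyW := hX (mem_insert_of_mem hy)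
        have hyx : y ≠ x := fun q => hxX (q ▸ hy)
        rw [hmem y hyW (hnB y hyW (hadj y (mem_insert_of_mem hy)) hyx)]
        exact hav y hy
    · intro u hu hvu huX
      rw [mem_insert, not_or] at huX
      have huB := hnB u hu hvu huX.1
      obtain ⟨h1, h2⟩ := hag u hu hvu huX.2
      refine ⟨(hmem u hu huB).trans h1, fun z hz huz => ?_⟩
      have hzB : z ∉ B := fun q => hno z q u (mem_sdiff.2 ⟨hu, huB⟩) huz.symm
      exact (hmem z hz hzB).trans (h2 z hz huz)

lemma Diss.insert_of_isolated {S : Finset V} {v : V} (hd : Diss G S) (hi : Isolated G v S) :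
    Diss G (insert v S) := by
  intro a ha b hb c hc hab hac
  rw [mem_insert] at ha hb hc
  rcases ha with rfl | ha
  · rcases hb with rfl | hb
    · exact absurd hab G.irrefl
    · exact absurd hab (hi b hb)
  · rcases hb with rfl | hb
    · exact absurd hab.symm (hi a ha)
    · rcases hc with rfl | hc
      · exact absurd hac.symm (hi a ha)
      · exact hd a ha b hb c hc hab hac

lemma Diss.insert_of_unique {S : Finset V} {v u : V} (hd : Diss G S)
    (hu : Isolated G u S) (hv : ∀ a ∈ S, G.Adj v a → a = u) :
    Diss G (insert v S) := by
  intro a ha b hb c hc hab hac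
  rw [mem_insert] at ha hb hc
  rcases ha with rfl | ha
  · have hb' := hb.resolve_left hab.ne'
    have hc' := hc.resolve_left hac.ne'
    exact (hv b hb' hab).trans (hv c hc' hac).symm
  · rcases hb with rfl | hb
    · rcases hc with rfl | hc
      · rfl
      · exact absurd hac ((hv a ha hab.symm) ▸ hu c hc)
    · rcases hc with rfl | hc
      · exact absurd hab ((hv a ha hac.symm) ▸ hu b hb)
      · exact hd a ha b hb c hc hab hac

/-- The vertex `u` lies in every maximum dissociation set of `U`, and has a neighbour in each. -/
def Saturated (G : SimpleGraph V) (U : Finset V) (u : V) : Prop :=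
  ∀ S ∈ maxDiss G U, u ∈ S ∧ ¬ Isolated G u S

lemma Saturated.essential {U : Finset V} {u : V} (h : Saturated G U u) : Essential G U u :=
  fun S hS => (h S hS).1

/-- Otherwise exchange branches until some maximum set of `U.erase u` misses every neighbour of `u`.
Adding `u` gives a maximum set of `U` in which `u` is isolated. -/
lemma Saturated.exists_essential (hG : G.IsAcyclic) {U : Finset V} {u : V}
    (h : Saturated G U u) : ∃ y, G.Adj u y ∧ Essential G (U.erase u) y := by
  by_contra hcon
  push Not at hcon
  obtain ⟨S₀, hS₀⟩ := maxDiss_nonempty (G := G) (U.erase u)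
  obtain ⟨S, hS, hav, -⟩ := exists_avoid hG (notMem_erase u U) hS₀
    ((U.erase u).filter (G.Adj u)) (filter_subset _ _) (fun x hx => (mem_filter.1 hx).2)
    (fun x hx => hcon x (mem_filter.1 hx).2)
  have hS' := mem_maxDiss.1 hS
  have huS : u ∉ S := fun q => notMem_erase u U (hS'.1 q)
  have hi : Isolated G u S := fun a ha hua => hav a (mem_filter.2 ⟨hS'.1 ha, hua⟩) ha
  have hp := h.essential.psi_erase
  have hc := card_insert_of_notMem huS
  have hmem : insert u S ∈ maxDiss G U := by
    refine mem_maxDiss.2 ⟨?_, hS'.2.1.insert_of_isolated hi, by omega⟩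
    exact insert_subset h.essential.mem (hS'.1.trans (erase_subset _ _))
  refine (h _ hmem).2 fun a ha hua => ?_
  exact hi a ((mem_insert.1 ha).resolve_left hua.ne') hua

/-- Deleting `u` and then the essential neighbour `y` lowers ψ by two; the crude bound does the
rest. -/
lemma Saturated.num_le (hG : G.IsAcyclic) {U : Finset V} {u : V} (h : Saturated G U u) :
    3 * num G (U.erase u) ≤ 3 ^ (psi G U / 2) := by
  obtain ⟨y, -, hy⟩ := h.exists_essential hG
  have h1 := hy.num_le hG
  have h2 := h.essential.psi_erase
  have h3 := hy.psi_erase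
  calc 3 * num G (U.erase u) ≤ 3 * 3 ^ ((psi G (U.erase u) - 1) / 2) := by omega
    _ = 3 ^ ((psi G (U.erase u) - 1) / 2 + 1) := by rw [pow_succ]; ring
    _ = _ := by congr 1; omega

/-- If `v` can be deleted without decreasing the dissociation number, then either some neighbour
is saturated after the deletion, or two neighbours are essential. -/
lemma exists_saturated_or_essential_pair (hG : G.IsAcyclic) {U : Finset V} {v : V} (hv : v ∈ U)
    (h : ¬ Essential G U v) :
    (∃ u, G.Adj v u ∧ Saturated G (U.erase v) u) ∨
      ∃ u u', u ≠ u' ∧ G.Adj v u ∧ G.Adj v u' ∧ Essential G (U.erase v) u ∧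
        Essential G (U.erase v) u' := by
  by_contra hcon
  push Not at hcon
  obtain ⟨hsat, hpair⟩ := hcon
  have hvW := notMem_erase v U
  have hpsi := psi_erase_of_not_essential h
  set W := U.erase v with hW
  let X := W.filter fun x => G.Adj v x ∧ ¬ Essential G W x
  have hX : X ⊆ W := filter_subset _ _
  have hbad : ∀ S ∈ maxDiss G W, ¬ Diss G (insert v S) := by
    intro S hS hd
    rw [mem_maxDiss] at hS
    have := le_psi (insert_subset hv (hS.1.trans (erase_subset _ _))) hd
    rw [card_insert_of_notMem (fun q => hvW (hS.1 q))] at this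
    omega
  by_cases hE : ∃ u, G.Adj v u ∧ Essential G W u
  · obtain ⟨u, hvu, hu⟩ := hE
    -- The vertex `u` is essential but not saturated, so it can be made isolated. It is the only
    -- essential neighbour of `v`; once the other neighbours are exchanged away, `v` can be matched
    -- with `u`.
    have : ∃ S₀ ∈ maxDiss G W, Isolated G u S₀ := by
      have := hsat u hvu
      simp only [Saturated, not_forall] at this
      obtain ⟨S₀, hS₀, hq⟩ := this
      exact ⟨S₀, hS₀, by_contra fun z => hq ⟨hu S₀ hS₀, z⟩⟩
    obtain ⟨S₀, hS₀, hi⟩ := this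
    obtain ⟨S, hS, hav, hag⟩ := exists_avoid hG hvW hS₀ X hX
      (fun x hx => (mem_filter.1 hx).2.1) (fun x hx => (mem_filter.1 hx).2.2)
    have hS' := mem_maxDiss.1 hS
    refine hbad S hS (hS'.2.1.insert_of_unique (u := u) ?_ ?_)
    · intro a ha hua
      have := (hag u hu.mem hvu fun q => (mem_filter.1 q).2.2 hu).2 a (hS'.1 ha) hua
      exact hi a (this.1 ha) hua
    · intro a ha hva
      by_contra hau
      refine hav a (mem_filter.2 ⟨hS'.1 ha, hva, ?_⟩) ha
      exact hpair u a (Ne.symm hau) hvu hva hu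
  · push Not at hE
    obtain ⟨S₀, hS₀⟩ := maxDiss_nonempty (G := G) W
    obtain ⟨S, hS, hav, -⟩ := exists_avoid hG hvW hS₀ X hX
      (fun x hx => (mem_filter.1 hx).2.1) (fun x hx => (mem_filter.1 hx).2.2)
    have hS' := mem_maxDiss.1 hS
    refine hbad S hS (hS'.2.1.insert_of_isolated fun a ha hva => ?_)
    exact hav a (mem_filter.2 ⟨hS'.1 ha, hva, hE a hva⟩) ha

/-- In both cases of `exists_saturated_or_essential_pair` two successive deletions from `U.erase v`
lower ψ by two without losing maximum sets. This saves a factor 3 over the crude bound. -/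
lemma three_mul_numAvoid_le (hG : G.IsAcyclic) {U : Finset V} {v : V} (hv : v ∈ U) :
    3 * numAvoid G U v ≤ 3 ^ (psi G U / 2) := by
  by_cases h : Essential G U v
  · rw [numAvoid_eq_zero_iff.2 h]
    simp
  · rw [numAvoid_eq_num_erase h, ← psi_erase_of_not_essential h]
    rcases exists_saturated_or_essential_pair hG hv h with ⟨u, -, hu⟩ | ⟨u, u', hne, hvu, hvu', hu, hu'⟩
    · have h1 := hu.essential.num_le_num_erase
      have h2 := hu.num_le hG
      omega
    · have hvW := notMem_erase v U
      set W := U.erase v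
      -- Deleting `u` leaves the branch `B` of `u'` untouched. A maximum set missing `u'` could be
      -- transplanted on `B` into a maximum set of `W`.
      have hess : Essential G (W.erase u) u' := by
        intro T hT
        by_contra hu'T
        obtain ⟨S, hS⟩ := maxDiss_nonempty (G := G) W
        have huS := hu.erase_mem_maxDiss hS
        obtain ⟨B, hBW, hxB, hno, hB⟩ := exists_branch hG hvW hu'.mem hvu'
        have huB : u ∉ B := fun q => hne (hB u q hvu)
        have hBW' : B ⊆ W.erase u := subset_erase.2 ⟨hBW, huB⟩
        have hno' : NoEdge G B (W.erase u \ B) :=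
          hno.mono subset_rfl (sdiff_subset_sdiff (erase_subset _ _) subset_rfl)
        have h1 : T ∩ B ∈ maxDiss G B := by
          have hun : B ∪ (W.erase u \ B) = W.erase u := union_sdiff_of_subset hBW'
          rw [← hun] at hT
          exact (inter_mem_maxDiss disjoint_sdiff (psi_union_of_noEdge disjoint_sdiff hno') hT).1
        have hun : B ∪ (W \ B) = W := union_sdiff_of_subset hBW
        have hp := psi_union_of_noEdge (disjoint_sdiff : Disjoint B (W \ B)) hno
        have h2 : S ∩ (W \ B) ∈ maxDiss G (W \ B) := by
          rw [← hun] at hS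
          exact (inter_mem_maxDiss disjoint_sdiff hp hS).2
        have h3 := union_mem_maxDiss disjoint_sdiff hp h1 h2
          ((mem_maxDiss.1 h1).2.1.union (mem_maxDiss.1 h2).2.1
            (hno.mono inter_subset_right inter_subset_right))
        rw [hun] at h3
        have := hu' _ h3
        rw [mem_union, mem_inter, mem_inter, mem_sdiff] at this
        tauto
      have h1 := hu.num_le_num_erase
      have h2 := hess.num_le hG
      have h3 := hu.psi_erase
      have h4 := hess.psi_erase
      calc 3 * num G W ≤ 3 * 3 ^ ((psi G (W.erase u) - 1) / 2) := by omega
        _ = 3 ^ ((psi G (W.erase u) - 1) / 2 + 1) := by rw [pow_succ]; ring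
        _ = _ := by congr 1; omega

/-! ### Attaching paths on three vertices to one vertex -/

/-- `Grow G b v U₀ n U`: the vertex set `U` arises from `U₀` by successively attaching `n` paths on
three vertices to `v`, each by an end vertex or, provided that `b` holds, by its centre. -/
inductive Grow (G : SimpleGraph V) (b : Prop) (v : V) (U₀ : Finset V) : ℕ → Finset V → Prop
  | base : Grow G b v U₀ 0 U₀
  | path {n : ℕ} {U C : Finset V} {c : V} : Grow G b v U₀ n U → Link G U C v c → Path3 G C c →
      Grow G b v U₀ (n + 1) (U ∪ C)
  | cherry {n : ℕ} {U C : Finset V} {c : V} : b → Grow G b v U₀ n U → Link G U C v c →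
      Cherry G C c → Grow G b v U₀ (n + 1) (U ∪ C)

lemma card_three_counts {C : Finset V} {c : V} (h : Cherry G C c ∨ Path3 G C c) :
    psi G C = 2 ∧ num G C = 3 ∧ numAvoid G C c = 1 ∧ numMem G C c = 2 := by
  have h3 : C.card = 3 ∧ ¬ Diss G C ∧ c ∈ C :=
    h.elim (fun h => ⟨h.card, h.not_diss, h.mem⟩) (fun h => ⟨h.card, h.not_diss, h.mem⟩)
  exact ⟨psi_card_three h3.1 h3.2.1, num_card_three h3.1 h3.2.1,
    numAvoid_card_three h3.1 h3.2.1 h3.2.2, numMem_card_three h3.1 h3.2.1 h3.2.2⟩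

lemma Grow.counts {b : Prop} {v : V} {U₀ U : Finset V} {n : ℕ} (h : Grow G b v U₀ n U) :
    psi G U = psi G U₀ + 2 * n ∧ numAvoid G U v = 3 ^ n * numAvoid G U₀ v ∧
      numIso G U v = numIso G U₀ v := by
  have key : ∀ {n : ℕ} {U C : Finset V} {c : V}, Link G U C v c → Cherry G C c ∨ Path3 G C c →
      (psi G U = psi G U₀ + 2 * n ∧ numAvoid G U v = 3 ^ n * numAvoid G U₀ v ∧
      numIso G U v = numIso G U₀ v) →
      (psi G (U ∪ C) = psi G U₀ + 2 * (n + 1) ∧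
        numAvoid G (U ∪ C) v = 3 ^ (n + 1) * numAvoid G U₀ v ∧
        numIso G (U ∪ C) v = numIso G U₀ v) := by
    intro n U C c hl hC ih
    obtain ⟨h1, h2, h3, -⟩ := card_three_counts hC
    have hpos : 0 < numAvoid G C c := by omega
    rw [hl.psi_union hpos, hl.numAvoid_union hpos, hl.numIso_union hpos, h1, h2, h3, ih.1, ih.2.1,
      ih.2.2]
    refine ⟨by ring, by ring, by ring⟩
  induction h with
  | base => simp
  | path _ hl hC ih => exact key hl (Or.inr hC) ih
  | cherry _ _ hl hC ih => exact key hl (Or.inl hC) ih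

lemma psi_ge_three (hG : G.IsAcyclic) {U : Finset V} (hU : Conn G U) (h4 : 4 ≤ U.card) :
    3 ≤ psi G U := by
  obtain ⟨R, C, r, c, rfl, hl, hC⟩ := exists_pendant hG hU h4
  rw [hl.psi_union (hC.numAvoid_pos hl.right_mem)]
  have := psi_pos (G := G) ⟨r, hl.left_mem⟩
  have := hC.two_le_psi
  omega

lemma Link.erase_union {R C : Finset V} {v x : V} (h : Link G R C v x) :
    (R ∪ C).erase v = C ∪ R.erase v := by
  rw [erase_union_distrib, erase_eq_of_notMem (disjoint_left.1 h.disj h.left_mem), union_comm]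

lemma Link.disj_erase {R C : Finset V} {v x : V} (h : Link G R C v x) :
    Disjoint C (R.erase v) := h.disj.symm.mono_right (erase_subset _ _)

lemma Link.noEdge_erase {R C : Finset V} {v x : V} (h : Link G R C v x) :
    NoEdge G C (R.erase v) := by
  intro a ha b hb hab
  rw [mem_erase] at hb
  exact hb.1 (h.eq_of_adj b hb.2 a ha hab.symm).1

lemma Link.child_eq {R C : Finset V} {v x u : V} (h : Link G R C v x) (hu : u ∈ C)
    (hvu : G.Adj v u) : u = x := (h.eq_of_adj v h.left_mem u hu hvu).2

/-! ### The estimate of `2 * numAvoid + numIso` -/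

section Key

variable {R C : Finset V} {v x : V}

lemma Link.mem_maxDiss_erase_union (h : Link G R C v x) {S T : Finset V}
    (hS : S ∈ maxDiss G C) (hT : T ∈ maxDiss G (R.erase v)) :
    S ∪ T ∈ maxDiss G ((R ∪ C).erase v) := by
  rw [h.erase_union]
  refine union_mem_maxDiss h.disj_erase (psi_union_of_noEdge h.disj_erase h.noEdge_erase) hS hT ?_
  rw [mem_maxDiss] at hS hT
  exact hS.2.1.union hT.2.1 (h.noEdge_erase.mono hS.1 hT.1)

lemma Link.essential_right (h : Link G R C v x) (hx : Essential G ((R ∪ C).erase v) x) :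
    Essential G C x := by
  intro S hS
  obtain ⟨T, hT⟩ := maxDiss_nonempty (G := G) (R.erase v)
  have := hx _ (h.mem_maxDiss_erase_union hS hT)
  refine (mem_union.1 this).resolve_right fun q => ?_
  exact disjoint_left.1 h.disj_erase h.right_mem ((mem_maxDiss.1 hT).1 q)

lemma Link.saturated_right (h : Link G R C v x) (hx : Saturated G ((R ∪ C).erase v) x) :
    Saturated G C x := by
  intro S hS
  refine ⟨h.essential_right hx.essential S hS, fun hi => ?_⟩
  obtain ⟨T, hT⟩ := maxDiss_nonempty (G := G) (R.erase v)
  refine (hx _ (h.mem_maxDiss_erase_union hS hT)).2 fun a ha hxa => ?_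
  rw [mem_union] at ha
  rcases ha with ha | ha
  · exact hi a ha hxa
  · exact h.noEdge_erase x h.right_mem a ((mem_maxDiss.1 hT).1 ha) hxa

/-- If `v` is isolated in a maximum dissociation set, and not essential, and its neighbour `x` is
essential once `v` is deleted, then the restrictions of that set are maximum. -/
lemma Link.restrict_isolated (h : Link G R C v x) (hv : ¬ Essential G (R ∪ C) v)
    (hx : Essential G ((R ∪ C).erase v) x) {S : Finset V} (hS : S ∈ maxDiss G (R ∪ C))
    (hvS : v ∈ S) (hi : Isolated G v S) :
    S ∩ C ∈ maxDiss G (C.erase x) ∧ S ∩ R.erase v ∈ maxDiss G (R.erase v) := by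
  have hp := psi_erase_of_not_essential hv
  rw [h.erase_union, psi_union_of_noEdge h.disj_erase h.noEdge_erase] at hp
  have hq := (h.essential_right hx).psi_erase
  have hxS : x ∉ S := fun q => hi x q h.adj
  rw [mem_maxDiss] at hS
  have h1 : S ∩ C ⊆ C.erase x :=
    subset_erase.2 ⟨inter_subset_right, fun q => hxS (mem_inter.1 q).1⟩
  have hd1 : Diss G (S ∩ C) := hS.2.1.mono inter_subset_left
  have hd2 : Diss G (S ∩ R.erase v) := hS.2.1.mono inter_subset_left
  have h2 := le_psi h1 hd1
  have h3 := le_psi (inter_subset_right : S ∩ R.erase v ⊆ R.erase v) hd2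
  have hSe : S.erase v = S ∩ C ∪ S ∩ R.erase v := by
    rw [← inter_union_distrib_left, ← h.erase_union, inter_erase, inter_eq_left.2 hS.1]
  have hc := congrArg card hSe
  rw [card_union_of_disjoint (h.disj_erase.mono inter_subset_right inter_subset_right)] at hc
  have := card_erase_add_one hvS
  exact ⟨mem_maxDiss_of_le h1 hd1 (by omega), mem_maxDiss_of_le inter_subset_right hd2 (by omega)⟩

/-- If `v` is isolated in a maximum set `S`, then `S` is maximum on the part `R.erase v` beyond the
branch of `u`. So it must contain `u'` there, which is a neighbour of `v`. -/
lemma Link.not_essential_pair (hG : G.IsAcyclic) {U : Finset V} (hv : v ∈ U)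
    (hne : ¬ Essential G U v) {u u' : V} (huu : u ≠ u') (hvu : G.Adj v u) (hvu' : G.Adj v u')
    (hu : Essential G (U.erase v) u) (hu' : Essential G (U.erase v) u') : numIso G U v = 0 := by
  obtain ⟨R, C, rfl, hl⟩ := exists_link hG hv (mem_of_mem_erase hu.mem) hvu
  rw [numIso, card_eq_zero, filter_eq_empty_iff]
  rintro S hS ⟨hvS, hi⟩
  obtain ⟨-, h2⟩ := hl.restrict_isolated hne hu hS hvS hi
  obtain ⟨T, hT⟩ := maxDiss_nonempty (G := G) C
  have := hu' _ (hl.mem_maxDiss_erase_union hT h2)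
  rw [mem_union, mem_inter] at this
  rcases this with h | h
  · exact huu (hl.child_eq ((mem_maxDiss.1 hT).1 h) hvu').symm
  · exact hi u' h.1 hvu'

lemma Link.numAvoid_eq (h : Link G R C v x) (hv : ¬ Essential G (R ∪ C) v) :
    numAvoid G (R ∪ C) v = num G C * num G (R.erase v) := by
  rw [numAvoid_eq_num_erase hv, h.erase_union, num_union_of_noEdge h.disj_erase h.noEdge_erase]

lemma Link.psi_eq (h : Link G R C v x) (hv : ¬ Essential G (R ∪ C) v) :
    psi G (R ∪ C) = psi G C + psi G (R.erase v) := by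
  rw [← psi_erase_of_not_essential hv, h.erase_union,
    psi_union_of_noEdge h.disj_erase h.noEdge_erase]

lemma Link.numIso_le (h : Link G R C v x) (hv : ¬ Essential G (R ∪ C) v)
    (hx : Essential G ((R ∪ C).erase v) x) :
    numIso G (R ∪ C) v ≤ num G (C.erase x) *
      ((maxDiss G (R.erase v)).filter fun T => Isolated G v T).card := by
  rw [num, ← card_product]
  refine card_le_card_of_injOn (fun S => (S ∩ C, S ∩ R.erase v)) ?_ ?_
  · intro S hS
    have hS' := mem_filter.1 hS
    obtain ⟨h1, h2⟩ := h.restrict_isolated hv hx hS'.1 hS'.2.1 hS'.2.2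
    exact mem_product.2 ⟨h1, mem_filter.2 ⟨h2, fun a ha => hS'.2.2 a (mem_inter.1 ha).1⟩⟩
  · intro S hS T hT hST
    have hS' := mem_filter.1 hS
    have hT' := mem_filter.1 hT
    simp only [Prod.mk.injEq] at hST
    have key : ∀ S ⊆ R ∪ C, v ∈ S → S = insert v (S ∩ C ∪ S ∩ R.erase v) := by
      intro S hS hvS
      rw [← inter_union_distrib_left, ← h.erase_union, inter_erase, inter_eq_left.2 hS,
        insert_erase hvS]
    rw [key S (mem_maxDiss.1 hS'.1).1 hS'.2.1, key T (mem_maxDiss.1 hT'.1).1 hT'.2.1, hST.1, hST.2]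

/-- Every maximum set contains the matched pair `x`, `y`, hence omits `z`. Deleting the pair costs
two in ψ, and `three_mul_numAvoid_le` at `z` saves another factor 3. -/
lemma Saturated.nine_mul_num_le (hG : G.IsAcyclic) {y z a : V} (hx : Saturated G C x)
    (hxy : G.Adj x y) (hy : Essential G (C.erase x) y) (hz : z ∈ (C.erase x).erase y)
    (ha : a = x ∨ a = y) (haz : G.Adj a z) : 9 * num G C ≤ 3 ^ (psi G C / 2) := by
  have hz' := hz
  simp only [mem_erase] at hz'
  have h1 : num G C ≤ numAvoid G ((C.erase x).erase y) z := by
    refine card_le_card_of_injOn (fun S => (S.erase x).erase y) ?_ ?_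
    · intro S hS
      have h2 := hx.essential.erase_mem_maxDiss hS
      have hyS := mem_of_mem_erase (hy _ h2)
      have hxS := hx.essential _ hS
      refine mem_filter.2 ⟨hy.erase_mem_maxDiss h2, fun hz'' => ?_⟩
      have hzS : z ∈ S := mem_of_mem_erase (mem_of_mem_erase hz'')
      have hd := (mem_maxDiss.1 hS).2.1
      rcases ha with rfl | rfl
      · exact hz'.1 (hd a hxS z hzS y hyS haz hxy)
      · exact hz'.2.1 (hd a hyS z hzS x hxS haz hxy.symm)
    · have key : ∀ S ∈ maxDiss G C, S = insert x (insert y ((S.erase x).erase y)) := by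
        intro S hS
        rw [insert_erase (hy _ (hx.essential.erase_mem_maxDiss hS)),
          insert_erase (hx.essential _ hS)]
      intro S hS T hT hST
      simp only at hST
      rw [key S hS, key T hT, hST]
  have h2 := three_mul_numAvoid_le hG hz
  have h3 := hx.essential.psi_erase
  have h4 := hy.psi_erase
  calc 9 * num G C ≤ 3 * 3 ^ (psi G ((C.erase x).erase y) / 2) := by omega
    _ = 3 ^ (psi G ((C.erase x).erase y) / 2 + 1) := by rw [pow_succ]; ring
    _ = _ := by congr 1; omega

/-- No edge of `U` leaves `C ∩ C'`: it would have to end at `v`, forcing `u = u'`. A nonempty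
intersection would therefore be all of `U`, although it misses `v`. -/
lemma link_inter_empty {U R' C' : Finset V} {u u' : V} (hU : Conn G U) (hv : v ∈ U)
    (hR : R ∪ C = U) (h : Link G R C v u) (hR' : R' ∪ C' = U) (h' : Link G R' C' v u')
    (huu : u ≠ u') : Disjoint C C' := by
  rw [disjoint_iff_inter_eq_empty]
  by_contra hne
  have hvC : v ∉ C := disjoint_left.1 h.disj h.left_mem
  have hCU : C ⊆ U := hR ▸ subset_union_right
  have := hU.2 (C ∩ C') (inter_subset_left.trans hCU) (nonempty_iff_ne_empty.2 hne) ?_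
  · exact hvC (mem_inter.1 (this.symm ▸ hv)).1
  · intro a ha b hb hab
    rw [mem_inter] at ha
    rw [mem_sdiff, mem_inter] at hb
    by_cases hbC : b ∈ C
    · have hbC' : b ∉ C' := fun q => hb.2 ⟨hbC, q⟩
      have hbR' : b ∈ R' := (mem_union.1 (hR'.symm ▸ hb.1)).resolve_right hbC'
      exact hvC ((h'.eq_of_adj b hbR' a ha.2 hab.symm).1 ▸ hbC)
    · have hbR : b ∈ R := (mem_union.1 (hR.symm ▸ hb.1)).resolve_right hbC
      have hau := (h.eq_of_adj b hbR a ha.1 hab.symm).2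
      exact huu (h'.child_eq (hau ▸ ha.2) h.adj)

end Key

/-- A vertex `v` with a pendant edge `xy` whose remaining branches are paths on three vertices. -/
lemma exists_grow {U R C : Finset V} {v x y : V} (hU : Conn G U) (hRC : R ∪ C = U)
    (hl : Link G R C v x) (hC : C = {x, y}) (hxy : G.Adj x y)
    (hb : ∀ u ∈ R, G.Adj v u → ∃ R' C', R' ∪ C' = U ∧ Link G R' C' v u ∧
      (Cherry G C' u ∨ Path3 G C' u)) :
    ∃ n, Path3 G {v, x, y} v ∧ Grow G True v {v, x, y} n U := by
  have hyC : y ∈ C := by rw [hC]; simp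
  have hvC : v ∉ C := disjoint_left.1 hl.disj hl.left_mem
  have hP : Path3 G {v, x, y} v := ⟨x, y, rfl, fun q => hvC (q ▸ hyC), hl.adj, hxy,
    fun q => hxy.ne (hl.child_eq hyC q).symm⟩
  choose! R' C' hU' hl' hC' using hb
  have hvU : v ∈ U := hRC ▸ mem_union_left _ hl.left_mem
  have hdC : ∀ u ∈ R, G.Adj v u → Disjoint C (C' u) := by
    intro u hu hvu
    refine link_inter_empty hU hvU hRC hl (hU' u hu hvu) (hl' u hu hvu) ?_
    rintro rfl
    exact disjoint_left.1 hl.disj hu hl.right_mem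
  have hvC' : ∀ u ∈ R, G.Adj v u → v ∉ C' u := fun u hu hvu =>
    disjoint_left.1 (hl' u hu hvu).disj (hl' u hu hvu).left_mem
  have hsub : ∀ u ∈ R, G.Adj v u → C' u ⊆ U := fun u hu hvu =>
    (hU' u hu hvu) ▸ subset_union_right
  have hUmem : ∀ u ∈ R, G.Adj v u → ∀ z ∈ U, z ∉ C' u → z ∈ R' u := by
    intro u hu hvu z hz hzC
    rw [← hU' u hu hvu, mem_union] at hz
    exact hz.resolve_right hzC
  have h0U : ({v, x, y} : Finset V) ⊆ U := by
    intro z hz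
    rw [mem_insert, ← hC] at hz
    rcases hz with rfl | hz
    · exact hvU
    · exact hRC ▸ mem_union_right _ hz
  -- Attach the branches at the neighbours of `v` in `R` one at a time; distinct branches are
  -- disjoint.
  have build : ∀ Y : Finset V, (∀ u ∈ Y, u ∈ R ∧ G.Adj v u) →
      ∃ n, Grow G True v {v, x, y} n ({v, x, y} ∪ Y.biUnion C') := by
    intro Y
    induction Y using Finset.induction_on with
    | empty => exact fun _ => ⟨0, by rw [biUnion_empty, union_empty]; exact Grow.base⟩
    | insert u Y huY ih =>
      intro hY
      obtain ⟨n, hn⟩ := ih fun z hz => hY z (mem_insert_of_mem hz)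
      obtain ⟨hu, hvu⟩ := hY u (mem_insert_self _ _)
      have hsubU : {v, x, y} ∪ Y.biUnion C' ⊆ U := union_subset h0U (biUnion_subset.2 fun z hz =>
        hsub z (hY z (mem_insert_of_mem hz)).1 (hY z (mem_insert_of_mem hz)).2)
      have hdj : Disjoint ({v, x, y} ∪ Y.biUnion C') (C' u) := by
        rw [disjoint_union_left, disjoint_biUnion_left]
        constructor
        · rw [disjoint_left]
          intro z hz
          rw [mem_insert, ← hC] at hz
          rcases hz with rfl | hz
          · exact hvC' u hu hvu
          · exact disjoint_left.1 (hdC u hu hvu) hz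
        · intro z hz
          obtain ⟨hzR, hvz⟩ := hY z (mem_insert_of_mem hz)
          exact link_inter_empty hU hvU (hU' z hzR hvz) (hl' z hzR hvz) (hU' u hu hvu)
            (hl' u hu hvu) (fun q => huY (q ▸ hz))
      have hlink : Link G ({v, x, y} ∪ Y.biUnion C') (C' u) v u := by
        refine ⟨hdj, mem_union_left _ (mem_insert_self _ _), (hl' u hu hvu).right_mem, hvu, ?_⟩
        intro a ha b hb hab
        exact (hl' u hu hvu).eq_of_adj a
          (hUmem u hu hvu a (hsubU ha) (disjoint_left.1 hdj ha)) b hb hab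
      refine ⟨n + 1, ?_⟩
      rw [biUnion_insert, union_comm (C' u), ← union_assoc]
      rcases hC' u hu hvu with h | h
      · exact hn.cherry trivial hlink h
      · exact hn.path hlink h
  obtain ⟨n, hn⟩ := build (R.filter (G.Adj v)) fun u hu => mem_filter.1 hu
  refine ⟨n, hP, ?_⟩
  have hall : {v, x, y} ∪ (R.filter (G.Adj v)).biUnion C' = U := by
    refine hU.2 _ ?_ ⟨v, mem_union_left _ (mem_insert_self _ _)⟩ ?_
    · refine union_subset h0U (biUnion_subset.2 fun z hz => ?_)
      exact hsub z (mem_filter.1 hz).1 (mem_filter.1 hz).2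
    · intro a ha b hb hab
      rw [mem_sdiff, mem_union, not_or, mem_biUnion, not_exists] at hb
      obtain ⟨hbU, hb0, hb1⟩ := hb
      have hbv : b ≠ v := fun q => hb0 (q ▸ mem_insert_self _ _)
      have hbC : b ∉ C := fun q => hb0 (mem_insert_of_mem (hC ▸ q))
      have hbR : b ∈ R := by
        rw [← hRC, mem_union] at hbU
        exact hbU.resolve_right hbC
      rw [mem_union, mem_insert, ← hC, mem_biUnion] at ha
      rcases ha with (rfl | ha) | ⟨u, hu, ha⟩
      · have hbY : b ∈ R.filter (G.Adj a) := mem_filter.2 ⟨hbR, hab⟩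
        exact hb1 b ⟨hbY, (hl' b hbR hab).right_mem⟩
      · exact hbv (hl.eq_of_adj b hbR a ha hab.symm).1
      · obtain ⟨huR, hvu⟩ := mem_filter.1 hu
        have hbu : b ∉ C' u := fun q => hb1 u ⟨hu, q⟩
        exact hbv ((hl' u huR hvu).eq_of_adj b (hUmem u huR hvu b hbU hbu) a ha hab.symm).1
  rwa [hall] at hn

/-- The main estimate on the maximum dissociation sets that can be combined with a pendant path
attached at `v`. -/
theorem two_mul_numAvoid_add_numIso_le (hG : G.IsAcyclic) {U : Finset V} (hU : Conn G U) {v : V}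
    (hv : v ∈ U) (h2 : 2 ≤ psi G U)
    (ih : ∀ B ⊂ U, Conn G B → 3 ≤ psi G B → 3 * num G B ≤ 2 * 3 ^ (psi G B / 2)) :
    (2 * numAvoid G U v + numIso G U v ≤ 2 * 3 ^ (psi G U / 2 - 1) ∧
      (2 * numAvoid G U v + numIso G U v = 2 * 3 ^ (psi G U / 2 - 1) →
        numAvoid G U v = 3 ^ (psi G U / 2 - 1))) ∨
      ∃ U₀ n, Path3 G U₀ v ∧ Grow G True v U₀ n U := by
  have ht : 3 ^ (psi G U / 2) = 3 * 3 ^ (psi G U / 2 - 1) := by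
    rw [← pow_succ']
    congr 1
    omega
  have htpos : 0 < 3 ^ (psi G U / 2 - 1) := by positivity
  have hA := three_mul_numAvoid_le hG hv
  -- Write `t = 3 ^ (psi G U / 2 - 1)`. If `v` is essential, then `numAvoid` vanishes, and deleting
  -- `v` injects the sets with `v` isolated into sets avoiding a neighbour, of which there are at
  -- most `t`.
  by_cases hess : Essential G U v
  · left
    rw [numAvoid_eq_zero_iff.2 hess]
    have hcard : 2 ≤ U.card := h2.trans (psi_le_card U)
    obtain ⟨u, hu, hvu⟩ := hU.exists_adj_of_mem hv hcard
    have h3 : numIso G U v ≤ numAvoid G (U.erase v) u := by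
      refine card_le_card_of_injOn (fun S => S.erase v) ?_ ?_
      · intro S hS
        have hS' := mem_filter.1 hS
        exact mem_filter.2 ⟨hess.erase_mem_maxDiss hS'.1,
          fun q => hS'.2.2 u (mem_of_mem_erase q) hvu⟩
      · intro S hS T hT hST
        simp only at hST
        rw [← insert_erase (mem_filter.1 hS).2.1, hST, insert_erase (mem_filter.1 hT).2.1]
    have h4 := three_mul_numAvoid_le hG (mem_erase.2 ⟨hvu.ne', hu⟩)
    have h5 : 3 ^ (psi G (U.erase v) / 2) ≤ 3 ^ (psi G U / 2) :=
      Nat.pow_le_pow_right (by norm_num) (Nat.div_le_div_right (psi_mono (erase_subset _ _)))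
    omega
  by_cases hiso : numIso G U v = 0
  · left
    omega
  rcases exists_saturated_or_essential_pair hG hv hess with
    ⟨x, hvx, hx⟩ | ⟨u, u', huu, hvu, hvu', hu, hu'⟩
  swap
  · exact absurd (Link.not_essential_pair hG hv hess huu hvu hvu' hu hu') hiso
  obtain ⟨R, C, rfl, hl⟩ := exists_link hG hv (mem_of_mem_erase hx.essential.mem) hvx
  have hxC := hl.saturated_right hx
  have hA0 := hl.numAvoid_eq hess
  have hpsi := hl.psi_eq hess
  have hA1 := hl.numIso_le hess hx.essential
  have hQ : ((maxDiss G (R.erase v)).filter fun T => Isolated G v T).card ≤ num G (R.erase v) :=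
    card_filter_le _ _
  have hF := num_le_three_pow hG (R.erase v)
  obtain ⟨y, hxy, hy⟩ := hxC.exists_essential hG
  -- If the branch of `x` is larger than the edge `xy`, then `numAvoid` is at most `t / 3` and
  -- `numIso` at most `t`, for a total of at most `5t / 3`.
  by_cases hD : ((C.erase x).erase y).Nonempty
  · left
    have hCconn := hl.conn_right hU
    have hyC := mem_of_mem_erase hy.mem
    obtain ⟨a, ha, z, hzC, hz, haz⟩ := hCconn.exists_adj (Z := {x, y})
      (by
        intro z hz
        rw [mem_insert, mem_singleton] at hz
        rcases hz with rfl | rfl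
        · exact hl.right_mem
        · exact hyC)
      ⟨x, mem_insert_self _ _⟩
      (by
        intro q
        obtain ⟨z, hz⟩ := hD
        rw [← q] at hz
        simp only [mem_erase, mem_insert, mem_singleton] at hz
        tauto)
    rw [mem_insert, mem_singleton] at ha
    rw [mem_insert, mem_singleton, not_or] at hz
    have h9 := hxC.nine_mul_num_le hG hxy hy
      (mem_erase.2 ⟨hz.2, mem_erase.2 ⟨hz.1, hzC⟩⟩) ha haz
    have h3 := hxC.num_le hG
    have hprod : 3 ^ (psi G C / 2) * 3 ^ (psi G (R.erase v) / 2) ≤ 3 ^ (psi G (R ∪ C) / 2) := by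
      rw [hpsi]
      exact three_pow_mul_le le_rfl le_rfl
    have e1 := Nat.mul_le_mul h9 hF
    have e2 := Nat.mul_le_mul h3 (hQ.trans hF)
    have e3 : 9 * numAvoid G (R ∪ C) v ≤ 3 ^ (psi G C / 2) * 3 ^ (psi G (R.erase v) / 2) := by
      rw [hA0, ← mul_assoc]
      exact e1
    have e4 : 3 * numIso G (R ∪ C) v ≤ 3 ^ (psi G C / 2) * 3 ^ (psi G (R.erase v) / 2) := by
      refine le_trans (Nat.mul_le_mul_left 3 hA1) ?_
      rw [← mul_assoc]
      exact e2
    omega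
  · have hCe : C = {x, y} := by
      ext z
      rw [mem_insert, mem_singleton]
      constructor
      · intro hz
        by_contra hcon
        rw [not_or] at hcon
        exact hD ⟨z, mem_erase.2 ⟨hcon.2, mem_erase.2 ⟨hcon.1, hz⟩⟩⟩
      · rintro (rfl | rfl)
        · exact hl.right_mem
        · exact mem_of_mem_erase hy.mem
    have hCcard : C.card = 2 := by rw [hCe, card_pair hxy.ne]
    have hnC : num G C = 1 := num_of_card_le_two hCcard.le
    have hpC : psi G C = 2 := by rw [psi_of_card_le_two hCcard.le, hCcard]
    have hnCx : num G (C.erase x) = 1 :=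
      num_of_card_le_two ((card_le_card (erase_subset _ _)).trans hCcard.le)
    rw [hnC, one_mul] at hA0
    rw [hnCx, one_mul] at hA1
    have hpF : psi G (R ∪ C) / 2 - 1 = psi G (R.erase v) / 2 := by omega
    have hchild : ∀ u ∈ R, G.Adj v u → ∃ R' C', R' ∪ C' = R ∪ C ∧ Link G R' C' v u ∧
        C' ⊆ R.erase v ∧ NoEdge G C' (R.erase v \ C') := by
      intro u hu hvu
      obtain ⟨R', C', hU', hl'⟩ := exists_link hG hv (mem_union_left C hu) hvu
      have hdj : Disjoint C C' := link_inter_empty hU hv rfl hl hU' hl' (by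
        rintro rfl
        exact disjoint_left.1 hl.disj hu hl.right_mem)
      have hvC' : v ∉ C' := disjoint_left.1 hl'.disj hl'.left_mem
      have hCR : C' ⊆ R := by
        intro z hz
        have : z ∈ R ∪ C := hU' ▸ mem_union_right _ hz
        exact (mem_union.1 this).resolve_right fun q => disjoint_left.1 hdj q hz
      refine ⟨R', C', hU', hl', subset_erase.2 ⟨hCR, hvC'⟩, ?_⟩
      intro a ha b hb hab
      rw [mem_sdiff, mem_erase] at hb
      have : b ∈ R' ∪ C' := hU' ▸ mem_union_left _ hb.1.2
      exact hb.1.1 (hl'.eq_of_adj b ((mem_union.1 this).resolve_right hb.2) a ha hab.symm).1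
    have hAv : ∀ u, G.Adj v u →
        ((maxDiss G (R.erase v)).filter fun T => Isolated G v T).card ≤
          numAvoid G (R.erase v) u := by
      intro u hvu
      refine card_le_card fun T hT => ?_
      rw [mem_filter] at hT ⊢
      exact ⟨hT.1, fun q => hT.2 u q hvu⟩
    -- Now `numAvoid` is the number of maximum sets of `R.erase v`, and `numIso` is at most the
    -- number of those missing all neighbours of `v`. A further branch with ψ at least 3 reduces
    -- these to at most `2t / 3`, by `ih`, and `t / 3`; the total is again at most `5t / 3`.
    by_cases hbig : ∃ u ∈ R, G.Adj v u ∧ ∃ R' C', R' ∪ C' = R ∪ C ∧ Link G R' C' v u ∧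
        C' ⊆ R.erase v ∧ NoEdge G C' (R.erase v \ C') ∧ 3 ≤ psi G C'
    · left
      obtain ⟨u, hu, hvu, R', C', hU', hl', hsub, hno, h3⟩ := hbig
      have hvC' : v ∉ C' := disjoint_left.1 hl'.disj hl'.left_mem
      have hss : C' ⊂ R ∪ C := ⟨hU' ▸ subset_union_right, fun q => hvC' (q hv)⟩
      have h4 := ih C' hss (hl'.conn_right (hU'.symm ▸ hU)) h3
      have hun : C' ∪ (R.erase v \ C') = R.erase v := union_sdiff_of_subset hsub
      have h5 := num_union_of_noEdge disjoint_sdiff hno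
      have h6 := psi_union_of_noEdge disjoint_sdiff hno
      rw [hun] at h5 h6
      have h7 := num_le_three_pow hG (R.erase v \ C')
      have h8 : 3 ^ (psi G C' / 2) * 3 ^ (psi G (R.erase v \ C') / 2) ≤
          3 ^ (psi G (R.erase v) / 2) := by
        rw [h6]
        exact three_pow_mul_le le_rfl le_rfl
      have h9 : 3 * num G (R.erase v) ≤ 2 * 3 ^ (psi G (R.erase v) / 2) := by
        calc 3 * num G (R.erase v) = 3 * num G C' * num G (R.erase v \ C') := by rw [h5]; ring
          _ ≤ (2 * 3 ^ (psi G C' / 2)) * 3 ^ (psi G (R.erase v \ C') / 2) := Nat.mul_le_mul h4 h7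
          _ = 2 * (3 ^ (psi G C' / 2) * 3 ^ (psi G (R.erase v \ C') / 2)) := by ring
          _ ≤ _ := Nat.mul_le_mul_left 2 h8
      have h10 := three_mul_numAvoid_le hG (mem_erase.2 ⟨hvu.ne', hu⟩ : u ∈ R.erase v)
      have h11 := hAv u hvu
      rw [hpF] at htpos ⊢
      omega
    · right
      push Not at hbig
      refine ⟨{v, x, y}, exists_grow hU rfl hl hCe hxy fun u hu hvu => ?_⟩
      obtain ⟨R', C', hU', hl', hsub, hno⟩ := hchild u hu hvu
      refine ⟨R', C', hU', hl', ?_⟩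
      have hconn : Conn G C' := hl'.conn_right (hU'.symm ▸ hU)
      have h3 := hbig u hu hvu R' C' hU' hl' hsub hno
      have h4 : C'.card < 4 := by
        by_contra hlt
        have := psi_ge_three hG hconn (by omega)
        omega
      -- A branch that is itself a dissociation set is its own unique maximum set and contains `u`,
      -- so `v` could never be isolated, against `hiso`. What remains are branches P₃.
      have hnd : ¬ Diss G C' := by
        intro hd
        have hpos : 0 < ((maxDiss G (R.erase v)).filter fun T => Isolated G v T).card := by omega
        obtain ⟨T, hT⟩ := card_pos.1 hpos
        rw [mem_filter] at hT
        have hun : C' ∪ (R.erase v \ C') = R.erase v := union_sdiff_of_subset hsub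
        have hT1 := hT.1
        rw [← hun] at hT1
        have := (inter_mem_maxDiss disjoint_sdiff (psi_union_of_noEdge disjoint_sdiff hno) hT1).1
        rw [maxDiss_of_diss hd, mem_singleton] at this
        have huT : u ∈ T ∩ C' := this.symm ▸ hl'.right_mem
        exact hT.2 u (mem_inter.1 huT).1 hvu
      have h5 : ¬ C'.card ≤ 2 := fun q => hnd (diss_of_card_le_two q)
      exact conn_card_three hG hconn (by omega) hl'.right_mem

/-! ### Counting in the extremal trees -/

lemma Grow.num_of_path4 {v : V} {U₀ U : Finset V} {n : ℕ} (h₀ : Path4 G U₀ v)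
    (h : Grow G True v U₀ n U) :
    psi G U = 2 * n + 3 ∧ numAvoid G U v = 3 ^ n ∧ num G U = 3 ^ n + 1 := by
  obtain ⟨c1, c2, c3, c4⟩ := h₀.counts
  have hc : ∀ {n : ℕ} {U : Finset V}, Grow G True v U₀ n U →
      psi G U = 2 * n + 3 ∧ numAvoid G U v = 3 ^ n ∧ numIso G U v = 0 := by
    intro n U h
    obtain ⟨h1, h2, h3⟩ := h.counts
    rw [c1] at h1
    rw [c2, mul_one] at h2
    rw [c4] at h3
    exact ⟨by omega, h2, h3⟩
  refine ⟨(hc h).1, (hc h).2.1, ?_⟩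
  induction h with
  | base =>
    have := numAvoid_add_numMem (G := G) U₀ v
    omega
  | path hg hl hC ih =>
    obtain ⟨-, -, h3, h4⟩ := card_three_counts (Or.inr hC)
    rw [hl.num_union (by omega), h3, h4, (hc hg).2.1, (hc hg).2.2, ih]
    ring
  | cherry _ hg hl hC ih =>
    obtain ⟨-, -, h3, h4⟩ := card_three_counts (Or.inl hC)
    rw [hl.num_union (by omega), h3, h4, (hc hg).2.1, (hc hg).2.2, ih]
    ring

lemma Path3.counts {C : Finset V} {c : V} (h : Path3 G C c) :
    psi G C = 2 ∧ num G C = 3 ∧ numAvoid G C c = 1 ∧ numMem G C c = 2 ∧ Dissociation.numIso G C c = 1 := by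
  obtain ⟨h1, h2, h3, h4⟩ := card_three_counts (Or.inr h)
  exact ⟨h1, h2, h3, h4, h.numIso⟩

lemma Cherry.counts {C : Finset V} {c : V} (h : Cherry G C c) :
    psi G C = 2 ∧ num G C = 3 ∧ numAvoid G C c = 1 ∧ numMem G C c = 2 ∧ Dissociation.numIso G C c = 0 := by
  obtain ⟨h1, h2, h3, h4⟩ := card_three_counts (Or.inl h)
  exact ⟨h1, h2, h3, h4, h.numIso⟩

lemma Grow.counts_of_path3 {b : Prop} {v : V} {U₀ U : Finset V} {n : ℕ} (h₀ : Path3 G U₀ v)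
    (h : Grow G b v U₀ n U) :
    psi G U = 2 * n + 2 ∧ numAvoid G U v = 3 ^ n ∧ numIso G U v = 1 := by
  obtain ⟨c1, -, c2, -, c3⟩ := h₀.counts
  obtain ⟨h1, h2, h3⟩ := h.counts
  rw [c1] at h1
  rw [c2, mul_one] at h2
  rw [c3] at h3
  exact ⟨by omega, h2, h3⟩

lemma Grow.num_of_path3 {v : V} {U₀ U : Finset V} {n : ℕ} (h₀ : Path3 G U₀ v)
    (h : Grow G False v U₀ n U) : num G U = 3 ^ n + n + 2 := by
  induction h with
  | base => rw [h₀.counts.2.1]; norm_num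
  | path hg hl hC ih =>
    obtain ⟨-, -, h3, h4, h5⟩ := hC.counts
    obtain ⟨-, a1, a2⟩ := hg.counts_of_path3 h₀
    rw [hl.num_union (by omega), h3, h4, h5, a1, a2, ih]
    ring
  | cherry hb => exact hb.elim

/-- Attaching P₃ by an end adds `2 * 3 ^ n + 1` maximum sets, attaching it by the centre only `2 * 3
^ n`. Equality therefore excludes cherries. -/
lemma Grow.num_le_of_path3 {v : V} {U₀ U : Finset V} {n : ℕ} (h₀ : Path3 G U₀ v)
    (h : Grow G True v U₀ n U) :
    num G U ≤ 3 ^ n + n + 2 ∧ (num G U = 3 ^ n + n + 2 → Grow G False v U₀ n U) := by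
  induction h with
  | base => exact ⟨by rw [h₀.counts.2.1]; norm_num, fun _ => Grow.base⟩
  | path hg hl hC ih =>
    obtain ⟨-, -, h3, h4, h5⟩ := hC.counts
    obtain ⟨-, a1, a2⟩ := hg.counts_of_path3 h₀
    rw [hl.num_union (by omega), h3, h4, h5, a1, a2, pow_succ]
    exact ⟨by omega, fun q => (ih.2 (by omega)).path hl hC⟩
  | cherry _ hg hl hC ih =>
    obtain ⟨-, -, h3, h4, h5⟩ := hC.counts
    obtain ⟨-, a1, a2⟩ := hg.counts_of_path3 h₀
    rw [hl.num_union (by omega), h3, h4, h5, a1, a2, pow_succ]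
    exact ⟨by omega, fun q => absurd q (by omega)⟩

lemma Link.union_mem_maxDiss {R C : Finset V} {r c : V} (h : Link G R C r c)
    (hc : 0 < numAvoid G C c) {S T : Finset V} (hS : S ∈ maxDiss G R) (hr : r ∉ S)
    (hT : T ∈ maxDiss G C) : S ∪ T ∈ maxDiss G (R ∪ C) := by
  refine Dissociation.union_mem_maxDiss h.disj (h.psi_union hc) hS hT ?_
  rw [mem_maxDiss] at hS hT
  exact (h.diss_union_iff hS.1 hT.1 hS.2.1 hT.2.1).2 fun q => absurd q hr

lemma Path4.card {C : Finset V} {c : V} (h : Path4 G C c) : C.card = 4 := by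
  obtain ⟨l, p, q, rfl, hlp, hlq, hcq, hcl, hcp, hpq, -⟩ := h
  rw [card_insert_of_notMem, card_eq_three.2 ⟨l, p, q, hlp, hlq, hpq.ne, rfl⟩]
  simp [hcl.ne, hcp.ne, hcq]

lemma Path4.mem {C : Finset V} {c : V} (h : Path4 G C c) : c ∈ C := by
  obtain ⟨l, p, q, rfl, -⟩ := h
  simp

lemma Path4.symm {l p q c : V} {C : Finset V} (h : C = {c, l, p, q}) (hlp : l ≠ p) (hlq : l ≠ q)
    (hcq : c ≠ q) (hcl : G.Adj c l) (hcp : G.Adj c p) (hpq : G.Adj p q) (hncq : ¬ G.Adj c q)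
    (hnlp : ¬ G.Adj l p) (hnlq : ¬ G.Adj l q) : Path4 G C p := by
  refine ⟨q, c, l, ?_, hcq.symm, hlq.symm, hlp.symm, hpq, hcp.symm, hcl, fun z => hnlp z.symm,
    fun z => hncq z.symm, fun z => hnlq z.symm⟩
  rw [h]
  ext z
  simp only [mem_insert, mem_singleton]
  tauto

/-- Every vertex other than the centre lies in a maximum dissociation set avoiding the centre. -/
lemma Grow.exists_mem {v₀ v : V} {U₀ U : Finset V} {n : ℕ} (h₀ : Path4 G U₀ v₀)
    (h : Grow G True v₀ U₀ n U) (hv : v ∈ U) (hne : v ≠ v₀) :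
    ∃ S ∈ maxDiss G U, v₀ ∉ S ∧ v ∈ S := by
  have key : ∀ {n : ℕ} {U C : Finset V} {c : V}, Grow G True v₀ U₀ n U → Link G U C v₀ c →
      Cherry G C c ∨ Path3 G C c →
      (v ∈ U → ∃ S ∈ maxDiss G U, v₀ ∉ S ∧ v ∈ S) → v ∈ U ∪ C →
      ∃ S ∈ maxDiss G (U ∪ C), v₀ ∉ S ∧ v ∈ S := by
    intro n U C c hg hl hC ih hv
    obtain ⟨-, -, h3, -⟩ := card_three_counts hC
    have hpos : 0 < numAvoid G C c := by omega
    have hv₀ : ∀ T ∈ maxDiss G C, v₀ ∉ T := fun T hT q =>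
      disjoint_left.1 hl.disj hl.left_mem ((mem_maxDiss.1 hT).1 q)
    rw [mem_union] at hv
    rcases hv with hv | hv
    · obtain ⟨S, hS, hvS, hv'⟩ := ih hv
      obtain ⟨T, hT⟩ := maxDiss_nonempty (G := G) C
      refine ⟨S ∪ T, hl.union_mem_maxDiss hpos hS hvS hT, ?_, mem_union_left _ hv'⟩
      rw [mem_union, not_or]
      exact ⟨hvS, hv₀ T hT⟩
    · have hpos' : 0 < numAvoid G U v₀ := by
        rw [(hg.num_of_path4 h₀).2.1]
        positivity
      obtain ⟨S, hS, hvS⟩ := numAvoid_pos_iff.1 hpos'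
      have h3 : C.card = 3 := hC.elim Cherry.card Path3.card
      have hd : ¬ Diss G C := hC.elim Cherry.not_diss Path3.not_diss
      have hm : 0 < numMem G C v := by rw [numMem_card_three h3 hd hv]; norm_num
      obtain ⟨T, hT⟩ := card_pos.1 hm
      rw [mem_filter] at hT
      refine ⟨S ∪ T, hl.union_mem_maxDiss hpos hS hvS hT.1, ?_, mem_union_right _ hT.2⟩
      rw [mem_union, not_or]
      exact ⟨hvS, hv₀ T hT.1⟩
  induction h with
  | base =>
    obtain ⟨c1, c2, -, -⟩ := h₀.counts
    obtain ⟨S, hS, hvS⟩ := numAvoid_pos_iff.1 (by omega : 0 < numAvoid G U₀ v₀)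
    have hS' := mem_maxDiss.1 hS
    have : S = U₀.erase v₀ := eq_of_subset_of_card_le (subset_erase.2 ⟨hS'.1, hvS⟩) (by
      rw [card_erase_of_mem h₀.mem, h₀.card, hS'.2.2, c1])
    exact ⟨S, hS, hvS, this ▸ mem_erase.2 ⟨hne, hv⟩⟩
  | path hg hl hC ih => exact key hg hl (Or.inr hC) ih hv
  | cherry _ hg hl hC ih => exact key hg hl (Or.inl hC) ih hv

/-- A maximum set of `U` avoiding `v₀` combines freely with every maximum set of `C`. If `v` lies in
`U`, the part in `C` varies over three sets; if `v` lies in `C`, two of these three contain it. -/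
lemma Grow.two_le_numMem {v₀ v c : V} {U₀ U C : Finset V} {n : ℕ} (h₀ : Path4 G U₀ v₀)
    (hg : Grow G True v₀ U₀ n U) (hl : Link G U C v₀ c) (hC : Cherry G C c ∨ Path3 G C c)
    (hv : v ∈ U ∪ C) (hne : v ≠ v₀) : 2 ≤ numMem G (U ∪ C) v := by
  obtain ⟨-, hn, h3, -⟩ := card_three_counts hC
  have hpos : 0 < numAvoid G C c := by omega
  obtain ⟨S, hS, hvS, T, hT, T', hT', hTT, hm, hm'⟩ : ∃ S ∈ maxDiss G U, v₀ ∉ S ∧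
      ∃ T ∈ maxDiss G C, ∃ T' ∈ maxDiss G C, T ≠ T' ∧ v ∈ S ∪ T ∧ v ∈ S ∪ T' := by
    by_cases hvU : v ∈ U
    · obtain ⟨S, hS, hvS, hv'⟩ := hg.exists_mem h₀ hvU hne
      obtain ⟨T, hT, T', hT', hTT⟩ := one_lt_card.1 (by
        rw [← num, hn]
        norm_num : 1 < (maxDiss G C).card)
      exact ⟨S, hS, hvS, T, hT, T', hT', hTT, mem_union_left _ hv', mem_union_left _ hv'⟩
    · have hvC : v ∈ C := (mem_union.1 hv).resolve_left hvU
      have hpos' : 0 < numAvoid G U v₀ := by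
        rw [(hg.num_of_path4 h₀).2.1]
        positivity
      obtain ⟨S, hS, hvS⟩ := numAvoid_pos_iff.1 hpos'
      have h3 : C.card = 3 := hC.elim Cherry.card Path3.card
      have hd : ¬ Diss G C := hC.elim Cherry.not_diss Path3.not_diss
      have hm : 1 < numMem G C v := by rw [numMem_card_three h3 hd hvC]; norm_num
      obtain ⟨T, hT, T', hT', hTT⟩ := one_lt_card.1 hm
      rw [mem_filter] at hT hT'
      exact ⟨S, hS, hvS, T, hT.1, T', hT'.1, hTT, mem_union_right _ hT.2, mem_union_right _ hT'.2⟩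
  refine one_lt_card.2 ⟨S ∪ T, mem_filter.2 ⟨hl.union_mem_maxDiss hpos hS hvS hT, hm⟩, S ∪ T',
    mem_filter.2 ⟨hl.union_mem_maxDiss hpos hS hvS hT', hm'⟩, fun q => hTT ?_⟩
  have h1 := (mem_maxDiss.1 hS).1
  rw [← union_inter_right_cancel hl.disj h1 (mem_maxDiss.1 hT).1, q,
    union_inter_right_cancel hl.disj h1 (mem_maxDiss.1 hT').1]

/-- The total is `3 ^ n + 1`, so the hypothesis says that `v` lies in exactly one maximum set. For
`n ≥ 1` only the centre does; for `n = 0` the other inner vertex of P₄ does too, and P₄ is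
symmetric. -/
lemma Grow.recentre {v₀ v : V} {U₀ U : Finset V} {n : ℕ} (h₀ : Path4 G U₀ v₀)
    (h : Grow G True v₀ U₀ n U) (hv : v ∈ U) (hA : numAvoid G U v = 3 ^ n) :
    ∃ U₁, Path4 G U₁ v ∧ Grow G True v U₁ n U := by
  by_cases hne : v = v₀
  · subst hne
    exact ⟨U₀, h₀, h⟩
  have hsum := numAvoid_add_numMem (G := G) U v
  have hnum := (h.num_of_path4 h₀).2.2
  cases h with
  | base =>
    refine ⟨U₀, ?_, Grow.base⟩
    obtain ⟨S, hS, hvS⟩ := numAvoid_pos_iff.1 (by rw [hA]; norm_num : 0 < numAvoid G U₀ v)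
    have hS' := mem_maxDiss.1 hS
    have hSe : S = U₀.erase v := eq_of_subset_of_card_le (subset_erase.2 ⟨hS'.1, hvS⟩) (by
      rw [card_erase_of_mem hv, h₀.card, hS'.2.2, h₀.counts.1])
    have hd := hS'.2.1
    rw [hSe] at hd
    obtain ⟨l, p, q, hU, hlp, hlq, hcq, hcl, hcp, hpq, hncq, hnlp, hnlq⟩ := h₀
    have hvU := hv
    rw [hU] at hvU
    simp only [mem_insert, mem_singleton] at hvU
    rcases hvU with rfl | rfl | rfl | rfl
    · exact absurd rfl hne
    · refine absurd hd (not_diss_of_adj (v := p) (a := v₀) (b := q) ?_ ?_ ?_ hcq hcp.symm hpq)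
      · rw [hU]; simp [hlp.symm]
      · rw [hU]; simp [hcl.ne]
      · rw [hU]; simp [hlq.symm]
    · exact Path4.symm hU hlp hlq hcq hcl hcp hpq hncq hnlp hnlq
    · refine absurd hd (not_diss_of_adj (v := v₀) (a := l) (b := p) ?_ ?_ ?_ hlp hcl hcp)
      · rw [hU]; simp [hcq]
      · rw [hU]; simp [hlq]
      · rw [hU]; simp [hpq.ne]
  | path hg hl hC =>
    have := hg.two_le_numMem h₀ hl (Or.inr hC) hv hne
    omega
  | cherry _ hg hl hC =>
    have := hg.two_le_numMem h₀ hl (Or.inl hC) hv hne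
    omega

/-! ### Induction for the sharp bounds -/

/-- The sharp bounds on the number of maximum dissociation sets of a tree, with the structure of
the extremal trees. -/
structure SharpBound (G : SimpleGraph V) (U : Finset V) : Prop where
  one : psi G U = 1 → num G U = 1
  odd_le : ∀ k, psi G U = 2 * k + 3 → num G U ≤ 3 ^ k + 1
  odd_eq : ∀ k, psi G U = 2 * k + 3 → num G U = 3 ^ k + 1 →
    ∃ v U₀, Path4 G U₀ v ∧ Grow G True v U₀ k U
  even_le : ∀ k, psi G U = 2 * k + 2 → num G U ≤ 3 ^ k + k + 2
  even_eq : ∀ k, psi G U = 2 * k + 2 → num G U = 3 ^ k + k + 2 →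
    ∃ v U₀, Path3 G U₀ v ∧ Grow G False v U₀ k U

lemma three_mul_pow_le {r k : ℕ} (h : r + 1 ≤ k) : 3 * 3 ^ r ≤ 3 ^ k := by
  rw [← pow_succ']
  exact Nat.pow_le_pow_right (by norm_num) h

lemma succ_le_three_pow (r : ℕ) : r + 1 ≤ 3 ^ r := Nat.lt_pow_self (by norm_num)

lemma add_two_le_three_pow {r : ℕ} (h : r ≠ 0) : r + 2 ≤ 3 ^ r := by
  obtain ⟨s, rfl⟩ := Nat.exists_eq_succ_of_ne_zero h
  have := succ_le_three_pow s
  rw [Nat.succ_eq_add_one, pow_succ]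
  omega

/-- From ψ = 3 on, the sharp bound gains a factor 2/3 over the crude one; this is the induction
hypothesis needed by `two_mul_numAvoid_add_numIso_le`. -/
lemma SharpBound.three_mul_num_le {B : Finset V} (h : SharpBound G B) (h3 : 3 ≤ psi G B) :
    3 * num G B ≤ 2 * 3 ^ (psi G B / 2) := by
  rcases Nat.even_or_odd' (psi G B) with ⟨m, hm | hm⟩
  · have h1 := h.even_le (m - 1) (by omega)
    have h2 := add_two_le_three_pow (by omega : m - 1 ≠ 0)
    have h3 := three_mul_pow_le (by omega : m - 1 + 1 ≤ psi G B / 2)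
    omega
  · have h1 := h.odd_le (m - 1) (by omega)
    have h2 := succ_le_three_pow (m - 1)
    have h3 := three_mul_pow_le (by omega : m - 1 + 1 ≤ psi G B / 2)
    omega

lemma sharpBound_of_card_le_three (hG : G.IsAcyclic) {U : Finset V} (hU : Conn G U)
    (h : U.card ≤ 3) : SharpBound G U := by
  rcases Nat.lt_or_ge U.card 3 with hlt | hge
  · have h1 : num G U = 1 := num_of_card_le_two (by omega)
    have h2 : psi G U = U.card := psi_of_card_le_two (by omega)
    have h3 : ∀ k, 0 < 3 ^ k := fun k => by positivity
    refine ⟨fun _ => h1, fun k hk => ?_, fun k hk q => ?_, fun k hk => ?_, fun k hk q => ?_⟩ <;>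
      have := h3 k <;> omega
  · obtain ⟨c, hc⟩ := hU.1
    have hs := conn_card_three hG hU (by omega) hc
    obtain ⟨h1, h2, -⟩ := card_three_counts hs
    have h3 : ∀ k, 0 < 3 ^ k := fun k => by positivity
    refine ⟨fun _ => by omega, fun k hk => by omega, fun k hk q => by omega,
      fun k hk => ?_, fun k hk q => ?_⟩
    · have := h3 k
      omega
    · obtain rfl : k = 0 := by omega
      rcases hs with ⟨x, y, hUe, hxy, hx, hy, hn⟩ | hs
      · refine ⟨x, U, ⟨c, y, ?_, hxy, hx.symm, hy, hn⟩, Grow.base⟩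
        rw [hUe, insert_comm]
      · exact ⟨c, U, hs, Grow.base⟩

section Step

variable {R C : Finset V} {r c : V}

/-- The count does not change while ψ grows by at least 3, so every bound becomes strict. -/
lemma sharpBound_of_rigid (hR : SharpBound G R) (hl : Link G R C r c) (hC : Rigid G C c) :
    SharpBound G (R ∪ C) := by
  have hpos : 0 < numAvoid G C c := by rw [hC.numAvoid]; norm_num
  have hp := hl.psi_union hpos
  have hn := hl.num_union hpos
  rw [hC.numAvoid, hC.numMem, hC.numIso] at hn
  have h3 := hC.three_le
  have hR1 := psi_pos (G := G) ⟨r, hl.left_mem⟩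
  have hodd : ∀ k, psi G (R ∪ C) = 2 * k + 3 → num G (R ∪ C) < 3 ^ k + 1 := by
    intro k hk
    have hkpos : 0 < 3 ^ k := by positivity
    rcases Nat.even_or_odd' (psi G R) with ⟨m, hm | hm⟩
    · have h1 := hR.even_le (m - 1) (by omega)
      have h2 := succ_le_three_pow (m - 1)
      have h3 := three_mul_pow_le (by omega : m - 1 + 1 ≤ k)
      omega
    · by_cases hm0 : m = 0
      · have := hR.one (by omega)
        omega
      · have h1 := hR.odd_le (m - 1) (by omega)
        have h2 := succ_le_three_pow (m - 1)
        have h3 := three_mul_pow_le (by omega : m - 1 + 1 ≤ k)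
        omega
  have heven : ∀ k, psi G (R ∪ C) = 2 * k + 2 → num G (R ∪ C) < 3 ^ k + k + 2 := by
    intro k hk
    have hkpos : 0 < 3 ^ k := by positivity
    rcases Nat.even_or_odd' (psi G R) with ⟨m, hm | hm⟩
    · have h1 := hR.even_le (m - 1) (by omega)
      have h2 := succ_le_three_pow (m - 1)
      have h3 := three_mul_pow_le (by omega : m - 1 + 1 ≤ k)
      omega
    · by_cases hm0 : m = 0
      · have := hR.one (by omega)
        omega
      · have h1 := hR.odd_le (m - 1) (by omega)
        have h2 := succ_le_three_pow (m - 1)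
        have h3 := three_mul_pow_le (by omega : m - 1 + 1 ≤ k)
        omega
  exact ⟨fun q => by omega, fun k hk => (hodd k hk).le, fun k hk q => absurd q (hodd k hk).ne,
    fun k hk => (heven k hk).le, fun k hk q => absurd q (heven k hk).ne⟩

/-- With `numAvoid` at most `3 ^ k`, the bound `3 ^ k + 1` for odd ψ passes to `3 ^ (k + 1) + 1`.
The even bound falls one short of the allowed value, so equality occurs only for odd ψ. -/
lemma sharpBound_of_cherry (hG : G.IsAcyclic) (hR : SharpBound G R) (hl : Link G R C r c)
    (hC : Cherry G C c) : SharpBound G (R ∪ C) := by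
  obtain ⟨c1, -, c3, c4, c5⟩ := hC.counts
  have hpos : 0 < numAvoid G C c := by omega
  have hp := hl.psi_union hpos
  have hn := hl.num_union hpos
  rw [c3, c4, c5] at hn
  have hR1 := psi_pos (G := G) ⟨r, hl.left_mem⟩
  have hA := three_mul_numAvoid_le hG hl.left_mem
  have hodd : ∀ k, psi G (R ∪ C) = 2 * k + 3 → num G (R ∪ C) ≤ 3 ^ k + 1 ∧
      (num G (R ∪ C) = 3 ^ k + 1 → ∃ v U₀, Path4 G U₀ v ∧ Grow G True v U₀ k (R ∪ C)) := by
    intro k hk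
    have hkpos : 0 < 3 ^ k := by positivity
    cases k with
    | zero =>
      rw [show psi G R / 2 = 0 by omega, pow_zero] at hA
      have := hR.one (by omega)
      omega
    | succ k =>
      rw [show psi G R / 2 = k + 1 by omega, pow_succ] at hA
      rw [pow_succ]
      have h1 := hR.odd_le k (by omega)
      refine ⟨by omega, fun q => ?_⟩
      obtain ⟨v, U₀, h₀, hg⟩ := hR.odd_eq k (by omega) (by omega)
      obtain ⟨U₁, h1, hg1⟩ := hg.recentre h₀ hl.left_mem (by omega)
      exact ⟨r, U₁, h1, hg1.cherry trivial hl hC⟩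
  have heven : ∀ k, psi G (R ∪ C) = 2 * k + 2 → num G (R ∪ C) < 3 ^ k + k + 2 := by
    intro k hk
    obtain ⟨k, rfl⟩ := Nat.exists_eq_succ_of_ne_zero (by omega : k ≠ 0)
    rw [show psi G R / 2 = k + 1 by omega, pow_succ] at hA
    have h1 := hR.even_le k (by omega)
    rw [Nat.succ_eq_add_one, pow_succ]
    omega
  exact ⟨fun q => by omega, fun k hk => (hodd k hk).1, fun k hk q => (hodd k hk).2 q,
    fun k hk => (heven k hk).le, fun k hk q => absurd q (heven k hk).ne⟩

lemma Link.path4 (hl : Link G R C r c) (hR : R = {r}) (hC : Path3 G C c) :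
    Path4 G (R ∪ C) c := by
  obtain ⟨x, y, rfl, hcy, hcx, hxy, hn⟩ := hC
  subst hR
  have hrx : r ≠ x := fun q => disjoint_left.1 hl.disj hl.left_mem (by simp [q])
  have hry : r ≠ y := fun q => disjoint_left.1 hl.disj hl.left_mem (by simp [q])
  refine ⟨r, x, y, ?_, hrx, hry, hcy, hl.adj.symm, hcx, hxy, hn, fun q => ?_, fun q => ?_⟩
  · ext z
    simp only [mem_union, mem_insert, mem_singleton]
    tauto
  · exact hcx.ne (hl.child_eq (by simp) q).symm
  · exact hcy (hl.child_eq (by simp) q).symm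

lemma sharpBound_of_path3 (hG : G.IsAcyclic) (hRc : Conn G R) (hR : SharpBound G R)
    (ih : ∀ B ⊂ R, Conn G B → SharpBound G B) (hl : Link G R C r c) (hC : Path3 G C c) :
    SharpBound G (R ∪ C) := by
  obtain ⟨c1, -, c3, c4, c5⟩ := hC.counts
  have hpos : 0 < numAvoid G C c := by omega
  have hp := hl.psi_union hpos
  have hn := hl.num_union hpos
  rw [c3, c4, c5] at hn
  have hR1 := psi_pos (G := G) ⟨r, hl.left_mem⟩
  have hkey := fun h2 : 2 ≤ psi G R => two_mul_numAvoid_add_numIso_le hG hRc hl.left_mem h2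
    fun B hB hBc h3 => (ih B hB hBc).three_mul_num_le h3
  have hodd : ∀ k, psi G (R ∪ C) = 2 * k + 3 → num G (R ∪ C) ≤ 3 ^ k + 1 ∧
      (num G (R ∪ C) = 3 ^ k + 1 → ∃ v U₀, Path4 G U₀ v ∧ Grow G True v U₀ k (R ∪ C)) := by
    intro k hk
    cases k with
    | zero =>
      have hA := three_mul_numAvoid_le hG hl.left_mem
      rw [show psi G R / 2 = 0 by omega, pow_zero] at hA
      have h1 := hR.one (by omega)
      have h2 := numIso_le_numMem (G := G) R r
      have h3 := numAvoid_add_numMem (G := G) R r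
      refine ⟨by rw [pow_zero]; omega, fun _ => ?_⟩
      have hRr : R = {r} := by
        by_contra hne
        have : 2 ≤ R.card := by
          by_contra hlt
          have := card_pos.2 ⟨r, hl.left_mem⟩
          obtain ⟨z, hz⟩ := card_eq_one.1 (by omega : R.card = 1)
          have hr := hl.left_mem
          rw [hz, mem_singleton] at hr
          exact hne (hr ▸ hz)
        have := two_le_psi (G := G) this
        omega
      exact ⟨c, R ∪ C, hl.path4 hRr hC, Grow.base⟩
    | succ k =>
      have h1 := hR.odd_le k (by omega)
      -- The exceptional trees of the estimate have even ψ, so they cannot occur for odd ψ.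
      rcases hkey (by omega) with ⟨h2, h3⟩ | ⟨U₀, n, h₀, hg⟩
      · rw [show psi G R / 2 - 1 = k by omega] at h2 h3
        rw [pow_succ]
        refine ⟨by omega, fun q => ?_⟩
        obtain ⟨v, U₀, h₀, hg⟩ := hR.odd_eq k (by omega) (by omega)
        obtain ⟨U₁, h1, hg1⟩ := hg.recentre h₀ hl.left_mem (h3 (by omega))
        exact ⟨r, U₁, h1, hg1.path hl hC⟩
      · have := (hg.counts_of_path3 h₀).1
        omega
  have heven : ∀ k, psi G (R ∪ C) = 2 * k + 2 → num G (R ∪ C) ≤ 3 ^ k + k + 2 ∧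
      (num G (R ∪ C) = 3 ^ k + k + 2 → ∃ v U₀, Path3 G U₀ v ∧ Grow G False v U₀ k (R ∪ C)) := by
    intro k hk
    obtain ⟨k, rfl⟩ := Nat.exists_eq_succ_of_ne_zero (by omega : k ≠ 0)
    rw [Nat.succ_eq_add_one, pow_succ]
    have h1 := hR.even_le k (by omega)
    rcases hkey (by omega) with ⟨h2, -⟩ | ⟨U₀, n, h₀, hg⟩
    · rw [show psi G R / 2 - 1 = k by omega] at h2
      exact ⟨by omega, fun q => by omega⟩
    · obtain ⟨a1, a2, a3⟩ := hg.counts_of_path3 h₀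
      obtain rfl : n = k := by omega
      refine ⟨by omega, fun q => ?_⟩
      exact ⟨r, U₀, h₀, ((hg.num_le_of_path3 h₀).2 (by omega)).path hl hC⟩
  exact ⟨fun q => by omega, fun k hk => (hodd k hk).1, fun k hk q => (hodd k hk).2 q,
    fun k hk => (heven k hk).1, fun k hk q => (heven k hk).2 q⟩

lemma sharpBound_of_path4 (hG : G.IsAcyclic) (hRc : Conn G R) (hR : SharpBound G R)
    (hl : Link G R C r c) (hC : Path4 G C c) : SharpBound G (R ∪ C) := by
  obtain ⟨c1, c3, c4, c5⟩ := hC.counts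
  have hpos : 0 < numAvoid G C c := by omega
  have hp := hl.psi_union hpos
  have hn := hl.num_union hpos
  rw [c3, c4, c5] at hn
  have hR1 := psi_pos (G := G) ⟨r, hl.left_mem⟩
  have hA := three_mul_numAvoid_le hG hl.left_mem
  have hodd : ∀ k, psi G (R ∪ C) = 2 * k + 3 → num G (R ∪ C) ≤ 3 ^ k + 1 ∧
      (num G (R ∪ C) = 3 ^ k + 1 → ∃ v U₀, Path4 G U₀ v ∧ Grow G True v U₀ k (R ∪ C)) := by
    intro k hk
    obtain ⟨k, rfl⟩ := Nat.exists_eq_succ_of_ne_zero (by omega : k ≠ 0)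
    rw [show psi G R / 2 = k + 1 by omega, pow_succ] at hA
    have h1 := hR.even_le k (by omega)
    have h2 := succ_le_three_pow k
    rw [Nat.succ_eq_add_one, pow_succ]
    refine ⟨by omega, fun q => ?_⟩
    -- The total is at most `2 * 3 ^ k + k + 2`, which reaches `3 ^ (k + 1) + 1` only if `k + 1 = 3
    -- ^ k`, that is, `k = 0`. Then `R` is a P₃, and the P₄ `C` serves as core.
    have hk0 : k = 0 := by
      by_contra hk0
      have := add_two_le_three_pow hk0
      omega
    subst hk0
    have h3 : num G R = 3 := by omega
    have h4 : R.card = 3 := by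
      have h5 : ¬ R.card ≤ 2 := fun q => by
        have := num_of_card_le_two (G := G) q
        omega
      have h6 : ¬ 4 ≤ R.card := fun q => by
        have := psi_ge_three hG hRc q
        omega
      omega
    refine ⟨c, C, hC, ?_⟩
    rw [union_comm]
    rcases conn_card_three hG hRc h4 hl.left_mem with h | h
    · exact Grow.base.cherry trivial hl.symm h
    · exact Grow.base.path hl.symm h
  have heven : ∀ k, psi G (R ∪ C) = 2 * k + 2 → num G (R ∪ C) < 3 ^ k + k + 2 := by
    intro k hk
    rcases Nat.lt_or_ge (psi G R) 2 with hlt | hge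
    · rw [show psi G R / 2 = 0 by omega, pow_zero] at hA
      have := hR.one (by omega)
      have : 0 < 3 ^ k := by positivity
      omega
    · obtain ⟨m, rfl⟩ := Nat.exists_eq_add_of_le' (by omega : 2 ≤ k)
      rw [show psi G R / 2 = m + 1 by omega, pow_succ] at hA
      have h1 := hR.odd_le m (by omega)
      have h2 := three_mul_pow_le (by omega : m + 1 ≤ m + 2)
      omega
  exact ⟨fun q => by omega, fun k hk => (hodd k hk).1, fun k hk q => (hodd k hk).2 q,
    fun k hk => (heven k hk).le, fun k hk q => absurd q (heven k hk).ne⟩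

end Step

theorem sharpBound (hG : G.IsAcyclic) {U : Finset V} (hU : Conn G U) : SharpBound G U := by
  induction U using Finset.strongInduction with
  | H U ih =>
  rcases Nat.lt_or_ge U.card 4 with hlt | hge
  · exact sharpBound_of_card_le_three hG hU (by omega)
  · obtain ⟨R, C, r, c, rfl, hl, hC⟩ := exists_pendant hG hU hge
    have hRU : R ⊂ R ∪ C := ⟨subset_union_left, fun q =>
      disjoint_left.1 hl.disj (q (mem_union_right _ hl.right_mem)) hl.right_mem⟩
    have hRc := hl.conn_left hU
    have hR := ih R hRU hRc
    rcases hC with h | h | h | h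
    · exact sharpBound_of_rigid hR hl h
    · exact sharpBound_of_cherry hG hR hl h
    · exact sharpBound_of_path3 hG hRc hR (fun B hB hBc => ih B (hB.trans hRU) hBc) hl h
    · exact sharpBound_of_path4 hG hRc hR hl h

/-! ### Passage to the definitions of the statement -/

lemma isDissociationSet_iff {S : Finset V} : IsDissociationSet G (S : Set V) ↔ Diss G S := by
  constructor
  · intro h v hv a ha b hb hva hvb
    have := Set.encard_le_one_iff.1 (h ⟨v, hv⟩) ⟨a, ha⟩ ⟨b, hb⟩ hva hvb
    exact congrArg Subtype.val this
  · intro h v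
    refine Set.encard_le_one_iff.2 fun a b ha hb => Subtype.ext ?_
    exact h v v.2 a a.2 b b.2 ha hb

lemma dissociationNumber_eq [Fintype V] : dissociationNumber G = psi G univ := by
  have hb : BddAbove {n | ∃ F : Finset V, IsDissociationSet G (F : Set V) ∧ F.card = n} := by
    refine ⟨psi G univ, ?_⟩
    rintro n ⟨F, hF, rfl⟩
    exact le_psi (subset_univ _) (isDissociationSet_iff.1 hF)
  refine le_antisymm (csSup_le ⟨0, ∅, isDissociationSet_iff.2 diss_empty, card_empty⟩ ?_) ?_
  · rintro n ⟨F, hF, rfl⟩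
    exact le_psi (subset_univ _) (isDissociationSet_iff.1 hF)
  · obtain ⟨S, hS⟩ := maxDiss_nonempty (G := G) (univ : Finset V)
    rw [mem_maxDiss] at hS
    exact le_csSup hb ⟨S, isDissociationSet_iff.2 hS.2.1, hS.2.2⟩

lemma numMaximumDissociationSets_eq [Fintype V] :
    numMaximumDissociationSets G = num G univ := by
  have : {F : Finset V | IsMaximumDissociationSet G F} = (maxDiss G univ : Set (Finset V)) := by
    ext F
    rw [Set.mem_ofPred_eq, mem_coe, IsMaximumDissociationSet, isDissociationSet_iff, mem_maxDiss]
    constructor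
    · rintro ⟨h1, h2⟩
      refine ⟨subset_univ _, h1, le_antisymm (le_psi (subset_univ _) h1) (psi_le ?_)⟩
      exact fun S _ hS => h2 S (isDissociationSet_iff.2 hS)
    · rintro ⟨-, h1, h2⟩
      refine ⟨h1, fun F' hF' => h2 ▸ le_psi (subset_univ _) (isDissociationSet_iff.1 hF')⟩
  rw [numMaximumDissociationSets, this, Set.ncard_coe_finset, num]

lemma conn_univ [Fintype V] (h : G.Connected) : Conn G univ := by
  have := h.nonempty
  refine ⟨univ_nonempty, fun Z _ hne hno => ?_⟩
  obtain ⟨z, hz⟩ := hne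
  refine eq_univ_iff_forall.2 fun x => ?_
  obtain ⟨p⟩ := h.preconnected z x
  induction p with
  | nil => exact hz
  | cons hadj _ ih =>
    refine ih (by_contra fun q => ?_)
    exact hno _ hz _ (mem_sdiff.2 ⟨mem_univ _, q⟩) hadj

/-! ### Explicit coordinates for the attached paths -/

/-- The maps `f i` embed `k` paths on three vertices outside of `U₀`, and the only further edges
join `v` to the vertices `f i (c i)`. -/
structure Copies (G : SimpleGraph V) (U₀ : Finset V) (v : V) {k : ℕ} (c : Fin k → Fin 3)
    (f : Fin k → Fin 3 → V) : Prop where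
  inj : ∀ i j a b, f i a = f j b → i = j ∧ a = b
  notMem : ∀ i a, f i a ∉ U₀
  adj : ∀ i j a b, G.Adj (f i a) (f j b) ↔ i = j ∧ (SimpleGraph.pathGraph 3).Adj a b
  adj_base : ∀ u ∈ U₀, ∀ i a, G.Adj u (f i a) ↔ u = v ∧ a = c i

/-- The vertex set covered by `U₀` and the embedded paths. -/
noncomputable def cover (U₀ : Finset V) {k : ℕ} (f : Fin k → Fin 3 → V) : Finset V :=
  U₀ ∪ univ.image fun p : Fin k × Fin 3 => f p.1 p.2

lemma mem_cover {U₀ : Finset V} {k : ℕ} {f : Fin k → Fin 3 → V} {z : V} :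
    z ∈ cover U₀ f ↔ z ∈ U₀ ∨ ∃ i a, f i a = z := by
  simp [cover]

/-- The centre of the path is given index 1, so attachment at a leaf becomes `a₀ ≠ 1`. -/
lemma exists_embed {C : Finset V} {c : V} (h : Cherry G C c ∨ Path3 G C c) :
    ∃ (g : Fin 3 → V) (a₀ : Fin 3), Function.Injective g ∧ (∀ z, z ∈ C ↔ ∃ a, g a = z) ∧
      (∀ a b, G.Adj (g a) (g b) ↔ (SimpleGraph.pathGraph 3).Adj a b) ∧ g a₀ = c ∧
      (Path3 G C c → a₀ ≠ 1) := by
  have h3 : ∀ {x y z : V}, x ≠ y → y ≠ z → x ≠ z → G.Adj x y → G.Adj y z → ¬ G.Adj x z →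
      Function.Injective ![x, y, z] ∧
      ∀ a b, G.Adj (![x, y, z] a) (![x, y, z] b) ↔ (SimpleGraph.pathGraph 3).Adj a b := by
    intro x y z hxy hyz hxz h1 h2 h3
    have h3' : ¬ G.Adj z x := fun q => h3 q.symm
    constructor
    · intro a b hab
      fin_cases a <;> fin_cases b <;> simp_all
    · intro a b
      rw [SimpleGraph.pathGraph_adj]
      fin_cases a <;> fin_cases b <;> simp [h1, h2, h3, h1.symm, h2.symm, h3']
  rcases h with h | h
  · have hn : ¬ Path3 G C c := by
      intro h'
      have := h.counts.2.2.2.2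
      have := h'.counts.2.2.2.2
      omega
    obtain ⟨x, y, rfl, hxy, hx, hy, hnxy⟩ := h
    obtain ⟨g1, g2⟩ := h3 hx.ne' hy.ne hxy hx.symm hy hnxy
    refine ⟨![x, c, y], 1, g1, fun z => ?_, g2, rfl, fun q => absurd q hn⟩
    simp only [mem_insert, mem_singleton, Fin.exists_fin_succ, Matrix.cons_val_zero,
      Matrix.cons_val_succ, IsEmpty.exists_iff, or_false]
    tauto
  · obtain ⟨x, y, rfl, hcy, hx, hy, hncy⟩ := h
    obtain ⟨g1, g2⟩ := h3 hx.ne hy.ne hcy hx hy hncy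
    refine ⟨![c, x, y], 0, g1, fun z => ?_, g2, rfl, fun _ => by decide⟩
    simp only [mem_insert, mem_singleton, Fin.exists_fin_succ, Matrix.cons_val_zero,
      Matrix.cons_val_succ, IsEmpty.exists_iff, or_false]
    tauto

lemma Grow.exists_copies {b : Prop} {v : V} {U₀ U : Finset V} {n : ℕ} (hv : v ∈ U₀)
    (h : Grow G b v U₀ n U) :
    ∃ (c : Fin n → Fin 3) (f : Fin n → Fin 3 → V), Copies G U₀ v c f ∧ cover U₀ f = U ∧
      (¬ b → ∀ i, c i ≠ 1) := by
  have key : ∀ {n : ℕ} {U C : Finset V} {r : V}, Link G U C v r → Cherry G C r ∨ Path3 G C r →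
      (¬ b → Path3 G C r) →
      (∃ (c : Fin n → Fin 3) (f : Fin n → Fin 3 → V), Copies G U₀ v c f ∧ cover U₀ f = U ∧
        (¬ b → ∀ i, c i ≠ 1)) →
      ∃ (c : Fin (n + 1) → Fin 3) (f : Fin (n + 1) → Fin 3 → V), Copies G U₀ v c f ∧
        cover U₀ f = U ∪ C ∧ (¬ b → ∀ i, c i ≠ 1) := by
    rintro n U C r hl hC hb ⟨c, f, hf, hU, hc⟩
    obtain ⟨g, a₀, hg, hgC, hadj, hga, hp⟩ := exists_embed hC
    have hgm : ∀ a, g a ∈ C := fun a => (hgC _).2 ⟨a, rfl⟩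
    have hfm : ∀ i a, f i a ∈ U := fun i a => hU ▸ mem_cover.2 (Or.inr ⟨i, a, rfl⟩)
    have h0m : ∀ u ∈ U₀, u ∈ U := fun u hu => hU ▸ mem_cover.2 (Or.inl hu)
    have hne : ∀ i a b, f i a ≠ g b := fun i a b q =>
      disjoint_left.1 hl.disj (hfm i a) (q ▸ hgm b)
    have hfg : ∀ i a b, ¬ G.Adj (f i a) (g b) := by
      intro i a b q
      exact hf.notMem i a ((hl.eq_of_adj _ (hfm i a) _ (hgm b) q).1 ▸ hv)
    -- The new path takes the last index; only these two equations of `Fin.snoc` are used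
    -- afterwards.
    obtain ⟨F, hF1, hF2⟩ : ∃ F : Fin (n + 1) → Fin 3 → V,
        (∀ i : Fin n, F i.castSucc = f i) ∧ F (Fin.last n) = g :=
      ⟨Fin.snoc (α := fun _ => Fin 3 → V) f g, fun i => Fin.snoc_castSucc .., Fin.snoc_last ..⟩
    obtain ⟨c', hc1, hc2⟩ : ∃ c' : Fin (n + 1) → Fin 3,
        (∀ i : Fin n, c' i.castSucc = c i) ∧ c' (Fin.last n) = a₀ :=
      ⟨Fin.snoc (α := fun _ => Fin 3) c a₀, fun i => Fin.snoc_castSucc .., Fin.snoc_last ..⟩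
    have hlast : ∀ i : Fin n, i.castSucc ≠ Fin.last n := fun i => (Fin.castSucc_lt_last i).ne
    refine ⟨c', F, ⟨?_, ?_, ?_, ?_⟩, ?_, ?_⟩
    · intro i j a b hab
      induction i using Fin.lastCases with
      | last =>
        induction j using Fin.lastCases with
        | last => rw [hF2] at hab; exact ⟨rfl, hg hab⟩
        | cast j => rw [hF2, hF1] at hab; exact absurd hab.symm (hne j b a)
      | cast i =>
        induction j using Fin.lastCases with
        | last => rw [hF2, hF1] at hab; exact absurd hab (hne i a b)
        | cast j =>
          rw [hF1, hF1] at hab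
          obtain ⟨rfl, rfl⟩ := hf.inj _ _ _ _ hab
          exact ⟨rfl, rfl⟩
    · intro i a
      induction i using Fin.lastCases with
      | last => rw [hF2]; exact fun q => disjoint_left.1 hl.disj (h0m _ q) (hgm a)
      | cast i => rw [hF1]; exact hf.notMem i a
    · intro i j a b
      induction i using Fin.lastCases with
      | last =>
        induction j using Fin.lastCases with
        | last => rw [hF2, hadj]; simp
        | cast j =>
          rw [hF2, hF1]
          exact ⟨fun q => absurd q.symm (hfg j b a), fun q => absurd q.1.symm (hlast j)⟩
      | cast i =>
        induction j using Fin.lastCases with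
        | last =>
          rw [hF2, hF1]
          exact ⟨fun q => absurd q (hfg i a b), fun q => absurd q.1 (hlast i)⟩
        | cast j => rw [hF1, hF1, hf.adj, Fin.castSucc_inj]
    · intro u hu i a
      induction i using Fin.lastCases with
      | last =>
        rw [hF2, hc2]
        constructor
        · intro q
          obtain ⟨h1, h2⟩ := hl.eq_of_adj u (h0m u hu) _ (hgm a) q
          exact ⟨h1, hg (h2.trans hga.symm)⟩
        · rintro ⟨rfl, rfl⟩
          rw [hga]
          exact hl.adj
      | cast i => rw [hF1, hc1]; exact hf.adj_base u hu i a
    · ext z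
      rw [mem_cover, Fin.exists_fin_succ', mem_union, ← hU, mem_cover, hgC, hF2]
      simp only [hF1]
      exact or_assoc.symm
    · intro hb' i
      induction i using Fin.lastCases with
      | last => rw [hc2]; exact hp (hb hb')
      | cast i => rw [hc1]; exact hc hb' i
  induction h with
  | base =>
    refine ⟨Fin.elim0, Fin.elim0, ⟨?_, ?_, ?_, ?_⟩, ?_, ?_⟩
    · exact fun i => i.elim0
    · exact fun i => i.elim0
    · exact fun i => i.elim0
    · exact fun _ _ i => i.elim0
    · ext z
      simp [mem_cover]
    · exact fun _ i => i.elim0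
  | path _ hl hC ih => exact key hl (Or.inr hC) (fun _ => hC) ih
  | cherry hb _ hl hC ih => exact key hl (Or.inl hC) (fun q => absurd hb q) ih

lemma Copies.grow {b : Prop} {v : V} {U₀ : Finset V} (hv : v ∈ U₀) {n : ℕ} {c : Fin n → Fin 3}
    {f : Fin n → Fin 3 → V} (h : Copies G U₀ v c f) (hb : ∀ i, c i = 1 → b) :
    Grow G b v U₀ n (cover U₀ f) := by
  induction n with
  | zero =>
    have : cover U₀ f = U₀ := by
      ext z
      simp [mem_cover]
    rw [this]
    exact Grow.base
  | succ n ih =>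
    have hlast : ∀ i : Fin n, i.castSucc ≠ Fin.last n := fun i => (Fin.castSucc_lt_last i).ne
    have h' : Copies G U₀ v (fun i : Fin n => c i.castSucc) fun i => f i.castSucc := by
      refine ⟨fun i j a b hab => ?_, fun i a => h.notMem _ a, fun i j a b => ?_,
        fun u hu i a => h.adj_base u hu _ a⟩
      · obtain ⟨h1, h2⟩ := h.inj _ _ _ _ hab
        exact ⟨Fin.castSucc_injective _ h1, h2⟩
      · rw [h.adj, Fin.castSucc_inj]
    have hg := ih h' fun i q => hb _ q
    let C : Finset V := univ.image (f (Fin.last n))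
    have hC : ∀ z, z ∈ C ↔ ∃ a, f (Fin.last n) a = z := fun z => by simp [C]
    have hcov : cover U₀ f = cover U₀ (fun i : Fin n => f i.castSucc) ∪ C := by
      ext z
      rw [mem_cover, Fin.exists_fin_succ', mem_union, mem_cover, hC, or_assoc]
    have hl : Link G (cover U₀ fun i : Fin n => f i.castSucc) C v
        (f (Fin.last n) (c (Fin.last n))) := by
      refine ⟨?_, mem_cover.2 (Or.inl hv), (hC _).2 ⟨_, rfl⟩,
        (h.adj_base v hv _ _).2 ⟨rfl, rfl⟩, ?_⟩
      · rw [disjoint_left]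
        intro z hz hzC
        obtain ⟨a, rfl⟩ := (hC z).1 hzC
        rcases mem_cover.1 hz with hz | ⟨i, b, hz⟩
        · exact h.notMem _ _ hz
        · exact hlast i (h.inj _ _ _ _ hz).1
      · intro x hx y hy hxy
        obtain ⟨a, rfl⟩ := (hC y).1 hy
        rcases mem_cover.1 hx with hx | ⟨i, b, rfl⟩
        · obtain ⟨rfl, rfl⟩ := (h.adj_base x hx _ _).1 hxy
          exact ⟨rfl, rfl⟩
        · exact absurd ((h.adj _ _ _ _).1 hxy).1 (hlast i)
    have hadj : ∀ a b, G.Adj (f (Fin.last n) a) (f (Fin.last n) b) ↔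
        a.val + 1 = b.val ∨ b.val + 1 = a.val := by
      intro a b
      rw [h.adj, SimpleGraph.pathGraph_adj]
      simp
    have hne : ∀ a b, a ≠ b → f (Fin.last n) a ≠ f (Fin.last n) b :=
      fun a b hab q => hab (h.inj _ _ _ _ q).2
    rw [hcov]
    -- Attachment at index 0 or 2 is by an end vertex, at index 1 by the centre; only the latter
    -- needs `b`.
    rcases (by generalize c (Fin.last n) = a; fin_cases a <;> simp :
      c (Fin.last n) = 0 ∨ c (Fin.last n) = 1 ∨ c (Fin.last n) = 2) with h0 | h1 | h2
    · refine hg.path hl ⟨f (Fin.last n) 1, f (Fin.last n) 2, ?_, ?_, ?_, ?_, ?_⟩ <;>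
        (try rw [h0]) <;> try simp [hadj]
      · ext z
        rw [hC, Fin.exists_fin_succ, Fin.exists_fin_succ, Fin.exists_fin_succ]
        simp [eq_comm]
      · exact hne _ _ (by decide)
    · refine hg.cherry (hb _ h1) hl ⟨f (Fin.last n) 0, f (Fin.last n) 2, ?_, ?_, ?_, ?_, ?_⟩ <;>
        (try rw [h1]) <;> try simp [hadj]
      · ext z
        rw [hC, Fin.exists_fin_succ, Fin.exists_fin_succ, Fin.exists_fin_succ]
        simp only [mem_insert, mem_singleton, IsEmpty.exists_iff, or_false, Fin.succ_zero_eq_one,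
          Fin.succ_one_eq_two]
        rw [eq_comm (a := z), eq_comm (a := z), eq_comm (a := z)]
        tauto
      · exact hne _ _ (by decide)
    · refine hg.path hl ⟨f (Fin.last n) 1, f (Fin.last n) 0, ?_, ?_, ?_, ?_, ?_⟩ <;>
        (try rw [h2]) <;> try simp [hadj]
      · ext z
        rw [hC, Fin.exists_fin_succ, Fin.exists_fin_succ, Fin.exists_fin_succ]
        simp only [mem_insert, mem_singleton, IsEmpty.exists_iff, or_false, Fin.succ_zero_eq_one,
          Fin.succ_one_eq_two]
        rw [eq_comm (a := z), eq_comm (a := z), eq_comm (a := z)]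
        tauto
      · exact hne _ _ (by decide)

lemma addEdgesFrom_adj {v x y : V} {S : Set V} :
    (addEdgesFrom G v S).Adj x y ↔
      G.Adj x y ∨ x ≠ y ∧ (x = v ∧ y ∈ S ∨ y = v ∧ x ∈ S) := by
  simp [addEdgesFrom]

lemma isLeafVertex_pathGraph_iff {e : Fin 3} :
    IsLeafVertex (SimpleGraph.pathGraph 3) e ↔ e ≠ 1 := by
  rw [IsLeafVertex, Set.encard_eq_one]
  constructor
  · rintro ⟨x, hx⟩ rfl
    have h0 : (0 : Fin 3) ∈ (SimpleGraph.pathGraph 3).neighborSet 1 := by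
      simp [SimpleGraph.pathGraph_adj]
    have h2 : (2 : Fin 3) ∈ (SimpleGraph.pathGraph 3).neighborSet 1 := by
      simp [SimpleGraph.pathGraph_adj]
    rw [hx, Set.mem_singleton_iff] at h0 h2
    exact absurd (h0.trans h2.symm) (by decide)
  · intro he
    refine ⟨1, ?_⟩
    ext a
    rw [SimpleGraph.mem_neighborSet, SimpleGraph.pathGraph_adj, Set.mem_singleton_iff]
    fin_cases e <;> fin_cases a <;> simp_all

/-! ### The first family: P₄ with attached P₃'s -/

section FamilyOne

variable {k : ℕ} {o b : Fin 2} {c : Fin k → Fin 3}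

lemma treeOne_adj_inr {i j : Fin k} {x y : Fin 3} :
    (treeOne k o b c).Adj (Sum.inr (i, x)) (Sum.inr (j, y)) ↔
      i = j ∧ (SimpleGraph.pathGraph 3).Adj x y := by
  simp [treeOne, addEdgesFrom_adj, copies]

lemma treeOne_adj_inl_inr {p : Fin 2 × Fin 2} {i : Fin k} {x : Fin 3} :
    (treeOne k o b c).Adj (Sum.inl p) (Sum.inr (i, x)) ↔ p = (0, o) ∧ x = c i := by
  simp [treeOne, addEdgesFrom_adj, eq_comm (a := c i)]

lemma treeOne_adj_inl {p q : Fin 2 × Fin 2} :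
    (treeOne k o b c).Adj (Sum.inl p) (Sum.inl q) ↔
      (p.1 = q.1 ∧ p.2 ≠ q.2) ∨ p = (0, o) ∧ q = (1, b) ∨ q = (0, o) ∧ p = (1, b) := by
  have h : ∀ a b : Fin 2, (SimpleGraph.pathGraph 2).Adj a b ↔ a ≠ b := by
    intro a b
    rw [SimpleGraph.pathGraph_adj]
    fin_cases a <;> fin_cases b <;> simp
  have h' : p = (0, o) ∧ q = (1, b) ∨ q = (0, o) ∧ p = (1, b) → p ≠ q := by
    rintro (⟨rfl, rfl⟩ | ⟨rfl, rfl⟩) <;> simp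
  have hs : ∀ (A : SimpleGraph (Fin 2 × Fin 2)) (B : SimpleGraph (Fin k × Fin 3)),
      (A ⊕g B).Adj (Sum.inl p) (Sum.inl q) ↔ A.Adj p q := fun _ _ => Iff.rfl
  simp only [treeOne, addEdgesFrom_adj, hs, copies, h, ne_eq, Sum.inl.injEq,
    Set.mem_union, Set.mem_singleton_iff, Set.mem_range, reduceCtorEq, exists_false, or_false]
  rw [and_iff_right_of_imp h']

lemma bijective_elim [Fintype V] {α : Type*} {B : α → V} {U₀ : Finset V} {v : V}
    {f : Fin k → Fin 3 → V} (hB : Function.Injective B) (hU : ∀ z, z ∈ U₀ ↔ ∃ p, B p = z)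
    (hf : Copies G U₀ v c f) (hcov : cover U₀ f = univ) :
    Function.Bijective (Sum.elim B fun p : Fin k × Fin 3 => f p.1 p.2) := by
  constructor
  · rw [Sum.elim_injective]
    refine ⟨hB, ?_, fun a p q => hf.notMem p.1 p.2 ((hU _).2 ⟨a, q⟩)⟩
    rintro ⟨i, a⟩ ⟨j, b⟩ hab
    obtain ⟨h1, h2⟩ := hf.inj _ _ _ _ hab
    exact Prod.ext h1 h2
  · intro z
    rcases mem_cover.1 (hcov.symm ▸ mem_univ z) with hz | ⟨i, a, hz⟩
    · obtain ⟨p, hp⟩ := (hU z).1 hz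
      exact ⟨Sum.inl p, hp⟩
    · exact ⟨Sum.inr (i, a), hz⟩

lemma inFamilyOne_of_grow [Fintype V] {v : V} {U₀ : Finset V} (h₀ : Path4 G U₀ v)
    (h : Grow G True v U₀ k univ) : InFamilyOne G := by
  obtain ⟨c, f, hf, hcov, -⟩ := h.exists_copies h₀.mem
  obtain ⟨l, p, q, hU, hlp, hlq, hvq, hvl, hvp, hpq, hnvq, hnlp, hnlq⟩ := h₀
  -- The core `l, v, p, q` splits into the two copies `{v, l}` and `{p, q}` of P₂, joined by the
  -- edge `vp`.
  have hB : Function.Injective fun x : Fin 2 × Fin 2 => ![![v, l], ![p, q]] x.1 x.2 := by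
    rintro ⟨i, a⟩ ⟨j, b⟩ hab
    have h1 := hvl.ne
    have h2 := hvp.ne
    have h3 := hpq.ne
    fin_cases i <;> fin_cases a <;> fin_cases j <;> fin_cases b <;> simp_all
  have hUB : ∀ z, z ∈ U₀ ↔ ∃ x : Fin 2 × Fin 2, ![![v, l], ![p, q]] x.1 x.2 = z := by
    intro z
    simp only [hU, mem_insert, mem_singleton, Prod.exists, Fin.exists_fin_two,
      Matrix.cons_val_zero, Matrix.cons_val_one]
    rw [eq_comm (a := z), eq_comm (a := z), eq_comm (a := z), eq_comm (a := z)]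
    tauto
  have hbij := bijective_elim hB hUB hf hcov
  have hadj : ∀ x y : Fin 2 × Fin 2,
      G.Adj (![![v, l], ![p, q]] x.1 x.2) (![![v, l], ![p, q]] y.1 y.2) ↔
        (treeOne k 0 0 c).Adj (Sum.inl x) (Sum.inl y) := by
    rintro ⟨i, a⟩ ⟨j, b⟩
    rw [treeOne_adj_inl]
    have h1 : ¬ G.Adj q v := fun z => hnvq z.symm
    have h2 : ¬ G.Adj p l := fun z => hnlp z.symm
    have h3 : ¬ G.Adj q l := fun z => hnlq z.symm
    fin_cases i <;> fin_cases a <;> fin_cases j <;> fin_cases b <;>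
      simp [hvl, hvl.symm, hvp, hvp.symm, hpq, hpq.symm, hnvq, hnlp, hnlq, h1, h2, h3]
  have hadj' : ∀ (x : Fin 2 × Fin 2) (i : Fin k) (a : Fin 3),
      G.Adj (![![v, l], ![p, q]] x.1 x.2) (f i a) ↔
        (treeOne k 0 0 c).Adj (Sum.inl x) (Sum.inr (i, a)) := by
    intro x i a
    rw [hf.adj_base _ ((hUB _).2 ⟨x, rfl⟩), treeOne_adj_inl_inr]
    exact and_congr_left fun _ => hB.eq_iff' (a := x) (b := (0, 0)) rfl
  refine ⟨k, 0, 0, c, ⟨RelIso.symm ⟨Equiv.ofBijective _ hbij, ?_⟩⟩⟩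
  rintro (x | ⟨i, a⟩) (y | ⟨j, b⟩)
  · exact hadj x y
  · exact hadj' x j b
  · rw [G.adj_comm, SimpleGraph.adj_comm (treeOne k 0 0 c)]
    exact hadj' y i a
  · rw [treeOne_adj_inr]
    exact hf.adj i j a b

lemma exists_grow_of_inFamilyOne [Fintype V] (h : InFamilyOne G) :
    ∃ k v U₀, Path4 G U₀ v ∧ Grow G True v U₀ k univ := by
  obtain ⟨k, o, b, c, ⟨e⟩⟩ := h
  let φ := e.symm
  have hφ : ∀ x y, G.Adj (φ x) (φ y) ↔ (treeOne k o b c).Adj x y := fun x y => φ.map_adj_iff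
  have hi : ∀ x y, φ x = φ y ↔ x = y := fun x y => φ.injective.eq_iff
  have hs : ∀ z, ∃ x, φ x = z := φ.surjective
  generalize (φ : _ → V) = φ at hφ hi hs
  let U₀ : Finset V := univ.image fun p => φ (Sum.inl p)
  have hU : ∀ z, z ∈ U₀ ↔ ∃ p, φ (Sum.inl p) = z := fun z => by simp [U₀]
  have hP : Path4 G U₀ (φ (Sum.inl (0, o))) := by
    -- In a copy of P₂, `Fin.rev` gives the other vertex.
    refine ⟨φ (Sum.inl (0, o.rev)), φ (Sum.inl (1, b)), φ (Sum.inl (1, b.rev)), ?_, ?_⟩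
    · ext z
      rw [hU]
      simp only [mem_insert, mem_singleton, Prod.exists, Fin.exists_fin_two]
      rw [eq_comm (a := z), eq_comm (a := z), eq_comm (a := z), eq_comm (a := z)]
      have h0 : Fin.rev (0 : Fin 2) = 1 := rfl
      have h1 : Fin.rev (1 : Fin 2) = 0 := rfl
      fin_cases o <;> fin_cases b <;> simp only [Fin.zero_eta, Fin.mk_one, h0, h1] <;> tauto
    · simp only [hφ, treeOne_adj_inl, ne_eq, hi]
      fin_cases o <;> fin_cases b <;> simp
  have hC : Copies G U₀ (φ (Sum.inl (0, o))) c fun i a => φ (Sum.inr (i, a)) := by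
    refine ⟨fun i j a b hab => ?_, fun i a q => ?_, fun i j a b => ?_, fun u hu i a => ?_⟩
    · simpa [hi] using hab
    · obtain ⟨p, hp⟩ := (hU _).1 q
      rw [hi] at hp
      simp at hp
    · rw [hφ, treeOne_adj_inr]
    · obtain ⟨p, rfl⟩ := (hU u).1 hu
      rw [hφ, treeOne_adj_inl_inr, hi, Sum.inl.injEq]
  have hcov : cover U₀ (fun i a => φ (Sum.inr (i, a))) = univ := by
    refine eq_univ_iff_forall.2 fun z => mem_cover.2 ?_
    obtain ⟨p | ⟨i, a⟩, rfl⟩ := hs z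
    · exact Or.inl ((hU _).2 ⟨p, rfl⟩)
    · exact Or.inr ⟨i, a, rfl⟩
  exact ⟨k, _, U₀, hP, hcov ▸ hC.grow hP.mem fun _ _ => trivial⟩

end FamilyOne

/-! ### The second family: P₃ with P₃'s attached leaf to leaf -/

section FamilyTwo

variable {k : ℕ} {e : Fin 3} {c : Fin k → Fin 3}

lemma treeTwo_adj_succ {i j : Fin k} {x y : Fin 3} :
    (treeTwo k e c).Adj (i.succ, x) (j.succ, y) ↔
      i = j ∧ (SimpleGraph.pathGraph 3).Adj x y := by
  simp [treeTwo, addEdgesFrom_adj, copies]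

lemma treeTwo_adj_zero_succ {i : Fin k} {x y : Fin 3} :
    (treeTwo k e c).Adj (0, x) (i.succ, y) ↔ x = e ∧ y = c i := by
  simp [treeTwo, addEdgesFrom_adj, copies, (Fin.succ_ne_zero i).symm, eq_comm (a := c i)]

lemma treeTwo_adj_zero {x y : Fin 3} :
    (treeTwo k e c).Adj (0, x) (0, y) ↔ (SimpleGraph.pathGraph 3).Adj x y := by
  simp [treeTwo, addEdgesFrom_adj, copies]

lemma inFamilyTwo_of_grow [Fintype V] {v : V} {U₀ : Finset V} (h₀ : Path3 G U₀ v)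
    (h : Grow G False v U₀ k univ) : InFamilyTwo G := by
  obtain ⟨c, f, hf, hcov, hc⟩ := h.exists_copies h₀.mem
  obtain ⟨x, y, hU, hvy, hvx, hxy, hn⟩ := h₀
  have hB : Function.Injective ![v, x, y] := by
    intro a b hab
    have h1 := hvx.ne
    have h2 := hxy.ne
    fin_cases a <;> fin_cases b <;> simp_all
  have hUB : ∀ z, z ∈ U₀ ↔ ∃ a : Fin 3, ![v, x, y] a = z := by
    intro z
    simp only [hU, mem_insert, mem_singleton, Fin.exists_fin_succ, Matrix.cons_val_zero,
      Matrix.cons_val_succ, IsEmpty.exists_iff, or_false]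
    rw [eq_comm (a := z), eq_comm (a := z), eq_comm (a := z)]
  have hbij := bijective_elim hB hUB hf hcov
  have hadj : ∀ a b, G.Adj (![v, x, y] a) (![v, x, y] b) ↔
      (SimpleGraph.pathGraph 3).Adj a b := by
    intro a b
    rw [SimpleGraph.pathGraph_adj]
    have h1 : ¬ G.Adj y v := fun z => hn z.symm
    fin_cases a <;> fin_cases b <;> simp [hvx, hvx.symm, hxy, hxy.symm, hn, h1]
  have hadj' : ∀ (b : Fin 3) (i : Fin k) (a : Fin 3),
      G.Adj (![v, x, y] b) (f i a) ↔ b = 0 ∧ a = c i := by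
    intro b i a
    rw [hf.adj_base _ ((hUB _).2 ⟨b, rfl⟩)]
    exact and_congr_left fun _ => hB.eq_iff' (a := b) (b := 0) rfl
  let F : Fin (k + 1) × Fin 3 → V := fun p =>
    Fin.cases (motive := fun _ => V) (![v, x, y] p.2) (fun i => f i p.2) p.1
  have hF0 : ∀ a, F (0, a) = ![v, x, y] a := fun a => rfl
  have hF1 : ∀ i a, F (Fin.succ i, a) = f i a := fun i a => rfl
  have hFbij : Function.Bijective F := by
    constructor
    · rintro ⟨i, a⟩ ⟨j, b⟩ hab
      cases i using Fin.cases with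
      | zero =>
        cases j using Fin.cases with
        | zero => rw [hF0, hF0] at hab; rw [hB hab]
        | succ j => exact absurd (hbij.1 (a₁ := Sum.inl a) (a₂ := Sum.inr (j, b)) hab) (by simp)
      | succ i =>
        cases j using Fin.cases with
        | zero => exact absurd (hbij.1 (a₁ := Sum.inr (i, a)) (a₂ := Sum.inl b) hab) (by simp)
        | succ j =>
          rw [hF1, hF1] at hab
          obtain ⟨rfl, rfl⟩ := hf.inj _ _ _ _ hab
          rfl
    · intro z
      obtain ⟨a | ⟨i, a⟩, hz⟩ := hbij.2 z
      · exact ⟨(0, a), hz⟩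
      · exact ⟨(i.succ, a), hz⟩
  refine ⟨k, 0, c, isLeafVertex_pathGraph_iff.2 (by decide),
    fun i => isLeafVertex_pathGraph_iff.2 (hc id i),
    ⟨RelIso.symm ⟨Equiv.ofBijective F hFbij, ?_⟩⟩⟩
  rintro ⟨i, a⟩ ⟨j, b⟩
  simp only [Equiv.ofBijective_apply]
  cases i using Fin.cases with
  | zero =>
    cases j using Fin.cases with
    | zero => rw [hF0, hF0, treeTwo_adj_zero, hadj]
    | succ j => rw [hF0, hF1, treeTwo_adj_zero_succ, hadj']
  | succ i =>
    cases j using Fin.cases with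
    | zero => rw [hF0, hF1, G.adj_comm, SimpleGraph.adj_comm (treeTwo k 0 c), treeTwo_adj_zero_succ, hadj']
    | succ j => rw [hF1, hF1, treeTwo_adj_succ, hf.adj]

lemma exists_grow_of_inFamilyTwo [Fintype V] (h : InFamilyTwo G) :
    ∃ k v U₀, Path3 G U₀ v ∧ Grow G False v U₀ k univ := by
  obtain ⟨k, e, c, he, hc, ⟨ι⟩⟩ := h
  let φ := ι.symm
  have hφ : ∀ x y, G.Adj (φ x) (φ y) ↔ (treeTwo k e c).Adj x y := fun x y => φ.map_adj_iff
  have hi : ∀ x y, φ x = φ y ↔ x = y := fun x y => φ.injective.eq_iff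
  have hs : ∀ z, ∃ x, φ x = z := φ.surjective
  generalize (φ : _ → V) = φ at hφ hi hs
  rw [isLeafVertex_pathGraph_iff] at he
  let U₀ : Finset V := univ.image fun a => φ (0, a)
  have hU : ∀ z, z ∈ U₀ ↔ ∃ a, φ (0, a) = z := fun z => by simp [U₀]
  have hP : Path3 G U₀ (φ (0, e)) := by
    -- Since `e ≠ 1` is an end of the path, `e.rev` is the opposite end.
    refine ⟨φ (0, 1), φ (0, e.rev), ?_, ?_⟩
    · ext z
      rw [hU]
      simp only [mem_insert, mem_singleton, Fin.exists_fin_succ, IsEmpty.exists_iff, or_false,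
        Fin.succ_zero_eq_one, Fin.succ_one_eq_two]
      rw [eq_comm (a := z), eq_comm (a := z), eq_comm (a := z)]
      have h0 : Fin.rev (0 : Fin 3) = 2 := rfl
      have h1 : Fin.rev (2 : Fin 3) = 0 := rfl
      fin_cases e <;> simp only [Fin.zero_eta, Fin.mk_one, Fin.reduceFinMk, h0, h1] at he ⊢ <;>
        tauto
    · simp only [hφ, treeTwo_adj_zero, ne_eq, hi, SimpleGraph.pathGraph_adj]
      fin_cases e <;> simp_all
  have hC : Copies G U₀ (φ (0, e)) c fun i a => φ (i.succ, a) := by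
    refine ⟨fun i j a b hab => ?_, fun i a q => ?_, fun i j a b => ?_, fun u hu i a => ?_⟩
    · simpa [hi] using hab
    · obtain ⟨p, hp⟩ := (hU _).1 q
      rw [hi] at hp
      exact Fin.succ_ne_zero i (congrArg Prod.fst hp).symm
    · rw [hφ, treeTwo_adj_succ]
    · obtain ⟨p, rfl⟩ := (hU u).1 hu
      rw [hφ, treeTwo_adj_zero_succ, hi, Prod.mk.injEq, and_iff_right rfl]
  have hcov : cover U₀ (fun i a => φ (i.succ, a)) = univ := by
    refine eq_univ_iff_forall.2 fun z => mem_cover.2 ?_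
    obtain ⟨⟨i, a⟩, rfl⟩ := hs z
    cases i using Fin.cases with
    | zero => exact Or.inl ((hU _).2 ⟨a, rfl⟩)
    | succ i => exact Or.inr ⟨i, a, rfl⟩
  exact ⟨k, _, U₀, hP,
    hcov ▸ hC.grow hP.mem fun i q => isLeafVertex_pathGraph_iff.1 (hc i) q⟩

end FamilyTwo

end Dissociation

theorem theorem3p1 {V : Type*} [Finite V] (T : SimpleGraph V) (hT : T.IsTree)
    (ψ : ℕ) (hψ : dissociationNumber T = ψ) :
    (ψ = 1 → numMaximumDissociationSets T = 1) ∧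
    (Odd ψ → 3 ≤ ψ →
      numMaximumDissociationSets T ≤ 3 ^ ((ψ - 1) / 2 - 1) + 1 ∧
      (numMaximumDissociationSets T = 3 ^ ((ψ - 1) / 2 - 1) + 1 ↔ InFamilyOne T)) ∧
    (Even ψ →
      numMaximumDissociationSets T ≤ 3 ^ (ψ / 2 - 1) + ψ / 2 + 1 ∧
      (numMaximumDissociationSets T = 3 ^ (ψ / 2 - 1) + ψ / 2 + 1 ↔ InFamilyTwo T)) := by
  classical
  have := Fintype.ofFinite V
  have hc := Dissociation.conn_univ hT.connected
  have hs := Dissociation.sharpBound hT.isAcyclic hc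
  have hpos := Dissociation.psi_pos (G := T) hc.1
  rw [Dissociation.dissociationNumber_eq] at hψ
  rw [Dissociation.numMaximumDissociationSets_eq]
  subst hψ
  refine ⟨hs.one, fun hodd h3 => ?_, fun heven => ?_⟩
  · obtain ⟨m, hm⟩ := hodd
    obtain ⟨k, rfl⟩ := Nat.exists_eq_add_of_le' (by omega : 1 ≤ m)
    have hk : Dissociation.psi T Finset.univ = 2 * k + 3 := by omega
    rw [show (Dissociation.psi T Finset.univ - 1) / 2 - 1 = k by omega]
    refine ⟨hs.odd_le k hk, fun q => ?_, fun q => ?_⟩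
    · obtain ⟨v, U₀, h₀, hg⟩ := hs.odd_eq k hk q
      exact Dissociation.inFamilyOne_of_grow h₀ hg
    -- Conversely, the value of ψ determines the number of attached paths, and the exact count gives
    -- equality.
    · obtain ⟨j, v, U₀, h₀, hg⟩ := Dissociation.exists_grow_of_inFamilyOne q
      obtain ⟨h1, -, h2⟩ := hg.num_of_path4 h₀
      obtain rfl : j = k := by omega
      exact h2
  · obtain ⟨m, hm⟩ := heven
    obtain ⟨k, rfl⟩ := Nat.exists_eq_add_of_le' (by omega : 1 ≤ m)
    have hk : Dissociation.psi T Finset.univ = 2 * k + 2 := by omega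
    rw [show Dissociation.psi T Finset.univ / 2 = k + 1 by omega, Nat.add_sub_cancel]
    refine ⟨by have := hs.even_le k hk; omega, fun q => ?_, fun q => ?_⟩
    · obtain ⟨v, U₀, h₀, hg⟩ := hs.even_eq k hk (by omega)
      exact Dissociation.inFamilyTwo_of_grow h₀ hg
    · obtain ⟨j, v, U₀, h₀, hg⟩ := Dissociation.exists_grow_of_inFamilyTwo q
      obtain ⟨h1, -⟩ := hg.counts_of_path3 h₀
      have h2 := hg.num_of_path3 h₀
      obtain rfl : j = k := by omega
      omega
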